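/- Let $n\ge 1$ and let $B_1\subset\mathbb R^2$ be the open unit disc. For $u\in H^1(B_1;\mathbb R^n)$, identified on $\partial B_1$ with its trace, put $$W^V(u)=\int_{B_1}|\nabla u|^2\,dx-\int_{\partial B_1}|u|^2\,d\mathcal H^1+\big|\{|u|>0\}\cap B_1\big|,$$ where $|\nabla u|^2=\sum_{i=1}^n|\nabla u_i|^2$ and $|\cdot|$ of a subset of $B_1$ is its area. For $c\in H^1(\partial B_1;\mathbb R^n)$ let $z(x)=|x|\,c(x/|x|)$ be the one-homogeneous extension of $c$ to $B_1$; it belongs to $H^1(B_1;\mathbb R^n)$ and has trace $c$ on $\partial B_1$. Then for every $\delta_0>0$ there is $\varepsilon>0$ (depending only on $n$ and $\delta_0$) such that: (i) if $c\in H^1(\partial B_1;\mathbb R^n)$ and the length of $\{|c|>0\}\cap\partial B_1$ satisfies $\big|\{|c|>0\}\cap\partial B_1\big|\le 2\pi-\delta_0$, then there is $h\in H^1(B_1;\mathbb R^n)$ with $h=c$ on $\partial B_1$ in the sense of traces and $$W^V(h)-\frac{\pi}{2}\le(1-\varepsilon)\Big(W^V(z)-\frac{\pi}{2}\Big);$$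 (ii) if $c\in H^1(\partial B_1;\mathbb R^n)$, then there is $h\in H^1(B_1;\mathbb R^n)$ with $h=c$ on $\partial B_1$ in the sense of traces and $$W^V(h)-\pi\le(1-\varepsilon)\big(W^V(z)-\pi\big).$$ -/

import Mathlib

open MeasureTheory Set
open scoped ContDiff

noncomputable section

namespace Epi

/-- The Euclidean plane. -/
abbrev Plane : Type := EuclideanSpace ℝ (Fin 2)

/-- The Euclidean target space of dimension `n`. -/
abbrev Target (n : ℕ) : Type := EuclideanSpace ℝ (Fin n)

/-- The open unit disc `B₁` of the plane. -/
def disc : Set Plane := Metric.ball 0 1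

/-- The unit circle `∂B₁`. -/
def unitCircle : Set Plane := Metric.sphere 0 1

/-- The unit speed parametrization `θ ↦ (cos θ, sin θ)` of the unit circle. -/
def circlePoint (θ : ℝ) : Plane := !₂[Real.cos θ, Real.sin θ]

/-- The arc length measure on the unit circle, as a measure on the plane. -/
def arcLength : Measure Plane :=
  (volume.restrict (Ioc (-Real.pi) Real.pi)).map circlePoint

/-- The partial derivative `∂ⱼ φ`. -/
def partialDeriv (j : Fin 2) (φ : Plane → ℝ) (x : Plane) : ℝ :=
  fderiv ℝ φ x (EuclideanSpace.single j 1)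

/-- `g` is the weak derivative of `c`, with respect to arc length, on the unit circle:
`∫ φ' c = - ∫ φ g` for all smooth functions `φ` on the circle
(that is, smooth `2π`-periodic functions of the angle). -/
def IsWeakAngularDeriv {n : ℕ} (c g : Plane → Target n) : Prop :=
  ∀ φ : ℝ → ℝ, ContDiff ℝ ∞ φ → Function.Periodic φ (2 * Real.pi) →
    ∫ θ in Ioc (-Real.pi) Real.pi, deriv φ θ • c (circlePoint θ) =
      -∫ θ in Ioc (-Real.pi) Real.pi, φ θ • g (circlePoint θ)

/-- `c ∈ H¹(∂B₁; ℝⁿ)`. Only the values of `c` on the unit circle matter. -/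
def MemH1Circle {n : ℕ} (c : Plane → Target n) : Prop :=
  MemLp c 2 arcLength ∧
    ∃ g : Plane → Target n, MemLp g 2 arcLength ∧ IsWeakAngularDeriv c g

/-- `G = (G₁, G₂)` is a square integrable weak gradient of `u` on the disc:
`∫ ∂ⱼφ u = - ∫ φ Gⱼ` for all `φ ∈ C_c^∞(B₁)` and `j = 1, 2`. -/
structure IsWeakGradient {n : ℕ} (u : Plane → Target n) (G : Fin 2 → Plane → Target n) :
    Prop where
  memLp : ∀ j, MemLp (G j) 2 (volume.restrict disc)
  integral_eq : ∀ (j : Fin 2) (φ : Plane → ℝ), ContDiff ℝ ∞ φ → HasCompactSupport φ →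
    tsupport φ ⊆ disc →
    ∫ x in disc, partialDeriv j φ x • u x = -∫ x in disc, φ x • G j x

/-- `u ∈ H¹(B₁; ℝⁿ)`. -/
def MemH1Disc {n : ℕ} (u : Plane → Target n) : Prop :=
  MemLp u 2 (volume.restrict disc) ∧ ∃ G, IsWeakGradient u G

open Classical in
/-- The weak gradient `(∂₁u, ∂₂u)` of `u ∈ H¹(B₁; ℝⁿ)`; it is unique almost everywhere on the
disc, see `IsWeakGradient.ae_eq`. -/
def weakGradient {n : ℕ} (u : Plane → Target n) : Fin 2 → Plane → Target n :=
  if h : ∃ G, IsWeakGradient u G then h.choose else 0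

/-- `T ∈ L²(∂B₁; ℝⁿ)` is the trace on the unit circle of `u ∈ H¹(B₁; ℝⁿ)`:
the Gauss-Green formula `∫_{B₁} (∂ⱼφ u + φ ∂ⱼu) = ∫_{∂B₁} φ νⱼ T`, where `ν(x) = x` is the outer
unit normal, holds for all smooth functions `φ` on the plane and `j = 1, 2`. -/
structure IsTrace {n : ℕ} (u T : Plane → Target n) : Prop where
  memLp : MemLp T 2 arcLength
  integral_eq : ∀ (j : Fin 2) (φ : Plane → ℝ), ContDiff ℝ ∞ φ →
    ∫ x in disc, (partialDeriv j φ x • u x + φ x • weakGradient u j x) =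
      ∫ x, (φ x * x j) • T x ∂arcLength

open Classical in
/-- The trace on the unit circle of `u ∈ H¹(B₁; ℝⁿ)`; it is unique almost everywhere on the
circle, see `IsTrace.ae_eq`. -/
def trace {n : ℕ} (u : Plane → Target n) : Plane → Target n :=
  if h : ∃ T, IsTrace u T then h.choose else 0

/-- `W₀(u) = ∫_{B₁} |∇u|² dx - ∫_{∂B₁} |u|² dℋ¹`. -/
def weissZero {n : ℕ} (u : Plane → Target n) : ℝ :=
  (∫ x in disc, ∑ j, ‖weakGradient u j x‖ ^ 2) - ∫ x, ‖trace u x‖ ^ 2 ∂arcLength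

/-- Weiss' boundary adjusted energy `W^V(u) = W₀(u) + |{|u| > 0} ∩ B₁|`. -/
def weissV {n : ℕ} (u : Plane → Target n) : ℝ :=
  weissZero u + volume.real ({x | 0 < ‖u x‖} ∩ disc)

/-- The one-homogeneous extension `z(x) = |x| c(x / |x|)` of a function `c` on the circle. -/
def oneHomExt {n : ℕ} (c : Plane → Target n) (x : Plane) : Target n :=
  ‖x‖ • c (‖x‖⁻¹ • x)

theorem IsWeakGradient.ae_eq {n : ℕ} {u : Plane → Target n} {G H : Fin 2 → Plane → Target n}
    (hG : IsWeakGradient u G) (hH : IsWeakGradient u H) (j : Fin 2) :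
    G j =ᵐ[volume.restrict disc] H j := by
  have hfin : IsFiniteMeasure (volume.restrict disc) :=
    ⟨by simp [disc, measure_ball_lt_top]⟩
  have iG : Integrable (G j) (volume.restrict disc) := (hG.memLp j).integrable (by norm_num)
  have iH : Integrable (H j) (volume.restrict disc) := (hH.memLp j).integrable (by norm_num)
  have hU : IsOpen disc := Metric.isOpen_ball
  have key := hU.ae_eq_zero_of_integral_contDiff_smul_eq_zero (μ := (volume : Measure Plane))
    (f := fun x => G j x - H j x)
    ((IntegrableOn.locallyIntegrableOn (iG.sub iH)))
    (fun φ h1 h2 h3 => by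
      have e := (hG.integral_eq j φ h1 h2 h3).symm.trans (hH.integral_eq j φ h1 h2 h3)
      have hb : ∃ C, ∀ x, ‖φ x‖ ≤ C := h1.continuous.bounded_above_of_compact_support h2
      obtain ⟨C, hC⟩ := hb
      have jG : Integrable (fun x => φ x • G j x) (volume.restrict disc) :=
        iG.bdd_smul C h1.continuous.aestronglyMeasurable (Filter.Eventually.of_forall hC)
      have jH : Integrable (fun x => φ x • H j x) (volume.restrict disc) :=
        iH.bdd_smul C h1.continuous.aestronglyMeasurable (Filter.Eventually.of_forall hC)
      rw [← setIntegral_eq_integral_of_forall_compl_eq_zero (s := disc)]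
      · simp only [smul_sub]
        rw [integral_sub jG jH, sub_eq_zero]
        exact neg_injective e
      · intro x hx
        have : φ x = 0 := image_eq_zero_of_notMem_tsupport (fun h => hx (h3 h))
        simp [this])
  refine (ae_restrict_iff' hU.measurableSet).2 ?_
  filter_upwards [key] with x hx hxd
  exact sub_eq_zero.1 (hx hxd)

theorem measurable_circlePoint : Measurable circlePoint := by
  have : Continuous circlePoint := by unfold circlePoint; fun_prop
  exact this.measurable

instance : IsFiniteMeasure arcLength := by
  unfold arcLength; infer_instance

theorem ae_arcLength_mem_unitCircle : ∀ᵐ x ∂arcLength, x ∈ unitCircle := by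
  unfold arcLength
  refine (ae_map_iff measurable_circlePoint.aemeasurable
    Metric.isClosed_sphere.measurableSet).2 (Filter.Eventually.of_forall fun θ => ?_)
  simp [circlePoint, EuclideanSpace.norm_eq]

theorem IsTrace.ae_eq {n : ℕ} {u S T : Plane → Target n}
    (hS : IsTrace u S) (hT : IsTrace u T) : S =ᵐ[arcLength] T := by
  have iS : Integrable S arcLength := hS.memLp.integrable (by norm_num)
  have iT : Integrable T arcLength := hT.memLp.integrable (by norm_num)
  have key : ∀ᵐ x ∂arcLength, S x - T x = 0 :=
    ae_eq_zero_of_integral_contDiff_smul_eq_zero (iS.sub iT).locallyIntegrable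
      (fun φ h1 h2 => by
        have hb : ∀ j : Fin 2, ∃ C, ∀ x, ‖φ x * x j * x j‖ ≤ C := fun j =>
          Continuous.bounded_above_of_compact_support
            (by have := h1.continuous; fun_prop) (h2.mul_right.mul_right)
        have hint : ∀ (j : Fin 2) (R : Plane → Target n), Integrable R arcLength →
            Integrable (fun x => (φ x * x j * x j) • R x) arcLength := fun j R hR => by
          obtain ⟨C, hC⟩ := hb j
          exact hR.bdd_smul C
            (by have := h1.continuous; exact Continuous.aestronglyMeasurable (by fun_prop))
            (Filter.Eventually.of_forall hC)
        have e : ∀ j : Fin 2, ∫ x, (φ x * x j * x j) • S x ∂arcLength =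
            ∫ x, (φ x * x j * x j) • T x ∂arcLength := fun j => by
          have hc : ContDiff ℝ ∞ (fun x : Plane => φ x * x j) := by fun_prop
          exact (hS.integral_eq j _ hc).symm.trans (hT.integral_eq j _ hc)
        have split : ∀ R : Plane → Target n, Integrable R arcLength →
            ∫ x, φ x • R x ∂arcLength =
              ∑ j : Fin 2, ∫ x, (φ x * x j * x j) • R x ∂arcLength := fun R hR => by
          rw [← integral_finsetSum _ (fun j _ => hint j R hR)]
          refine integral_congr_ae ?_
          filter_upwards [ae_arcLength_mem_unitCircle] with x hx
          have hx1 : x 0 ^ 2 + x 1 ^ 2 = 1 := by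
            have : ‖x‖ ^ 2 = 1 := by
              have : ‖x‖ = 1 := by simpa [unitCircle] using hx
              rw [this]; norm_num
            rw [EuclideanSpace.norm_sq_eq] at this
            simpa [Fin.sum_univ_two] using this
          simp only [Fin.sum_univ_two]
          rw [← add_smul]
          congr 1
          linear_combination (-φ x) * hx1
        obtain ⟨C, hC⟩ := h1.continuous.bounded_above_of_compact_support h2
        have jS : Integrable (fun x => φ x • S x) arcLength :=
          iS.bdd_smul C h1.continuous.aestronglyMeasurable (Filter.Eventually.of_forall hC)
        have jT : Integrable (fun x => φ x • T x) arcLength :=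
          iT.bdd_smul C h1.continuous.aestronglyMeasurable (Filter.Eventually.of_forall hC)
        simp only [smul_sub]
        rw [integral_sub jS jT, split S iS, split T iT, sub_eq_zero]
        exact Finset.sum_congr rfl fun j _ => e j)
  filter_upwards [key] with x hx
  exact sub_eq_zero.1 hx

end Epi

end

/-! Write F(c) for the integral of |c'|² - |c|² over the circle plus the length of {c ≠ 0}. By
homogeneity W^V(z) = F(c)/2. A function u(r, θ) = r c_r(θ) with c_1 = c satisfies the slicing
formula W^V(u) = ∫₀¹ r F(c_r) dr + ∫₀¹ r³ ∫ |∂_r c_r|² dθ dr. It therefore suffices to let the trace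
evolve, as r decreases from 1, so that F(c_r) approaches a limit value L at a rate linear in t = s(1
- r). The radial speed is of order s, so its cost is of order s².

If the slices satisfy F(c_r) - L ≤ (1 - t)(F(c) - L) - tE and the kinetic cost is at most a constant
times s²E, then a small s gives W^V(u) - L/2 ≤ (1 - s/3)(W^V(z) - L/2). Raising L only weakens this
inequality. So L ≤ 2π yields (ii), and (i) needs L ≤ π whenever the positivity set has length at
most 2π - δ.

The evolution is built separately on arcs whose end points are zeros of c. On an arc [a, b] the
angles move affinely towards a target arc [A, B] of length L. The low Dirichlet modes v ride along,
while the remainder w is multiplied by 1 - Ks(1 - r). A spectral gap of w above 1 pays for its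
damping and dilation (`damped_bound`). A kept mode whose frequency becomes 1 on the target gains
only an amount of order (Λ - 1)², where Λ is the ratio of the lengths. Hence the displacements of
its arc must be of order |Λ - 1| (`mode_gain`, `fills_of_modes`). Competitors on adjacent arcs live
in disjoint wedges, so their energies add (`Fills.append`).

The targets depend on the zero-free arcs longer than π - δ/2 (`exists_fills`). If there is none,
everything contracts to a point and L = 0. If there is one, of length at most 2π - δ, it is moved to
length π and the rest contracts, so L = π. If there are two, they are moved to two half circles. A
single arc longer than 2π - δ is stretched to the whole circle with two kept modes. A datum without
zeros keeps its trigonometric modes of degree at most one and does not move. In these last three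
cases L = 2π and the positivity set is longer than 2π - δ.

The spectral gaps come from the Wirtinger inequality and a min-max argument (`EigenFamily.gap`). A
Gauss-Green formula in moving polar coordinates identifies weak gradients and traces. -/

noncomputable section

/-! ### Primitives with square integrable derivative and the Wirtinger inequality -/

namespace Epi

/-- `b` is a primitive of the locally integrable function `b'`. -/
structure IsPrimitive {E : Type*} [NormedAddCommGroup E] [NormedSpace ℝ E] (b b' : ℝ → E) :
    Prop where
  int : ∀ x y, IntervalIntegrable b' volume x y
  eq : ∀ x y, ∫ t in x..y, b' t = b y - b x

/-- `b` is a primitive of the locally square integrable function `b'`. -/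
structure IsH1 {E : Type*} [NormedAddCommGroup E] [NormedSpace ℝ E] (b b' : ℝ → E) : Prop
    extends IsPrimitive b b' where
  meas : StronglyMeasurable b'
  sq : ∀ x y, IntervalIntegrable (fun t => ‖b' t‖ ^ 2) volume x y

namespace IsPrimitive

section General

variable {E : Type*} [NormedAddCommGroup E] [NormedSpace ℝ E] {b b' d d' : ℝ → E}

theorem continuous (h : IsPrimitive b b') : Continuous b := by
  have : b = fun y => b 0 + ∫ t in (0 : ℝ)..y, b' t := by
    ext y; rw [h.eq]; abel
  rw [this]
  exact continuous_const.add (intervalIntegral.continuous_primitive h.int 0)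

theorem add (h : IsPrimitive b b') (k : IsPrimitive d d') :
    IsPrimitive (fun t => b t + d t) (fun t => b' t + d' t) where
  int x y := (h.int x y).add (k.int x y)
  eq x y := by
    rw [intervalIntegral.integral_add (h.int x y) (k.int x y), h.eq, k.eq]; abel

theorem of_hasDerivAt [CompleteSpace E] (h : ∀ t, HasDerivAt b (b' t) t) (hc : Continuous b') :
    IsPrimitive b b' where
  int x y := hc.intervalIntegrable x y
  eq x y := intervalIntegral.integral_eq_sub_of_hasDerivAt (fun t _ => h t)
    (hc.intervalIntegrable x y)

end General

section Real

variable {f f' g g' : ℝ → ℝ}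

theorem absolutelyContinuousOnInterval (h : IsPrimitive f f') (x y : ℝ) :
    AbsolutelyContinuousOnInterval f x y := by
  have : f = fun z => f x + ∫ t in x..z, f' t := by
    ext z; rw [h.eq]; abel
  rw [this]
  exact (LipschitzWith.const (f x)).lipschitzOnWith.absolutelyContinuousOnInterval.add
    ((h.int x y).absolutelyContinuousOnInterval_intervalIntegral left_mem_uIcc)

theorem deriv_ae_eq (h : IsPrimitive f f') (x y : ℝ) :
    ∀ᵐ t, t ∈ uIcc x y → deriv f t = f' t := by
  filter_upwards [(h.int x y).ae_hasDerivAt_integral] with t ht htm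
  have : f = fun z => f x + ∫ t in x..z, f' t := by
    ext z; rw [h.eq]; abel
  rw [this]
  exact ((ht htm x left_mem_uIcc).const_add _).deriv

/-- The product rule for an absolutely continuous function and a primitive. -/
theorem integral_mul_add (h : IsPrimitive f f') {T : ℝ → ℝ} {x y : ℝ}
    (hT : AbsolutelyContinuousOnInterval T x y) :
    ∫ t in x..y, (deriv T t * f t + T t * f' t) = T y * f y - T x * f x := by
  rw [← hT.integral_deriv_mul_eq_sub (h.absolutelyContinuousOnInterval x y)]
  refine intervalIntegral.integral_congr_ae ?_
  filter_upwards [h.deriv_ae_eq x y] with t ht htm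
  rw [ht (uIoc_subset_uIcc htm)]

theorem mul (h : IsPrimitive f f') (k : IsPrimitive g g') :
    IsPrimitive (fun t => f t * g t) (fun t => f' t * g t + f t * g' t) where
  int x y := ((h.int x y).mul_continuousOn k.continuous.continuousOn).add
    ((k.int x y).continuousOn_mul h.continuous.continuousOn)
  eq x y := by
    rw [← k.integral_mul_add (h.absolutelyContinuousOnInterval x y)]
    refine intervalIntegral.integral_congr_ae ?_
    filter_upwards [h.deriv_ae_eq x y] with t ht htm
    rw [ht (uIoc_subset_uIcc htm)]

end Real

section Vector

variable {n : ℕ} {b b' d d' : ℝ → Target n} {f f' : ℝ → ℝ}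

theorem apply (h : IsPrimitive b b') (i : Fin n) :
    IsPrimitive (fun t => b t i) (fun t => b' t i) where
  int x y := ⟨(EuclideanSpace.proj i : Target n →L[ℝ] ℝ).integrable_comp (h.int x y).1,
    (EuclideanSpace.proj i : Target n →L[ℝ] ℝ).integrable_comp (h.int x y).2⟩
  eq x y := by
    have := (EuclideanSpace.proj i : Target n →L[ℝ] ℝ).intervalIntegral_comp_comm (h.int x y)
    simpa [h.eq] using this

theorem smul (h : IsPrimitive f f') (k : IsPrimitive b b') :
    IsPrimitive (fun t => f t • b t) (fun t => f' t • b t + f t • b' t) := by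
  have hint : ∀ x y, IntervalIntegrable (fun t => f' t • b t + f t • b' t) volume x y :=
    fun x y => ((h.int x y).smul_continuousOn k.continuous.continuousOn).add
      ((k.int x y).continuousOn_smul h.continuous.continuousOn)
  refine ⟨hint, fun x y => ?_⟩
  ext i
  have := (EuclideanSpace.proj i : Target n →L[ℝ] ℝ).intervalIntegral_comp_comm (hint x y)
  have h2 := (h.mul (k.apply i)).eq x y
  simp only [PiLp.proj_apply, PiLp.add_apply, PiLp.smul_apply, smul_eq_mul, PiLp.sub_apply]
    at this h2 ⊢
  rw [← this, h2]

theorem inner (h : IsPrimitive b b') (k : IsPrimitive d d') :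
    IsPrimitive (fun t => inner ℝ (b t) (d t))
      (fun t => inner ℝ (b' t) (d t) + inner ℝ (b t) (d' t)) := by
  have hs : ∀ s : Finset (Fin n), IsPrimitive (fun t => ∑ i ∈ s, b t i * d t i)
      (fun t => ∑ i ∈ s, (b' t i * d t i + b t i * d' t i)) := by
    intro s
    induction s using Finset.induction_on with
    | empty => exact ⟨fun x y => by simp, fun x y => by simp⟩
    | insert i s hi ih =>
      simp only [Finset.sum_insert hi]
      exact ((h.apply i).mul (k.apply i)).add ih
  have := hs Finset.univ
  simpa [PiLp.inner_apply, Finset.sum_add_distrib, mul_comm] using this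

end Vector

end IsPrimitive

namespace IsH1

variable {n : ℕ} {b b' d d' : ℝ → Target n}

theorem _root_.Epi.sq_norm_add_le {E : Type*} [SeminormedAddCommGroup E] (a b : E) :
    ‖a + b‖ ^ 2 ≤ 2 * ‖a‖ ^ 2 + 2 * ‖b‖ ^ 2 := by
  nlinarith [norm_add_le a b, norm_nonneg (a + b), norm_nonneg a, norm_nonneg b,
    sq_nonneg (‖a‖ - ‖b‖)]

theorem add (h : IsH1 b b') (k : IsH1 d d') :
    IsH1 (fun t => b t + d t) (fun t => b' t + d' t) where
  toIsPrimitive := h.toIsPrimitive.add k.toIsPrimitive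
  meas := h.meas.add k.meas
  sq x y := by
    refine (((h.sq x y).const_mul 2).add ((k.sq x y).const_mul 2)).mono_fun
      ((h.meas.add k.meas).norm.pow 2).aestronglyMeasurable (Filter.Eventually.of_forall fun t => ?_)
    simp only [Real.norm_eq_abs, abs_pow, abs_norm]
    exact (sq_norm_add_le _ _).trans (le_abs_self _)

theorem neg (h : IsH1 b b') : IsH1 (fun t => -b t) (fun t => -b' t) where
  int x y := (h.int x y).neg
  eq x y := by rw [intervalIntegral.integral_neg, h.eq]; abel
  meas := h.meas.neg
  sq x y := by simpa using h.sq x y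

theorem sub (h : IsH1 b b') (k : IsH1 d d') :
    IsH1 (fun t => b t - d t) (fun t => b' t - d' t) := by
  simpa [sub_eq_add_neg] using h.add k.neg

theorem of_hasDerivAt (h : ∀ t, HasDerivAt b (b' t) t) (hc : Continuous b') : IsH1 b b' where
  toIsPrimitive := .of_hasDerivAt h hc
  meas := hc.stronglyMeasurable
  sq x y := (hc.norm.pow 2).intervalIntegrable x y

theorem inner_int (h : IsH1 b b') (k : IsH1 d d') (x y : ℝ) :
    IntervalIntegrable (fun t => inner ℝ (b' t) (d' t)) volume x y := by
  refine ((h.sq x y).add (k.sq x y)).mono_fun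
    (h.meas.inner k.meas).aestronglyMeasurable (Filter.Eventually.of_forall fun t => ?_)
  have := abs_real_inner_le_norm (b' t) (d' t)
  show ‖_‖ ≤ ‖‖b' t‖ ^ 2 + ‖d' t‖ ^ 2‖
  rw [Real.norm_eq_abs, Real.norm_of_nonneg (by positivity)]
  nlinarith [sq_nonneg (‖b' t‖ - ‖d' t‖)]

/-- The **Wirtinger inequality** with a constant smaller than the optimal one. -/
theorem _root_.Epi.IsPrimitive.wirtinger_of_lt {f f' : ℝ → ℝ} (h : IsPrimitive f f') {x y l : ℝ}
    (hxy : x < y) (hsq : IntervalIntegrable (fun t => f' t ^ 2) volume x y)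
    (hx : f x = 0) (hy : f y = 0) (hl0 : 0 < l) (hl : l < Real.pi / (y - x)) :
    l ^ 2 * ∫ t in x..y, f t ^ 2 ≤ ∫ t in x..y, f' t ^ 2 := by
  have hyx : 0 < y - x := sub_pos.2 hxy
  set m := (x + y) / 2 with hm
  -- `T` solves the Riccati equation T' = l² + T², so (f' + T f)² = f'² - l² f² + (T f²)'. The last
  -- term integrates to zero because f vanishes at both ends. Centring at the midpoint and l < π/(y
  -- - x) keep the argument of the tangent inside (-π/2, π/2) up to the end points.
  set T : ℝ → ℝ := fun t => l * Real.tan (l * (t - m)) with hT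
  have hlp : l * (y - x) < Real.pi := by rwa [lt_div_iff₀ hyx] at hl
  have hcos : ∀ t ∈ Icc x y, 0 < Real.cos (l * (t - m)) := by
    intro t ht
    apply Real.cos_pos_of_mem_Ioo
    constructor <;> [skip; skip] <;> nlinarith [ht.1, ht.2]
  have hd : ∀ t ∈ Icc x y, HasDerivAt T (l ^ 2 + T t ^ 2) t := by
    intro t ht
    have h1 : HasDerivAt (fun t => l * (t - m)) l t := by
      simpa using ((hasDerivAt_id t).sub_const m).const_mul l
    have := ((Real.hasDerivAt_tan (hcos t ht).ne').comp t h1).const_mul l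
    refine this.congr_deriv ?_
    have hc := (hcos t ht).ne'
    simp only [hT, Real.tan_eq_sin_div_cos]
    field_simp
    linear_combination (-1) * (Real.sin_sq_add_cos_sq (l * (t - m)))
  have hTc : ContinuousOn T (Icc x y) := fun t ht => (hd t ht).continuousAt.continuousWithinAt
  have hTac : AbsolutelyContinuousOnInterval T x y := by
    have : ContDiffOn ℝ 1 T (uIcc x y) := by
      rw [uIcc_of_le hxy.le]
      intro t ht
      have h1 : ContDiffAt ℝ 1 (fun t => l * (t - m)) t := by fun_prop
      exact (contDiffAt_const.mul
        ((Real.contDiffAt_tan.2 (hcos t ht).ne').comp t h1)).contDiffWithinAt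
    exact this.absolutelyContinuousOnInterval
  have key := (h.mul h).integral_mul_add hTac
  simp only [hx, hy, mul_zero, sub_zero] at key
  have e1 : ∫ t in x..y, (deriv T t * (f t * f t) + T t * (f' t * f t + f t * f' t)) =
      ∫ t in x..y, ((f' t + T t * f t) ^ 2 + l ^ 2 * f t ^ 2 - f' t ^ 2) := by
    refine intervalIntegral.integral_congr fun t ht => ?_
    rw [uIcc_of_le hxy.le] at ht
    simp only [(hd t ht).deriv]
    ring
  have hfc := h.continuous
  have i2 : IntervalIntegrable (fun t => l ^ 2 * f t ^ 2) volume x y :=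
    (by fun_prop : Continuous fun t => l ^ 2 * f t ^ 2).intervalIntegrable _ _
  have hTf : ContinuousOn (fun t => T t * f t) (uIcc x y) := by
    rw [uIcc_of_le hxy.le]; exact hTc.mul hfc.continuousOn
  have i1 : IntervalIntegrable (fun t => (f' t + T t * f t) ^ 2) volume x y := by
    have : (fun t => (f' t + T t * f t) ^ 2) =
      fun t => f' t ^ 2 + (2 * (T t * f t) * f' t + (T t * f t) ^ 2) := by ext t; ring
    rw [this]
    exact hsq.add (((h.int x y).continuousOn_mul (hTf.const_smul (2:ℝ))).add
      (hTf.pow 2).intervalIntegrable)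
  rw [e1, intervalIntegral.integral_sub (i1.add i2) hsq, intervalIntegral.integral_add i1 i2,
    intervalIntegral.integral_const_mul] at key
  have : 0 ≤ ∫ t in x..y, (f' t + T t * f t) ^ 2 :=
    intervalIntegral.integral_nonneg hxy.le fun t _ => sq_nonneg _
  linarith

theorem sq_apply_int (h : IsH1 b b') (i : Fin n) (x y : ℝ) :
    IntervalIntegrable (fun t => b' t i ^ 2) volume x y := by
  refine (h.sq x y).mono_fun ?_ (Filter.Eventually.of_forall fun t => ?_)
  · have := (EuclideanSpace.proj i : Target n →L[ℝ] ℝ).continuous.comp_stronglyMeasurable h.meas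
    exact (this.pow 2).aestronglyMeasurable
  · simp only [Real.norm_eq_abs, abs_pow, abs_norm]
    have := PiLp.norm_apply_le (b' t) i
    rw [Real.norm_eq_abs] at this
    gcongr

/-- The **Wirtinger inequality** for functions vanishing at the end points of an interval. -/
theorem wirtinger (h : IsH1 b b') {x y : ℝ} (hxy : x < y) (hx : b x = 0) (hy : b y = 0) :
    (Real.pi / (y - x)) ^ 2 * ∫ t in x..y, ‖b t‖ ^ 2 ≤ ∫ t in x..y, ‖b' t‖ ^ 2 := by
  have hyx : 0 < y - x := sub_pos.2 hxy
  have hL : 0 < Real.pi / (y - x) := by positivity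
  have hlt : ∀ l ∈ Ioo 0 (Real.pi / (y - x)),
      l ^ 2 * ∫ t in x..y, ‖b t‖ ^ 2 ≤ ∫ t in x..y, ‖b' t‖ ^ 2 := by
    intro l hl
    have hc := h.continuous
    have e1 : ∫ t in x..y, ‖b t‖ ^ 2 = ∑ i, ∫ t in x..y, b t i ^ 2 := by
      rw [← intervalIntegral.integral_finsetSum]
      · simp [EuclideanSpace.norm_sq_eq]
      · intro i _
        exact (by fun_prop : Continuous fun t => b t i ^ 2).intervalIntegrable _ _
    have e2 : ∫ t in x..y, ‖b' t‖ ^ 2 = ∑ i, ∫ t in x..y, b' t i ^ 2 := by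
      rw [← intervalIntegral.integral_finsetSum]
      · simp [EuclideanSpace.norm_sq_eq]
      · intro i _
        exact h.sq_apply_int i x y
    rw [e1, e2, Finset.mul_sum]
    refine Finset.sum_le_sum fun i _ => ?_
    exact (h.toIsPrimitive.apply i).wirtinger_of_lt hxy (h.sq_apply_int i x y) (by simp [hx])
      (by simp [hy]) hl.1 hl.2
  -- At the optimal constant the tangent blows up at the end points, so that constant is reached
  -- only as a limit.
  have hcl : Real.pi / (y - x) ∈ closure (Ioo 0 (Real.pi / (y - x))) := by
    rw [closure_Ioo hL.ne]; exact right_mem_Icc.2 hL.le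
  have := closure_minimal hlt (isClosed_le ((continuous_pow 2).mul continuous_const) continuous_const) hcl
  exact this

end IsH1

end Epi

end

/-! ### Orthogonal families of eigenfunctions and the min-max principle -/

noncomputable section

namespace Epi

/-- A finite orthogonal family of solutions of `s'' = -μ s` on `[y₀, y₁]`, for boundary conditions
that make the boundary terms of the Green formula vanish. -/
structure EigenFamily {ι : Type*} (s s' : ι → ℝ → ℝ) (μ N : ι → ℝ) (y₀ y₁ : ℝ) : Prop where
  hasDeriv : ∀ i t, HasDerivAt (s i) (s' i t) t
  hasDeriv' : ∀ i t, HasDerivAt (s' i) (-(μ i) * s i t) t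
  bd : ∀ i j, s' i y₁ * s j y₁ = s' i y₀ * s j y₀
  orth : ∀ i j, i ≠ j → ∫ t in y₀..y₁, s i t * s j t = 0
  norm : ∀ i, ∫ t in y₀..y₁, s i t * s i t = N i
  pos : ∀ i, 0 < N i

/-- The combination of a family of scalar functions with vector coefficients. -/
def combo {ι : Type*} [Fintype ι] {n : ℕ} (s : ι → ℝ → ℝ) (B : ι → Target n) (t : ℝ) : Target n :=
  ∑ i, s i t • B i

namespace EigenFamily

variable {ι : Type*} [Fintype ι] {n : ℕ} {s s' : ι → ℝ → ℝ} {μ N : ι → ℝ} {y₀ y₁ : ℝ}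
  {w w' : ℝ → Target n}

omit [Fintype ι] in
theorem cont (h : EigenFamily s s' μ N y₀ y₁) (i : ι) : Continuous (s i) :=
  continuous_iff_continuousAt.2 fun t => (h.hasDeriv i t).continuousAt

omit [Fintype ι] in
theorem cont' (h : EigenFamily s s' μ N y₀ y₁) (i : ι) : Continuous (s' i) :=
  continuous_iff_continuousAt.2 fun t => (h.hasDeriv' i t).continuousAt

theorem isH1_combo (h : EigenFamily s s' μ N y₀ y₁) (B : ι → Target n) :
    IsH1 (combo s B) (combo s' B) := by
  refine IsH1.of_hasDerivAt (fun t => ?_) ?_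
  · exact HasDerivAt.fun_sum fun i _ => (h.hasDeriv i t).smul_const (B i)
  · exact continuous_finsetSum _ fun i _ => (h.cont' i).smul continuous_const

theorem integral_smul_combo (h : EigenFamily s s' μ N y₀ y₁) (B : ι → Target n) (i : ι) :
    ∫ t in y₀..y₁, s i t • combo s B t = N i • B i := by
  classical
  simp only [combo, Finset.smul_sum, smul_smul]
  rw [intervalIntegral.integral_finsetSum]
  · simp only [intervalIntegral.integral_smul_const]
    rw [Finset.sum_eq_single i, h.norm]
    · intro j _ hj
      rw [h.orth i j hj.symm, zero_smul]
    · simp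
  · intro j _
    exact (((h.cont i).mul (h.cont j)).smul continuous_const).intervalIntegrable _ _

omit [Fintype ι] in
/-- Integration by parts against a member of the family. -/
theorem integral_smul_deriv (h : EigenFamily s s' μ N y₀ y₁) (hw : IsPrimitive w w') (i : ι)
    (hb : s' i y₁ • w y₁ = s' i y₀ • w y₀) :
    ∫ t in y₀..y₁, s' i t • w' t = μ i • ∫ t in y₀..y₁, s i t • w t := by
  have h1 : IsPrimitive (s' i) (fun t => -(μ i) * s i t) :=
    .of_hasDerivAt (h.hasDeriv' i) (continuous_const.mul (h.cont i))
  have e := (h1.smul hw).eq y₀ y₁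
  rw [intervalIntegral.integral_add, hb, sub_self] at e
  · rw [eq_neg_of_add_eq_zero_right e, ← intervalIntegral.integral_smul,
      ← intervalIntegral.integral_neg]
    simp [smul_smul]
  · exact ((continuous_const.mul (h.cont i)).smul hw.continuous).intervalIntegrable _ _
  · exact (hw.int y₀ y₁).continuousOn_smul (h.cont' i).continuousOn

theorem integral_inner_combo {r : ι → ℝ → ℝ} {f : ℝ → Target n} (B : ι → Target n)
    (hi : ∀ i, IntervalIntegrable (fun t => r i t • f t) volume y₀ y₁) :
    ∫ t in y₀..y₁, inner ℝ (combo r B t) (f t) =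
      ∑ i, inner ℝ (B i) (∫ t in y₀..y₁, r i t • f t) := by
  have : ∀ t, inner ℝ (combo r B t) (f t) = ∑ i, inner ℝ (B i) (r i t • f t) := fun t => by
    simp [combo, sum_inner, inner_smul_left, inner_smul_right]
  simp only [this]
  rw [intervalIntegral.integral_finsetSum]
  · refine Finset.sum_congr rfl fun i _ => ?_
    exact (innerSL ℝ (B i)).intervalIntegral_comp_comm (hi i)
  · intro i _
    exact ⟨(innerSL ℝ (B i)).integrable_comp (hi i).1, (innerSL ℝ (B i)).integrable_comp (hi i).2⟩

theorem integral_norm_combo (h : EigenFamily s s' μ N y₀ y₁) (B : ι → Target n) :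
    ∫ t in y₀..y₁, ‖combo s B t‖ ^ 2 = ∑ i, N i * ‖B i‖ ^ 2 := by
  simp only [← real_inner_self_eq_norm_sq]
  rw [integral_inner_combo B fun i =>
    ((h.cont i).smul (h.isH1_combo B).continuous).intervalIntegrable _ _]
  simp [h.integral_smul_combo, inner_smul_right]

theorem combo_bd (h : EigenFamily s s' μ N y₀ y₁) (B : ι → Target n) (i : ι) :
    s' i y₁ • combo s B y₁ = s' i y₀ • combo s B y₀ := by
  simp only [combo, Finset.smul_sum, smul_smul, h.bd]

theorem integral_norm_combo_deriv (h : EigenFamily s s' μ N y₀ y₁) (B : ι → Target n) :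
    ∫ t in y₀..y₁, ‖combo s' B t‖ ^ 2 = ∑ i, μ i * (N i * ‖B i‖ ^ 2) := by
  simp only [← real_inner_self_eq_norm_sq]
  have hc : Continuous (combo s' B) :=
    continuous_finsetSum _ fun i _ => (h.cont' i).smul continuous_const
  rw [integral_inner_combo B fun i => ((h.cont' i).smul hc).intervalIntegrable _ _]
  simp [h.integral_smul_deriv (h.isH1_combo B).toIsPrimitive _ (h.combo_bd B _),
    h.integral_smul_combo, inner_smul_right]

theorem integral_inner_eq_zero (h : EigenFamily s s' μ N y₀ y₁) (hw : IsPrimitive w w')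
    (ho : ∀ i, ∫ t in y₀..y₁, s i t • w t = 0) (B : ι → Target n) :
    ∫ t in y₀..y₁, inner ℝ (combo s B t) (w t) = 0 := by
  rw [integral_inner_combo B fun i => ((h.cont i).smul hw.continuous).intervalIntegrable _ _]
  simp [ho]

theorem integral_inner_deriv_eq_zero (h : EigenFamily s s' μ N y₀ y₁) (hw : IsPrimitive w w')
    (ho : ∀ i, ∫ t in y₀..y₁, s i t • w t = 0)
    (hb : ∀ i, s' i y₁ • w y₁ = s' i y₀ • w y₀) (B : ι → Target n) :
    ∫ t in y₀..y₁, inner ℝ (combo s' B t) (w' t) = 0 := by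
  rw [integral_inner_combo B fun i => (hw.int y₀ y₁).continuousOn_smul (h.cont' i).continuousOn]
  simp [h.integral_smul_deriv hw _ (hb _), ho]

end EigenFamily

theorem integral_norm_sub_sq {n : ℕ} {f g : ℝ → Target n} {x y : ℝ}
    (hf : IntervalIntegrable (fun t => ‖f t‖ ^ 2) volume x y)
    (hg : IntervalIntegrable (fun t => ‖g t‖ ^ 2) volume x y)
    (hfg : IntervalIntegrable (fun t => inner ℝ (g t) (f t)) volume x y)
    (h0 : ∫ t in x..y, inner ℝ (g t) (f t) = 0) :
    ∫ t in x..y, ‖f t - g t‖ ^ 2 = (∫ t in x..y, ‖f t‖ ^ 2) + ∫ t in x..y, ‖g t‖ ^ 2 := by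
  have : ∀ t, ‖f t - g t‖ ^ 2 = ‖f t‖ ^ 2 + ‖g t‖ ^ 2 - 2 * inner ℝ (g t) (f t) := fun t => by
    rw [norm_sub_sq_real, real_inner_comm]; ring
  simp only [this]
  rw [intervalIntegral.integral_sub (hf.add hg) (hfg.const_mul 2),
    intervalIntegral.integral_add hf hg, intervalIntegral.integral_const_mul, h0]
  ring

namespace EigenFamily

variable {ι : Type*} [Fintype ι] {n : ℕ} {s s' : ι → ℝ → ℝ} {μ N : ι → ℝ} {y₀ y₁ : ℝ}
  {c c' w w' : ℝ → Target n}

/-- The min-max principle: a function that is orthogonal to the family satisfies a Poincaré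
inequality as soon as some corrected function does. -/
theorem gap (h : EigenFamily s s' μ N y₀ y₁) (hw : IsH1 w w')
    (ho : ∀ i, ∫ t in y₀..y₁, s i t • w t = 0)
    (hb : ∀ i, s' i y₁ • w y₁ = s' i y₀ • w y₀) {κ : ℝ} (hμ : ∀ i, μ i ≤ κ)
    (hB : ∃ B : ι → Target n, κ * ∫ t in y₀..y₁, ‖w t - combo s B t‖ ^ 2 ≤
      ∫ t in y₀..y₁, ‖w' t - combo s' B t‖ ^ 2) :
    κ * ∫ t in y₀..y₁, ‖w t‖ ^ 2 ≤ ∫ t in y₀..y₁, ‖w' t‖ ^ 2 := by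
  -- `w` and `combo s B` are orthogonal both in mass and in Dirichlet energy, so both sides of the
  -- corrected inequality split. The Dirichlet energy of the combination is at most κ times its
  -- mass, so its contribution can be dropped.
  obtain ⟨B, hB⟩ := hB
  have hv := h.isH1_combo B
  have hwc := hw.continuous
  have hvc := hv.continuous
  rw [integral_norm_sub_sq ((hwc.norm.pow 2).intervalIntegrable _ _)
      ((hvc.norm.pow 2).intervalIntegrable _ _)
      ((hvc.inner hwc).intervalIntegrable _ _) (h.integral_inner_eq_zero hw.toIsPrimitive ho B),
    integral_norm_sub_sq (hw.sq _ _) (hv.sq _ _) (hv.inner_int hw _ _)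
      (h.integral_inner_deriv_eq_zero hw.toIsPrimitive ho hb B),
    h.integral_norm_combo, h.integral_norm_combo_deriv] at hB
  have : ∑ i, μ i * (N i * ‖B i‖ ^ 2) ≤ κ * ∑ i, N i * ‖B i‖ ^ 2 := by
    rw [Finset.mul_sum]
    refine Finset.sum_le_sum fun i _ => ?_
    have := (h.pos i).le
    gcongr
    exact hμ i
  linarith

/-- The coefficients of the orthogonal projection to the family. -/
def _root_.Epi.projCoeff (s : ι → ℝ → ℝ) (N : ι → ℝ) (y₀ y₁ : ℝ) (c : ℝ → Target n) (i : ι) :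
    Target n :=
  (N i)⁻¹ • ∫ t in y₀..y₁, s i t • c t

theorem integral_smul_sub_proj (h : EigenFamily s s' μ N y₀ y₁) (hc : Continuous c) (i : ι) :
    ∫ t in y₀..y₁, s i t • (c t - combo s (projCoeff s N y₀ y₁ c) t) = 0 := by
  have hv := (h.isH1_combo (projCoeff s N y₀ y₁ c)).continuous
  simp only [smul_sub]
  have e := intervalIntegral.integral_sub (((h.cont i).smul hc).intervalIntegrable y₀ y₁ (μ := volume))
    (((h.cont i).smul hv).intervalIntegrable y₀ y₁)
  simp only [Pi.smul_apply'] at e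
  rw [e, h.integral_smul_combo, projCoeff, smul_smul,
    mul_inv_cancel₀ (h.pos i).ne', one_smul, sub_self]

end EigenFamily

end Epi

end

/-! ### Dirichlet eigenfunctions of an interval -/

noncomputable section

namespace Epi

/-- The Wronskian f' g - g' f has derivative (b - a) f g, and the boundary conditions give it equal
values at the two ends. -/
theorem integral_mul_eq_zero_of_ne {f f' g g' : ℝ → ℝ} {a b x y : ℝ}
    (hf : ∀ t, HasDerivAt f (f' t) t) (hf' : ∀ t, HasDerivAt f' (-a * f t) t)
    (hg : ∀ t, HasDerivAt g (g' t) t) (hg' : ∀ t, HasDerivAt g' (-b * g t) t)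
    (hab : a ≠ b) (h1 : f' y * g y = f' x * g x) (h2 : g' y * f y = g' x * f x) :
    ∫ t in x..y, f t * g t = 0 := by
  have hfc : Continuous f := continuous_iff_continuousAt.2 fun t => (hf t).continuousAt
  have hgc : Continuous g := continuous_iff_continuousAt.2 fun t => (hg t).continuousAt
  have hd : ∀ t, HasDerivAt (fun t => f' t * g t - g' t * f t) ((b - a) * (f t * g t)) t := by
    intro t
    refine (((hf' t).mul (hg t)).sub ((hg' t).mul (hf t))).congr_deriv ?_
    ring
  have e := intervalIntegral.integral_eq_sub_of_hasDerivAt (a := x) (b := y) (fun t _ => hd t)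
    ((continuous_const.mul (hfc.mul hgc)).intervalIntegrable _ _)
  rw [intervalIntegral.integral_const_mul, h1, h2, sub_self] at e
  exact (mul_eq_zero.1 e).resolve_left (sub_ne_zero.2 hab.symm)

/-- The conserved quantity f'² + a f² = a makes t/2 - f' f/(2a) a primitive of f². -/
theorem integral_mul_self_eq_half {f f' : ℝ → ℝ} {a x y : ℝ} (ha : a ≠ 0)
    (hf : ∀ t, HasDerivAt f (f' t) t) (hf' : ∀ t, HasDerivAt f' (-a * f t) t)
    (hE : ∀ t, f' t ^ 2 + a * f t ^ 2 = a) (h1 : f' y * f y = f' x * f x) :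
    ∫ t in x..y, f t * f t = (y - x) / 2 := by
  have hfc : Continuous f := continuous_iff_continuousAt.2 fun t => (hf t).continuousAt
  have hd : ∀ t, HasDerivAt (fun t => t / 2 - f' t * f t / (2 * a)) (f t * f t) t := by
    intro t
    refine (((hasDerivAt_id t).div_const 2).sub
      (((hf' t).mul (hf t)).div_const (2 * a))).congr_deriv ?_
    have := hE t
    field_simp
    linear_combination (-1) * this
  rw [intervalIntegral.integral_eq_sub_of_hasDerivAt (a := x) (b := y) (fun t _ => hd t)
    ((hfc.mul hfc).intervalIntegrable _ _), h1]
  ring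

/-- The frequency of the `k`-th Dirichlet eigenfunction of the interval `[x, y]`. -/
def freq (x y : ℝ) (k : ℕ) : ℝ := (k + 1) * Real.pi / (y - x)

/-- The `k`-th Dirichlet eigenfunction of the interval `[x, y]`. -/
def sine (x y : ℝ) (k : ℕ) (t : ℝ) : ℝ := Real.sin (freq x y k * (t - x))

/-- The derivative of the `k`-th Dirichlet eigenfunction of the interval `[x, y]`. -/
def sineDeriv (x y : ℝ) (k : ℕ) (t : ℝ) : ℝ := freq x y k * Real.cos (freq x y k * (t - x))

section Sine

variable {x y : ℝ}

theorem freq_pos (h : x < y) (k : ℕ) : 0 < freq x y k := by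
  have := sub_pos.2 h
  unfold freq; positivity

theorem sine_left (k : ℕ) : sine x y k x = 0 := by simp [sine]

theorem sine_right (h : x < y) (k : ℕ) : sine x y k y = 0 := by
  have : y - x ≠ 0 := (sub_pos.2 h).ne'
  have e : freq x y k * (y - x) = ((k + 1 : ℕ) : ℝ) * Real.pi := by
    unfold freq; push_cast; field_simp
  rw [sine, e, Real.sin_nat_mul_pi]

theorem hasDerivAt_sine (k : ℕ) (t : ℝ) : HasDerivAt (sine x y k) (sineDeriv x y k t) t := by
  have h1 : HasDerivAt (fun t => freq x y k * (t - x)) (freq x y k) t := by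
    simpa using ((hasDerivAt_id t).sub_const x).const_mul (freq x y k)
  exact h1.sin.congr_deriv (by rw [sineDeriv]; ring)

theorem hasDerivAt_sineDeriv (k : ℕ) (t : ℝ) :
    HasDerivAt (sineDeriv x y k) (-(freq x y k ^ 2) * sine x y k t) t := by
  have h1 : HasDerivAt (fun t => freq x y k * (t - x)) (freq x y k) t := by
    simpa using ((hasDerivAt_id t).sub_const x).const_mul (freq x y k)
  exact (h1.cos.const_mul (freq x y k)).congr_deriv (by rw [sine]; ring)

theorem eigenFamily_sine (h : x < y) (m : ℕ) :
    EigenFamily (fun k : Fin m => sine x y k) (fun k => sineDeriv x y k)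
      (fun k => freq x y k ^ 2) (fun _ => (y - x) / 2) x y where
  hasDeriv k t := hasDerivAt_sine k t
  hasDeriv' k t := hasDerivAt_sineDeriv k t
  bd i j := by simp [sine_left, sine_right h]
  orth i j hij := by
    refine integral_mul_eq_zero_of_ne (hasDerivAt_sine i) (hasDerivAt_sineDeriv i)
      (hasDerivAt_sine j) (hasDerivAt_sineDeriv j) ?_ (by simp [sine_left, sine_right h])
      (by simp [sine_left, sine_right h])
    intro e
    rw [sq_eq_sq₀ (freq_pos h _).le (freq_pos h _).le, freq, freq] at e
    have : y - x ≠ 0 := (sub_pos.2 h).ne'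
    field_simp at e
    apply hij
    ext
    exact_mod_cast (add_right_cancel e)
  norm i := by
    refine integral_mul_self_eq_half (pow_ne_zero 2 (freq_pos h _).ne') (hasDerivAt_sine i)
      (hasDerivAt_sineDeriv i) (fun t => ?_) (by simp [sine_left, sine_right h])
    rw [sineDeriv, sine]
    linear_combination (freq x y i ^ 2) * Real.sin_sq_add_cos_sq (freq x y i * (t - x))
  pos i := by have := sub_pos.2 h; positivity

theorem IsH1.wirtinger_le {n : ℕ} {b b' : ℝ → Target n} (hb : IsH1 b b') (h : x < y) {κ : ℝ}
    (hκ : κ ≤ (Real.pi / (y - x)) ^ 2) (hx : b x = 0) (hy : b y = 0) :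
    κ * ∫ t in x..y, ‖b t‖ ^ 2 ≤ ∫ t in x..y, ‖b' t‖ ^ 2 := by
  refine le_trans ?_ (hb.wirtinger h hx hy)
  have : 0 ≤ ∫ t in x..y, ‖b t‖ ^ 2 :=
    intervalIntegral.integral_nonneg h.le fun t _ => sq_nonneg _
  gcongr

/-- A Poincaré inequality passes from two adjacent intervals to their union. -/
theorem IsH1.poincare_append {n : ℕ} {b b' : ℝ → Target n} (hb : IsH1 b b') {κ x y z : ℝ}
    (h1 : κ * ∫ t in x..y, ‖b t‖ ^ 2 ≤ ∫ t in x..y, ‖b' t‖ ^ 2)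
    (h2 : κ * ∫ t in y..z, ‖b t‖ ^ 2 ≤ ∫ t in y..z, ‖b' t‖ ^ 2) :
    κ * ∫ t in x..z, ‖b t‖ ^ 2 ≤ ∫ t in x..z, ‖b' t‖ ^ 2 := by
  have hc : Continuous fun t => ‖b t‖ ^ 2 := hb.continuous.norm.pow 2
  rw [← intervalIntegral.integral_add_adjacent_intervals (hc.intervalIntegrable x y)
    (hc.intervalIntegrable y z),
    ← intervalIntegral.integral_add_adjacent_intervals (hb.sq x y) (hb.sq y z)]
  linarith

variable {n : ℕ} {w w' : ℝ → Target n}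

/-- The second Dirichlet eigenvalue of an interval. -/
theorem sine_gap_one (h : x < y) (hw : IsH1 w w') (hx : w x = 0) (hy : w y = 0)
    (ho : ∀ i : Fin 1, ∫ t in x..y, sine x y i t • w t = 0) :
    (2 * Real.pi / (y - x)) ^ 2 * ∫ t in x..y, ‖w t‖ ^ 2 ≤ ∫ t in x..y, ‖w' t‖ ^ 2 := by
  have hyx := sub_pos.2 h
  refine (eigenFamily_sine h 1).gap hw ho (by simp [hx, hy]) (fun i => ?_) ?_
  · fin_cases i
    simp only [freq]
    have := Real.pi_pos
    gcongr
    simp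
  -- The first sine equals 1 at the midpoint, so subtracting `w m` times it creates a zero there.
  -- Wirtinger on the two halves then has twice the frequency.
  · set m := (x + y) / 2 with hm
    refine ⟨fun _ => w m, ?_⟩
    set B : Fin 1 → Target n := fun _ => w m
    have hv := hw.sub ((eigenFamily_sine h 1).isH1_combo B)
    have h0 : w x - combo (fun k : Fin 1 => sine x y k) B x = 0 := by
      simp [combo, hx, sine_left]
    have h1 : w y - combo (fun k : Fin 1 => sine x y k) B y = 0 := by
      simp [combo, hy, sine_right h]
    have h2 : w m - combo (fun k : Fin 1 => sine x y k) B m = 0 := by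
      have : freq x y 0 * (m - x) = Real.pi / 2 := by
        simp only [freq, hm]; field_simp; push_cast; ring
      simp [combo, sine, this, B]
    have k1 : (2 * Real.pi / (y - x)) = Real.pi / (m - x) := by
      have : m - x = (y - x) / 2 := by rw [hm]; ring
      rw [this]; field_simp
    have k2 : (2 * Real.pi / (y - x)) = Real.pi / (y - m) := by
      have : y - m = (y - x) / 2 := by rw [hm]; ring
      rw [this]; field_simp
    exact hv.poincare_append (y := m)
      (hv.wirtinger_le (by rw [hm]; linarith) (by rw [k1]) h0 h2)
      (hv.wirtinger_le (by rw [hm]; linarith) (by rw [k2]) h2 h1)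

/-- The third Dirichlet eigenvalue of an interval. -/
theorem sine_gap_two (h : x < y) (hw : IsH1 w w') (hx : w x = 0) (hy : w y = 0)
    (ho : ∀ i : Fin 2, ∫ t in x..y, sine x y i t • w t = 0) :
    (3 * Real.pi / (y - x)) ^ 2 * ∫ t in x..y, ‖w t‖ ^ 2 ≤ ∫ t in x..y, ‖w' t‖ ^ 2 := by
  have hyx := sub_pos.2 h
  refine (eigenFamily_sine h 2).gap hw ho (by simp [hx, hy]) (fun i => ?_) ?_
  · have := Real.pi_pos
    fin_cases i <;> simp only [freq] <;> gcongr <;> (simp; try linarith)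
  · set p := x + (y - x) / 3 with hp
    set q := x + 2 * (y - x) / 3 with hq
    -- These coefficients interpolate `w` at the nodes p, q of the third eigenfunction. The two
    -- sines take the values √3/2, √3/2 at p and √3/2, -√3/2 at q.
    set B : Fin 2 → Target n :=
      ![(1 / Real.sqrt 3) • (w p + w q), (1 / Real.sqrt 3) • (w p - w q)] with hB
    refine ⟨B, ?_⟩
    have hv := hw.sub ((eigenFamily_sine h 2).isH1_combo B)
    have h0 : w x - combo (fun k : Fin 2 => sine x y k) B x = 0 := by
      simp [combo, hx, sine_left]
    have h1 : w y - combo (fun k : Fin 2 => sine x y k) B y = 0 := by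
      simp [combo, hy, sine_right h]
    have s1 : Real.sin (Real.pi / 3) = Real.sqrt 3 / 2 := Real.sin_pi_div_three
    have s2 : Real.sin (2 * Real.pi / 3) = Real.sqrt 3 / 2 := by
      rw [← s1, ← Real.sin_pi_sub]; congr 1; ring
    have s3 : Real.sin (4 * Real.pi / 3) = -(Real.sqrt 3 / 2) := by
      rw [← s1, ← Real.sin_add_pi]; congr 1; ring
    have r3 : Real.sqrt 3 ≠ 0 := by positivity
    have hc : Real.sqrt 3 / 2 * (1 / Real.sqrt 3) = 1 / 2 := by field_simp
    have f1 : freq x y (0 : ℕ) * (p - x) = Real.pi / 3 := by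
      simp only [freq, hp]; field_simp; push_cast; ring
    have f2 : freq x y (1 : ℕ) * (p - x) = 2 * Real.pi / 3 := by
      simp only [freq, hp]; field_simp; push_cast; ring
    have f3 : freq x y (0 : ℕ) * (q - x) = 2 * Real.pi / 3 := by
      simp only [freq, hq]; field_simp; push_cast; ring
    have f4 : freq x y (1 : ℕ) * (q - x) = 4 * Real.pi / 3 := by
      simp only [freq, hq]; field_simp; push_cast; ring
    have h2 : w p - combo (fun k : Fin 2 => sine x y k) B p = 0 := by
      simp only [combo, sine, Fin.sum_univ_two, Fin.val_zero, Fin.val_one, f1, f2, s1, s2, hB,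
        Matrix.cons_val_zero, Matrix.cons_val_one, smul_smul, hc]
      module
    have h3 : w q - combo (fun k : Fin 2 => sine x y k) B q = 0 := by
      simp only [combo, sine, Fin.sum_univ_two, Fin.val_zero, Fin.val_one, f3, f4, s2, s3, hB,
        Matrix.cons_val_zero, Matrix.cons_val_one, smul_smul, hc, neg_mul]
      module
    have k1 : 3 * Real.pi / (y - x) = Real.pi / (p - x) := by
      have : p - x = (y - x) / 3 := by rw [hp]; ring
      rw [this]; field_simp
    have k2 : 3 * Real.pi / (y - x) = Real.pi / (q - p) := by
      have : q - p = (y - x) / 3 := by rw [hp, hq]; ring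
      rw [this]; field_simp
    have k3 : 3 * Real.pi / (y - x) = Real.pi / (y - q) := by
      have : y - q = (y - x) / 3 := by rw [hq]; ring
      rw [this]; field_simp
    exact hv.poincare_append (y := q)
      (hv.poincare_append (y := p)
        (hv.wirtinger_le (by rw [hp]; linarith) (by rw [k1]) h0 h2)
        (hv.wirtinger_le (by rw [hp, hq]; linarith) (by rw [k2]) h2 h3))
      (hv.wirtinger_le (by rw [hq]; linarith) (by rw [k3]) h3 h1)

end Sine

end Epi

end

/-! ### The spectral gap of the circle and Poincaré inequalities on intervals with many zeros -/

noncomputable section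

namespace Epi

/-- The trigonometric functions of degree at most one on the circle. -/
def trig (b : ℝ) : Fin 3 → ℝ → ℝ :=
  ![fun _ => 1, fun t => Real.cos (t - b), fun t => Real.sin (t - b)]

/-- The derivatives of `trig b`. -/
def trigDeriv (b : ℝ) : Fin 3 → ℝ → ℝ :=
  ![fun _ => 0, fun t => -Real.sin (t - b), fun t => Real.cos (t - b)]

theorem eigenFamily_trig (b : ℝ) :
    EigenFamily (trig b) (trigDeriv b) ![0, 1, 1] ![2 * Real.pi, Real.pi, Real.pi]
      b (b + 2 * Real.pi) := by
  have hc : ∀ t, HasDerivAt (fun t => Real.cos (t - b)) (-Real.sin (t - b)) t := fun t => by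
    simpa using ((hasDerivAt_id t).sub_const b).cos
  have hs : ∀ t, HasDerivAt (fun t => Real.sin (t - b)) (Real.cos (t - b)) t := fun t => by
    simpa using ((hasDerivAt_id t).sub_const b).sin
  have hs' : ∀ t, HasDerivAt (fun t => -Real.sin (t - b)) (-1 * Real.cos (t - b)) t := fun t =>
    (hs t).neg.congr_deriv (by ring)
  have hc' : ∀ t, HasDerivAt (fun t => Real.cos (t - b)) (-1 * Real.sin (t - b)) t := fun t => by
    simpa using hc t
  have h1 : ∀ t : ℝ, HasDerivAt (fun _ => (1 : ℝ)) 0 t := fun t => hasDerivAt_const t 1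
  have h0 : ∀ t : ℝ, HasDerivAt (fun _ => (0 : ℝ)) (-0 * 1) t := fun t => by
    simpa using hasDerivAt_const t (0 : ℝ)
  have o1 : ∫ t in b..(b + 2 * Real.pi), 1 * Real.cos (t - b) = 0 :=
    integral_mul_eq_zero_of_ne h1 h0 hc hs' zero_ne_one (by simp) (by simp)
  have o2 : ∫ t in b..(b + 2 * Real.pi), 1 * Real.sin (t - b) = 0 :=
    integral_mul_eq_zero_of_ne h1 h0 hs hc' zero_ne_one (by simp) (by simp)
  -- Cosine and sine share the eigenvalue 1, so the Wronskian argument does not apply to this pair.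
  have o3 : ∫ t in b..(b + 2 * Real.pi), Real.cos (t - b) * Real.sin (t - b) = 0 := by
    have hd : ∀ t, HasDerivAt (fun t => Real.sin (t - b) * Real.sin (t - b) / 2)
        (Real.cos (t - b) * Real.sin (t - b)) t := fun t =>
      (((hs t).mul (hs t)).div_const 2).congr_deriv (by ring)
    rw [intervalIntegral.integral_eq_sub_of_hasDerivAt (fun t _ => hd t)
      ((by fun_prop : Continuous _).intervalIntegrable _ _)]
    simp
  refine ⟨?_, ?_, ?_, ?_, ?_, ?_⟩
  · intro i; fin_cases i <;> [exact h1; exact hc; exact hs]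
  · intro i; fin_cases i <;> [exact h0; exact hs'; exact hc']
  · intro i j; fin_cases i <;> fin_cases j <;> simp [trig, trigDeriv]
  · intro i j hij
    fin_cases i <;> fin_cases j <;> first | exact absurd rfl hij | skip
    · exact o1
    · exact o2
    · rw [← o1]; exact intervalIntegral.integral_congr fun t _ => mul_comm _ _
    · exact o3
    · rw [← o2]; exact intervalIntegral.integral_congr fun t _ => mul_comm _ _
    · rw [← o3]; exact intervalIntegral.integral_congr fun t _ => mul_comm _ _
  · intro i
    fin_cases i
    · simp [trig]
    · refine (integral_mul_self_eq_half one_ne_zero hc hs' (fun t => ?_) (by simp)).trans ?_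
      · linear_combination Real.sin_sq_add_cos_sq (t - b)
      · simp
    · refine (integral_mul_self_eq_half one_ne_zero hs hc' (fun t => ?_) (by simp)).trans ?_
      · linear_combination Real.sin_sq_add_cos_sq (t - b)
      · simp
  · intro i; fin_cases i <;> simp [Real.pi_pos]

/-- The second positive eigenvalue of the circle is at least `9 / 4`. -/
theorem trig_gap {n : ℕ} {w w' : ℝ → Target n} {b : ℝ} (hw : IsH1 w w')
    (hb : w (b + 2 * Real.pi) = w b)
    (ho : ∀ i, ∫ t in b..(b + 2 * Real.pi), trig b i t • w t = 0) :
    9 / 4 * ∫ t in b..(b + 2 * Real.pi), ‖w t‖ ^ 2 ≤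
      ∫ t in b..(b + 2 * Real.pi), ‖w' t‖ ^ 2 := by
  have hpi := Real.pi_pos
  refine (eigenFamily_trig b).gap hw ho (fun i => ?_) (fun i => ?_) ?_
  · rw [hb]; fin_cases i <;> simp [trigDeriv]
  · fin_cases i <;> norm_num
  · set p := b + 2 * Real.pi / 3 with hp
    set q := b + 4 * Real.pi / 3 with hq
    -- Trigonometric interpolation of `w` at three equally spaced points. The remainder vanishes
    -- there, and Wirtinger on arcs of length 2π/3 gives (3/2)² = 9/4. The sharp constant 4 is not
    -- needed.
    set B : Fin 3 → Target n := ![(1 / 3 : ℝ) • (w b + w p + w q),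
      (1 / 3 : ℝ) • ((2 : ℝ) • w b - w p - w q), (1 / Real.sqrt 3) • (w p - w q)] with hB
    refine ⟨B, ?_⟩
    have hv := hw.sub ((eigenFamily_trig b).isH1_combo B)
    have s1 : Real.sin (2 * Real.pi / 3) = Real.sqrt 3 / 2 := by
      rw [← Real.sin_pi_div_three, ← Real.sin_pi_sub]; congr 1; ring
    have s2 : Real.sin (4 * Real.pi / 3) = -(Real.sqrt 3 / 2) := by
      rw [← Real.sin_pi_div_three, ← Real.sin_add_pi]; congr 1; ring
    have c1 : Real.cos (2 * Real.pi / 3) = -(1 / 2) := by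
      rw [← Real.cos_pi_div_three, ← Real.cos_pi_sub]; congr 1; ring
    have c2 : Real.cos (4 * Real.pi / 3) = -(1 / 2) := by
      rw [← Real.cos_pi_div_three, ← Real.cos_add_pi]; congr 1; ring
    have r3 : Real.sqrt 3 ≠ 0 := by positivity
    have hc : Real.sqrt 3 / 2 * (1 / Real.sqrt 3) = 1 / 2 := by field_simp
    have e1 : p - b = 2 * Real.pi / 3 := by rw [hp]; ring
    have e2 : q - b = 4 * Real.pi / 3 := by rw [hq]; ring
    have h0 : w b - combo (trig b) B b = 0 := by
      simp only [combo, trig, Fin.sum_univ_three, hB, Matrix.cons_val, sub_self, Real.cos_zero,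
        Real.sin_zero]
      module
    have h1 : w (b + 2 * Real.pi) - combo (trig b) B (b + 2 * Real.pi) = 0 := by
      rw [← h0, hb]; simp [combo, trig, Fin.sum_univ_three]
    have h2 : w p - combo (trig b) B p = 0 := by
      simp only [combo, trig, Fin.sum_univ_three, hB, Matrix.cons_val, e1, s1, c1, smul_smul, hc]
      module
    have h3 : w q - combo (trig b) B q = 0 := by
      simp only [combo, trig, Fin.sum_univ_three, hB, Matrix.cons_val, e2, s2, c2, smul_smul, hc,
        neg_mul]
      module
    have k1 : (9 / 4 : ℝ) = (Real.pi / (p - b)) ^ 2 := by rw [e1]; field_simp; norm_num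
    have k2 : (9 / 4 : ℝ) = (Real.pi / (q - p)) ^ 2 := by
      have : q - p = 2 * Real.pi / 3 := by rw [hp, hq]; ring
      rw [this]; field_simp; norm_num
    have k3 : (9 / 4 : ℝ) = (Real.pi / (b + 2 * Real.pi - q)) ^ 2 := by
      have : b + 2 * Real.pi - q = 2 * Real.pi / 3 := by rw [hq]; ring
      rw [this]; field_simp; norm_num
    exact hv.poincare_append (y := q)
      (hv.poincare_append (y := p)
        (hv.wirtinger_le (by rw [hp]; linarith) k1.le h0 h2)
        (hv.wirtinger_le (by rw [hp, hq]; linarith) k2.le h2 h3))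
      (hv.wirtinger_le (by rw [hq]; linarith) k3.le h3 h1)

/-- The Poincaré inequality for a function on an interval all of whose zero-free subintervals are
short. -/
theorem IsH1.poincare_of_gaps {n : ℕ} {b b' : ℝ → Target n} (hb : IsH1 b b') {x y L : ℝ}
    (hxy : x ≤ y) (hL : 0 < L) (hx : b x = 0) (hy : b y = 0)
    (hgap : ∀ p q, x ≤ p → p < q → q ≤ y → b p = 0 → b q = 0 → (∀ t ∈ Ioo p q, b t ≠ 0) →
      q - p ≤ L) :
    (Real.pi / L) ^ 2 * ∫ t in x..y, ‖b t‖ ^ 2 ≤ ∫ t in x..y, ‖b' t‖ ^ 2 := by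
  set κ := (Real.pi / L) ^ 2 with hκ
  have hc := hb.continuous
  have step : ∀ p q, p < q → q - p ≤ L → b p = 0 → b q = 0 →
      κ * ∫ t in p..q, ‖b t‖ ^ 2 ≤ ∫ t in p..q, ‖b' t‖ ^ 2 := fun p q hpq hl hp hq => by
    refine hb.wirtinger_le hpq ?_ hp hq
    have := sub_pos.2 hpq
    have := Real.pi_pos
    rw [hκ]
    gcongr
  -- Continuation argument: the zeros up to which the inequality holds form a closed set, and from
  -- its supremum m < y a further zero at distance at most L can be reached. That zero need not be
  -- the next one.
  set A : Set ℝ := {p | p ∈ Icc x y ∧ b p = 0 ∧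
    κ * ∫ t in x..p, ‖b t‖ ^ 2 ≤ ∫ t in x..p, ‖b' t‖ ^ 2} with hA
  have hAc : IsClosed A := by
    have h1 : Continuous fun p => κ * ∫ t in x..p, ‖b t‖ ^ 2 :=
      continuous_const.mul (intervalIntegral.continuous_primitive
        (fun u v => (hc.norm.pow 2).intervalIntegrable u v) x)
    have h2 : Continuous fun p => ∫ t in x..p, ‖b' t‖ ^ 2 :=
      intervalIntegral.continuous_primitive hb.sq x
    exact isClosed_Icc.inter ((isClosed_eq hc continuous_const).inter (isClosed_le h1 h2))
  have hxA : x ∈ A := ⟨⟨le_rfl, hxy⟩, hx, by simp⟩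
  have hbdd : BddAbove A := ⟨y, fun p hp => hp.1.2⟩
  have hm : sSup A ∈ A := hAc.csSup_mem ⟨x, hxA⟩ hbdd
  set m := sSup A with hmdef
  rcases hm.1.2.eq_or_lt with h | h
  · rw [← h]; exact hm.2.2
  · exfalso
    -- Otherwise the first zero q ≥ m + L would end a zero-free interval starting at m, and `hgap`
    -- would place q within distance L of m after all.
    obtain ⟨z, hz, hzL, hz0⟩ : ∃ z ∈ Ioc m y, z - m ≤ L ∧ b z = 0 := by
      by_contra! hno
      set Z : Set ℝ := Icc (m + L) y ∩ {t | b t = 0} with hZ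
      have hLy : m + L < y := by
        by_contra! hle
        exact hno y ⟨h, le_rfl⟩ (by linarith) hy
      have hyZ : y ∈ Z := ⟨⟨hLy.le, le_rfl⟩, hy⟩
      have hZc : IsClosed Z := isClosed_Icc.inter (isClosed_eq hc continuous_const)
      have hZb : BddBelow Z := ⟨m + L, fun t ht => ht.1.1⟩
      have hq := hZc.csInf_mem ⟨y, hyZ⟩ hZb
      set q := sInf Z with hqdef
      have hmq : m < q := by linarith [hq.1.1]
      have hle := hgap m q hm.1.1 hmq hq.1.2 hm.2.1 hq.2 fun t ht ht0 => by
        rcases le_or_gt (t - m) L with h1 | h1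
        · exact hno t ⟨ht.1, ht.2.le.trans hq.1.2⟩ h1 ht0
        · exact absurd (csInf_le hZb ⟨⟨by linarith, ht.2.le.trans hq.1.2⟩, ht0⟩)
            (not_le.2 ht.2)
      exact hno q ⟨hmq, hq.1.2⟩ hle hq.2
    have hzA : z ∈ A := ⟨⟨hm.1.1.trans hz.1.le, hz.2⟩, hz0,
      hb.poincare_append hm.2.2 (step m z hz.1 hzL hm.2.1 hz0)⟩
    exact absurd (le_csSup hbdd hzA) (not_le.2 hz.1)

end Epi

end

/-! ### Absolutely continuous representatives on the circle -/

noncomputable section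

namespace Epi

theorem contDiff_circlePoint : ContDiff ℝ ∞ circlePoint := by
  rw [contDiff_euclidean]
  intro i
  fin_cases i <;> simp [circlePoint] <;> fun_prop

theorem continuous_circlePoint : Continuous circlePoint := contDiff_circlePoint.continuous

theorem circlePoint_periodic : Function.Periodic circlePoint (2 * Real.pi) := fun θ => by
  simp [circlePoint]

theorem norm_circlePoint (θ : ℝ) : ‖circlePoint θ‖ = 1 := by
  simp [circlePoint, EuclideanSpace.norm_eq]

theorem integral_arcLength {E : Type*} [NormedAddCommGroup E] [NormedSpace ℝ E] {f : Plane → E}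
    (hf : AEStronglyMeasurable f arcLength) :
    ∫ x, f x ∂arcLength = ∫ θ in (-Real.pi)..Real.pi, f (circlePoint θ) := by
  rw [intervalIntegral.integral_of_le (by linarith [Real.pi_pos]), arcLength,
    integral_map measurable_circlePoint.aemeasurable hf]

/-- A periodic property that holds almost everywhere on one period holds almost everywhere. -/
theorem ae_of_periodic {p : ℝ → Prop} {a T : ℝ} (hT : 0 < T) (hp : ∀ θ, p θ → p (θ + T))
    (hp' : ∀ θ, p (θ + T) → p θ)
    (h : ∀ᵐ θ ∂(volume.restrict (Ioc a (a + T))), p θ) : ∀ᵐ θ, p θ := by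
  rw [ae_restrict_iff' measurableSet_Ioc] at h
  have h2 : ∀ k : ℤ, ∀ᵐ θ, θ + k * T ∈ Ioc a (a + T) → p (θ + k * T) := fun k =>
    (measurePreserving_add_right (volume : Measure ℝ) (k * T)).quasiMeasurePreserving.ae h
  have h3 : ∀ k : ℕ, ∀ θ, p (θ + k * T) ↔ p θ := by
    intro k
    induction k with
    | zero => simp
    | succ k ih =>
      intro θ
      rw [← ih θ]
      have : θ + ((k + 1 : ℕ) : ℝ) * T = θ + k * T + T := by push_cast; ring
      rw [this]
      exact ⟨hp' _, hp _⟩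
  have h4 : ∀ k : ℤ, ∀ θ, p (θ + k * T) ↔ p θ := by
    intro k θ
    obtain ⟨m, rfl | rfl⟩ := k.eq_nat_or_neg
    · exact_mod_cast h3 m θ
    · rw [← h3 m (θ + _)]
      push_cast
      rw [show θ + -(m : ℝ) * T + m * T = θ by ring]
  filter_upwards [ae_all_iff.2 h2] with θ hθ
  obtain ⟨k, hk, -⟩ := existsUnique_add_zsmul_mem_Ioc hT θ a
  rw [zsmul_eq_mul] at hk
  exact (h4 k θ).1 (hθ k hk)

/-- The angle of a point of the plane. -/
def angle (x : Plane) : ℝ := Complex.arg (x 0 + x 1 * Complex.I)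

theorem angle_circlePoint {θ : ℝ} (h : θ ∈ Ioc (-Real.pi) Real.pi) : angle (circlePoint θ) = θ := by
  have := Complex.arg_cos_add_sin_mul_I h
  simpa [angle, circlePoint] using this

theorem measurable_angle : Measurable angle := by
  unfold angle
  exact Complex.measurable_arg.comp (Continuous.measurable (by fun_prop))

/-- The primitive of a smooth periodic function with mean zero. -/
theorem exists_smooth_periodic_primitive {ψ : ℝ → ℝ} (h1 : ContDiff ℝ ∞ ψ)
    (h2 : Function.Periodic ψ (2 * Real.pi)) (h3 : ∫ t in (-Real.pi)..Real.pi, ψ t = 0) :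
    ∃ φ : ℝ → ℝ, ContDiff ℝ ∞ φ ∧ Function.Periodic φ (2 * Real.pi) ∧ deriv φ = ψ := by
  have hd : ∀ t, HasDerivAt (fun t => ∫ s in (0 : ℝ)..t, ψ s) (ψ t) t := fun t =>
    (h1.continuous).integral_hasStrictDerivAt 0 t |>.hasDerivAt
  have hde : deriv (fun t => ∫ s in (0 : ℝ)..t, ψ s) = ψ := funext fun t => (hd t).deriv
  refine ⟨fun t => ∫ s in (0 : ℝ)..t, ψ s, ?_, fun t => ?_, hde⟩
  · rw [contDiff_infty_iff_deriv, hde]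
    exact ⟨fun t => (hd t).differentiableAt, h1⟩
  · have hi : ∀ a b, IntervalIntegrable ψ volume a b := fun a b =>
      h1.continuous.intervalIntegrable a b
    have := h2.intervalIntegral_add_eq t (-Real.pi)
    rw [show -Real.pi + 2 * Real.pi = Real.pi by ring, h3] at this
    simp only
    rw [← intervalIntegral.integral_add_adjacent_intervals (hi 0 t) (hi t _), this, add_zero]

variable {n : ℕ}

/-- An `H¹` function on the circle agrees almost everywhere with a periodic primitive. -/
theorem MemH1Circle.exists_rep {c : Plane → Target n} (h : MemH1Circle c) :
    ∃ C C' : ℝ → Target n, IsH1 C C' ∧ Function.Periodic C (2 * Real.pi) ∧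
      Function.Periodic C' (2 * Real.pi) ∧ ∀ᵐ θ, c (circlePoint θ) = C θ := by
  obtain ⟨hc, g, hg, hweak⟩ := h
  have hpi := Real.pi_pos
  have hle : -Real.pi ≤ Real.pi := by linarith
  set g1 := hg.1.mk g with hg1
  have hg1m : StronglyMeasurable g1 := hg.1.stronglyMeasurable_mk
  have hg1L : MemLp g1 2 arcLength := (memLp_congr_ae hg.1.ae_eq_mk).1 hg
  set C' : ℝ → Target n := fun θ => g1 (circlePoint θ) with hC'
  have hC'm : StronglyMeasurable C' := hg1m.comp_measurable measurable_circlePoint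
  have hC'per : Function.Periodic C' (2 * Real.pi) := fun θ => by
    simp only [hC', circlePoint_periodic θ]
  have hC'L : MemLp C' 2 (volume.restrict (Ioc (-Real.pi) Real.pi)) :=
    (memLp_map_measure_iff hg1m.aestronglyMeasurable measurable_circlePoint.aemeasurable).1 hg1L
  have hfin : IsFiniteMeasure (volume.restrict (Ioc (-Real.pi) Real.pi)) :=
    ⟨by simp⟩
  have hsq0 : IntervalIntegrable (fun t => ‖C' t‖ ^ 2) volume (-Real.pi) (-Real.pi + 2 * Real.pi) := by
    rw [show -Real.pi + 2 * Real.pi = Real.pi by ring, intervalIntegrable_iff_integrableOn_Ioc_of_le hle]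
    exact (memLp_two_iff_integrable_sq_norm hC'm.aestronglyMeasurable).1 hC'L
  have hint0 : IntervalIntegrable C' volume (-Real.pi) (-Real.pi + 2 * Real.pi) := by
    rw [show -Real.pi + 2 * Real.pi = Real.pi by ring, intervalIntegrable_iff_integrableOn_Ioc_of_le hle]
    exact hC'L.integrable (by norm_num)
  have hsq : ∀ x y, IntervalIntegrable (fun t => ‖C' t‖ ^ 2) volume x y := fun x y =>
    Function.Periodic.intervalIntegrable (T := 2 * Real.pi) (fun t => by simp only [hC'per t])
      (by positivity) hsq0 x y
  have hint : ∀ x y, IntervalIntegrable C' volume x y := fun x y =>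
    hC'per.intervalIntegrable (by positivity) hint0 x y
  have hgC' : ∀ᵐ θ ∂(volume.restrict (Ioc (-Real.pi) Real.pi)), g (circlePoint θ) = C' θ :=
    ae_of_ae_map measurable_circlePoint.aemeasurable hg.1.ae_eq_mk
  -- Testing with the constant function 1 gives mean zero, which makes the primitive periodic.
  have hmean : ∫ t in (-Real.pi)..Real.pi, C' t = 0 := by
    have := hweak (fun _ => 1) contDiff_const (fun _ => rfl)
    simp only [deriv_const, zero_smul, integral_zero, one_smul] at this
    rw [intervalIntegral.integral_of_le hle, ← integral_congr_ae hgC']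
    exact neg_eq_zero.1 this.symm
  set C0 : ℝ → Target n := fun θ => ∫ t in (-Real.pi)..θ, C' t with hC0
  have hC0prim : IsPrimitive C0 C' :=
    ⟨hint, fun x y => (intervalIntegral.integral_interval_sub_left (hint _ _) (hint _ _)).symm⟩
  have hC0per : Function.Periodic C0 (2 * Real.pi) := fun θ => by
    have h1 := hC0prim.eq θ (θ + 2 * Real.pi)
    rw [hC'per.intervalIntegral_add_eq θ (-Real.pi),
      show -Real.pi + 2 * Real.pi = Real.pi by ring, hmean] at h1
    exact (sub_eq_zero.1 h1.symm)
  have hC0c := hC0prim.continuous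
  have hC0a : C0 (-Real.pi) = 0 := by simp [hC0]
  have hC0b : C0 Real.pi = 0 := hmean
  have hcI : IntegrableOn (fun θ => c (circlePoint θ)) (Ioc (-Real.pi) Real.pi) :=
    ((memLp_map_measure_iff hc.1 measurable_circlePoint.aemeasurable).1 hc).integrable (by norm_num)
  -- The primitive is carried to the plane by the principal angle, so that `c - F` can be tested
  -- against smooth functions of the plane with respect to arc length.
  set F : Plane → Target n := fun x => C0 (angle x) with hF
  have hFm : StronglyMeasurable F := hC0c.stronglyMeasurable.comp_measurable measurable_angle
  have hFc : ∀ θ ∈ Ioc (-Real.pi) Real.pi, F (circlePoint θ) = C0 θ := fun θ hθ => by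
    simp only [hF, angle_circlePoint hθ]
  have hC0I : IntegrableOn C0 (Ioc (-Real.pi) Real.pi) :=
    (intervalIntegrable_iff_integrableOn_Ioc_of_le hle).1 (hC0c.intervalIntegrable _ _)
  have hFI : Integrable F arcLength := by
    rw [arcLength, integrable_map_measure hFm.aestronglyMeasurable
      measurable_circlePoint.aemeasurable]
    exact hC0I.congr_fun (fun θ hθ => (hFc θ hθ).symm) measurableSet_Ioc
  have hcI' : Integrable c arcLength := hc.integrable (by norm_num)
  set f : ℝ → Target n := fun θ => c (circlePoint θ) - C0 θ with hf
  have hfI : IntervalIntegrable f volume (-Real.pi) Real.pi := by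
    rw [intervalIntegrable_iff_integrableOn_Ioc_of_le hle]
    exact hcI.sub hC0I
  set M : Target n := (2 * Real.pi)⁻¹ • ∫ t in (-Real.pi)..Real.pi, f t with hM
  have key : ∀ᵐ x ∂arcLength, c x - F x - M = 0 := by
    refine ae_eq_zero_of_integral_contDiff_smul_eq_zero
      ((hcI'.sub hFI).sub (integrable_const M)).locallyIntegrable fun Φ hΦ1 hΦ2 => ?_
    set ψ : ℝ → ℝ := fun θ => Φ (circlePoint θ) with hψ
    have hψ1 : ContDiff ℝ ∞ ψ := hΦ1.comp contDiff_circlePoint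
    have hψ2 : Function.Periodic ψ (2 * Real.pi) := fun θ => by
      simp only [hψ, circlePoint_periodic θ]
    have hψc := hψ1.continuous
    -- Only mean-free functions are derivatives of smooth periodic ones, hence the weak derivative
    -- is tested with the primitive of ψ - a. The removed mean a is matched by `M`, the mean of `c -
    -- C0`.
    set a := (2 * Real.pi)⁻¹ * ∫ t in (-Real.pi)..Real.pi, ψ t with ha
    obtain ⟨φ, hφ1, hφ2, hφ3⟩ := exists_smooth_periodic_primitive (ψ := fun t => ψ t - a)
      (hψ1.sub contDiff_const) (fun t => by simp only [hψ2 t]) (by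
        rw [intervalIntegral.integral_sub (hψc.intervalIntegrable _ _) (by simp)]
        simp only [intervalIntegral.integral_const, ha, smul_eq_mul]
        field_simp
        ring)
    have hφd : ∀ t, HasDerivAt φ (ψ t - a) t := fun t => by
      have := (hφ1.differentiable (by simp) t).hasDerivAt
      rwa [hφ3] at this
    have hφc := hφ1.continuous
    have w1 := hweak φ hφ1 hφ2
    rw [hφ3] at w1
    have w2 : ∫ θ in (-Real.pi)..Real.pi, (ψ θ - a) • C0 θ =
        -∫ θ in (-Real.pi)..Real.pi, φ θ • C' θ := by
      have e := ((IsPrimitive.of_hasDerivAt hφd (hψc.sub continuous_const)).smul hC0prim).eq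
        (-Real.pi) Real.pi
      rw [hC0a, hC0b, smul_zero, smul_zero, sub_zero, intervalIntegral.integral_add] at e
      · exact eq_neg_of_add_eq_zero_left e
      · exact ((hψc.sub continuous_const).smul hC0c).intervalIntegrable _ _
      · exact (hint _ _).continuousOn_smul hφc.continuousOn
    have w3 : ∫ θ in (-Real.pi)..Real.pi, (ψ θ - a) • f θ = 0 := by
      simp only [hf, smul_sub]
      have hcI2 : IntervalIntegrable (fun θ => c (circlePoint θ)) volume (-Real.pi) Real.pi :=
        (intervalIntegrable_iff_integrableOn_Ioc_of_le hle).2 hcI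
      have hcont : Continuous fun θ => ψ θ - a := hψc.sub continuous_const
      have w4 : ∫ θ in Ioc (-Real.pi) Real.pi, φ θ • g (circlePoint θ) =
          ∫ θ in Ioc (-Real.pi) Real.pi, φ θ • C' θ :=
        integral_congr_ae (hgC'.mono fun θ hθ => by simp only [hθ])
      have i2 : IntervalIntegrable (fun θ => (ψ θ - a) • C0 θ) volume (-Real.pi) Real.pi :=
        (hcont.smul hC0c).intervalIntegrable _ _
      rw [intervalIntegral.integral_sub (hcI2.continuousOn_smul hcont.continuousOn) i2, w2,
        intervalIntegral.integral_of_le hle, w1, intervalIntegral.integral_of_le hle,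
        w4, sub_self]
    have hmeas : AEStronglyMeasurable (fun x => Φ x • (c x - F x - M)) arcLength :=
      hΦ1.continuous.aestronglyMeasurable.smul ((hc.1.sub hFm.aestronglyMeasurable).sub
        aestronglyMeasurable_const)
    rw [integral_arcLength hmeas]
    have e : ∫ θ in (-Real.pi)..Real.pi, Φ (circlePoint θ) • (c (circlePoint θ) - F (circlePoint θ) - M) =
        ∫ θ in (-Real.pi)..Real.pi, ((ψ θ - a) • f θ + a • f θ - ψ θ • M) := by
      refine intervalIntegral.integral_congr_ae (Filter.Eventually.of_forall fun θ hθ => ?_)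
      rw [uIoc_of_le hle] at hθ
      simp only [hFc θ hθ, hf, hψ]
      module
    have i1 : IntervalIntegrable (fun θ => (ψ θ - a) • f θ) volume (-Real.pi) Real.pi :=
      hfI.continuousOn_smul (hψc.sub continuous_const).continuousOn
    have i2 : IntervalIntegrable (fun θ => a • f θ) volume (-Real.pi) Real.pi := hfI.smul a
    have i3 : IntervalIntegrable (fun θ => ψ θ • M) volume (-Real.pi) Real.pi :=
      (hψc.smul continuous_const).intervalIntegrable _ _
    rw [e, intervalIntegral.integral_sub (i1.add i2) i3,
      intervalIntegral.integral_add i1 i2, w3, intervalIntegral.integral_smul,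
      intervalIntegral.integral_smul_const, hM, ha, zero_add, smul_smul, ← sub_smul]
    rw [mul_comm, sub_self, zero_smul]
  refine ⟨fun θ => C0 θ + M, C', ⟨⟨hint, fun x y => ?_⟩, hC'm, hsq⟩, fun θ => ?_, hC'per, ?_⟩
  · rw [hC0prim.eq]; abel
  · simp only [hC0per θ]
  · refine ae_of_periodic (a := -Real.pi) (T := 2 * Real.pi) (by positivity)
      (fun θ hθ => by simpa only [circlePoint_periodic θ, hC0per θ] using hθ)
      (fun θ hθ => by simpa only [circlePoint_periodic θ, hC0per θ] using hθ) ?_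
    rw [show -Real.pi + 2 * Real.pi = Real.pi by ring]
    have := ae_of_ae_map measurable_circlePoint.aemeasurable key
    filter_upwards [this, ae_restrict_mem measurableSet_Ioc] with θ h1 h2
    rw [hFc θ h2, sub_sub, sub_eq_zero] at h1
    exact h1

end Epi

end

/-! ### Moving polar coordinates and the change of variables -/

noncomputable section

namespace Epi

theorem circlePoint_inj {θ η : ℝ} (h : circlePoint θ = circlePoint η)
    (hlt : |θ - η| < 2 * Real.pi) : θ = η := by
  have h0 : Real.cos θ = Real.cos η := by simpa [circlePoint] using congrArg (· 0) h
  have h1 : Real.sin θ = Real.sin η := by simpa [circlePoint] using congrArg (· 1) h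
  have := Real.Angle.cos_sin_inj h0 h1
  rw [Real.Angle.angle_eq_iff_two_pi_dvd_sub] at this
  obtain ⟨k, hk⟩ := this
  rw [hk, abs_mul, abs_of_pos (by positivity : 0 < 2 * Real.pi)] at hlt
  have hk1 : |(k : ℝ)| < 1 := by
    by_contra! hge
    nlinarith [Real.pi_pos]
  have : k = 0 := by
    have : |k| < 1 := by exact_mod_cast hk1
    exact Int.abs_lt_one_iff.1 this
  rw [this] at hk
  simpa [sub_eq_zero] using hk

/-- The measurable identification of `ℝ × ℝ` with the plane. -/
def planeEquiv : ℝ × ℝ ≃ᵐ Plane :=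
  (MeasurableEquiv.finTwoArrow (α := ℝ)).symm.trans (MeasurableEquiv.toLp 2 (Fin 2 → ℝ))

theorem planeEquiv_apply (a b : ℝ) : planeEquiv (a, b) = !₂[a, b] := by
  ext i; fin_cases i <;> rfl

theorem measurePreserving_planeEquiv : MeasurePreserving planeEquiv volume volume :=
  (volume_preserving_finTwoArrow ℝ).symm.trans
    (EuclideanSpace.volume_preserving_symm_measurableEquiv_toLp (Fin 2)).symm

/-- An affine motion of the angle `y`: at radius `r` the angle `y` is moved to
`y + s (1 - r) (p₀ + p₁ y)`. -/
structure Motion where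
  /-- the speed -/
  s : ℝ
  /-- the constant coefficient of the displacement -/
  p₀ : ℝ
  /-- the linear coefficient of the displacement -/
  p₁ : ℝ

namespace Motion

variable (m : Motion)

/-- The displacement field of a motion. -/
def disp (y : ℝ) : ℝ := m.p₀ + m.p₁ * y

/-- The moved angle. -/
def ang (q : ℝ × ℝ) : ℝ := q.2 + m.s * (1 - q.1) * m.disp q.2

/-- The dilation factor of a motion at radius `r`. -/
def lam (r : ℝ) : ℝ := 1 + m.s * (1 - r) * m.p₁

/-- The point of the plane with radius `r` and angle moved from `y`. -/
def pt (q : ℝ × ℝ) : Plane := q.1 • circlePoint (m.ang q)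

/-- The Jacobian determinant of `Motion.pt`. -/
def jac (q : ℝ × ℝ) : ℝ := q.1 * m.lam q.1

/-- The parameter rectangle. -/
def _root_.Epi.rect (y₀ y₁ : ℝ) : Set (ℝ × ℝ) := Ioo 0 1 ×ˢ Ioo y₀ y₁

/-- The sector swept out by the interval `(y₀, y₁)`. -/
def sector (y₀ y₁ : ℝ) : Set Plane := m.pt '' rect y₀ y₁

/-- The motion moves `[y₀, y₁]` monotonically inside `[b₀, b₀ + 2π]`. -/
structure Good (b₀ y₀ y₁ : ℝ) : Prop where
  lam_pos : ∀ r ∈ Icc (0 : ℝ) 1, 0 < m.lam r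
  lower : ∀ r ∈ Icc (0 : ℝ) 1, b₀ ≤ m.ang (r, y₀)
  upper : ∀ r ∈ Icc (0 : ℝ) 1, m.ang (r, y₁) ≤ b₀ + 2 * Real.pi
  lt : y₀ < y₁

variable {m} {b₀ y₀ y₁ : ℝ}

theorem _root_.Epi.measurableSet_rect : MeasurableSet (rect y₀ y₁) :=
  measurableSet_Ioo.prod measurableSet_Ioo

theorem ang_eq (r y z : ℝ) : m.ang (r, y) = m.ang (r, z) + m.lam r * (y - z) := by
  simp only [ang, lam, disp]; ring

theorem norm_pt {q : ℝ × ℝ} (hq : 0 ≤ q.1) : ‖m.pt q‖ = q.1 := by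
  rw [pt, norm_smul, norm_circlePoint, mul_one, Real.norm_of_nonneg hq]

theorem Good.ang_mem (h : m.Good b₀ y₀ y₁) {q : ℝ × ℝ} (hq : q ∈ rect y₀ y₁) :
    m.ang q ∈ Ioo b₀ (b₀ + 2 * Real.pi) := by
  have hr : q.1 ∈ Icc (0 : ℝ) 1 := Ioo_subset_Icc_self hq.1
  have hl := h.lam_pos _ hr
  have e1 := m.ang_eq q.1 q.2 y₀
  have e2 := m.ang_eq q.1 y₁ q.2
  have := h.lower _ hr
  have := h.upper _ hr
  have := mul_pos hl (sub_pos.2 hq.2.1)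
  have := mul_pos hl (sub_pos.2 hq.2.2)
  constructor <;> linarith

/-- The radius is recovered as the norm. At a fixed radius the moved angle increases in y with slope
`lam`, and it stays in an open window of length 2π. -/
theorem Good.injOn (h : m.Good b₀ y₀ y₁) : InjOn m.pt (rect y₀ y₁) := by
  intro q hq q' hq' e
  have h1 : q.1 = q'.1 := by
    rw [← norm_pt (m := m) hq.1.1.le, e, norm_pt hq'.1.1.le]
  have h2 : m.ang q = m.ang q' := by
    refine circlePoint_inj ?_ ?_
    · rw [pt, pt, ← h1] at e
      exact smul_right_injective _ hq.1.1.ne' e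
    · have := h.ang_mem hq
      have := h.ang_mem hq'
      rw [abs_lt]
      constructor <;> linarith [this.1, this.2, (h.ang_mem hq).1, (h.ang_mem hq).2]
  have h3 := m.ang_eq q.1 q.2 q'.2
  have h4 : m.ang (q.1, q'.2) = m.ang q' := by rw [h1]
  have hl := h.lam_pos _ (Ioo_subset_Icc_self hq.1)
  have h5 : m.lam q.1 * (q.2 - q'.2) = 0 := by
    have : m.ang (q.1, q.2) = m.ang q := rfl
    linarith
  exact Prod.ext h1 (sub_eq_zero.1 ((mul_eq_zero.1 h5).resolve_left hl.ne'))

variable (m) in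
/-- `Motion.pt` in the coordinates of `ℝ × ℝ`. -/
def ptPair (q : ℝ × ℝ) : ℝ × ℝ := polarCoord.symm (q.1, m.ang q)

theorem planeEquiv_ptPair (q : ℝ × ℝ) : planeEquiv (m.ptPair q) = m.pt q := by
  rw [ptPair, polarCoord_symm_apply, planeEquiv_apply, pt]
  ext i; fin_cases i <;> simp [circlePoint]

variable (m) in
/-- The derivative of `Motion.ptPair`. -/
def fderivPtPair (q : ℝ × ℝ) : ℝ × ℝ →L[ℝ] ℝ × ℝ :=
  (fderivPolarCoordSymm (q.1, m.ang q)).comp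
    (Matrix.toLin (.finTwoProd ℝ) (.finTwoProd ℝ)
      !![1, 0; -m.s * m.disp q.2, m.lam q.1]).toContinuousLinearMap

theorem hasFDerivAt_ptPair (q : ℝ × ℝ) : HasFDerivAt m.ptPair (m.fderivPtPair q) q := by
  refine HasFDerivAt.comp q (hasFDerivAt_polarCoord_symm _) ?_
  rw [Matrix.toLin_finTwoProd_toContinuousLinearMap]
  refine (HasFDerivAt.prodMk hasFDerivAt_fst (f₂ := m.ang)
    (hasFDerivAt_snd.add (((hasFDerivAt_fst.const_sub 1).const_mul m.s).mul
      ((hasFDerivAt_snd.const_mul m.p₁).const_add m.p₀)))).congr_fderiv ?_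
  ext <;> simp [lam, disp]
  ring

theorem det_fderivPtPair (q : ℝ × ℝ) : (m.fderivPtPair q).det = m.jac q := by
  rw [fderivPtPair, ContinuousLinearMap.det, ContinuousLinearMap.toLinearMap_comp,
    LinearMap.det_comp]
  have h1 := det_fderivPolarCoordSymm (q.1, m.ang q)
  rw [ContinuousLinearMap.det] at h1
  rw [h1]
  simp [jac, LinearMap.det_toLin, Matrix.det_fin_two_of]

theorem sector_eq : m.sector y₀ y₁ = planeEquiv '' (m.ptPair '' rect y₀ y₁) := by
  rw [sector, image_image]
  exact image_congr fun q _ => (planeEquiv_ptPair q).symm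

theorem Good.injOn_ptPair (h : m.Good b₀ y₀ y₁) : InjOn m.ptPair (rect y₀ y₁) :=
  fun q hq q' hq' e => h.injOn hq hq' (by rw [← planeEquiv_ptPair, e, planeEquiv_ptPair])

theorem Good.jac_nonneg (h : m.Good b₀ y₀ y₁) {q : ℝ × ℝ} (hq : q ∈ rect y₀ y₁) :
    0 ≤ m.jac q :=
  mul_nonneg hq.1.1.le (h.lam_pos _ (Ioo_subset_Icc_self hq.1)).le

section ChangeOfVariables

variable {E : Type*} [NormedAddCommGroup E] [NormedSpace ℝ E]

theorem Good.setIntegral_sector (h : m.Good b₀ y₀ y₁) (f : Plane → E) :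
    ∫ x in m.sector y₀ y₁, f x = ∫ q in rect y₀ y₁, m.jac q • f (m.pt q) := by
  rw [sector_eq, measurePreserving_planeEquiv.setIntegral_image_emb
    planeEquiv.measurableEmbedding, integral_image_eq_integral_abs_det_fderiv_smul _
    measurableSet_rect (fun q _ => (hasFDerivAt_ptPair q).hasFDerivWithinAt) h.injOn_ptPair]
  refine setIntegral_congr_fun measurableSet_rect fun q hq => ?_
  simp only [det_fderivPtPair, planeEquiv_ptPair, abs_of_nonneg (h.jac_nonneg hq)]

theorem Good.integrableOn_sector (h : m.Good b₀ y₀ y₁) (f : Plane → E) :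
    IntegrableOn f (m.sector y₀ y₁) ↔
      IntegrableOn (fun q => m.jac q • f (m.pt q)) (rect y₀ y₁) := by
  rw [sector_eq, measurePreserving_planeEquiv.integrableOn_image planeEquiv.measurableEmbedding,
    integrableOn_image_iff_integrableOn_abs_det_fderiv_smul _
    measurableSet_rect (fun q _ => (hasFDerivAt_ptPair q).hasFDerivWithinAt) h.injOn_ptPair]
  refine integrableOn_congr_fun (fun q hq => ?_) measurableSet_rect
  simp only [det_fderivPtPair, planeEquiv_ptPair, Function.comp_apply,
    abs_of_nonneg (h.jac_nonneg hq)]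

end ChangeOfVariables

theorem continuous_ang : Continuous m.ang := by
  unfold ang disp; fun_prop

theorem continuous_lam : Continuous m.lam := by
  unfold lam; fun_prop

theorem continuous_jac : Continuous m.jac :=
  continuous_fst.mul (continuous_lam.comp continuous_fst)

theorem continuous_pt : Continuous m.pt :=
  continuous_fst.smul (continuous_circlePoint.comp continuous_ang)

variable (m) in
/-- The function on the plane which is `F` in the coordinates of the sector and which vanishes
outside the sector. -/
def lift {E : Type*} [Zero E] (y₀ y₁ : ℝ) (F : ℝ × ℝ → E) : Plane → E :=
  Function.extend (fun q : rect y₀ y₁ => m.pt q) (fun q => F q) 0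

theorem Good.lift_pt (h : m.Good b₀ y₀ y₁) {E : Type*} [Zero E] (F : ℝ × ℝ → E) {q : ℝ × ℝ}
    (hq : q ∈ rect y₀ y₁) : m.lift y₀ y₁ F (m.pt q) = F q :=
  Function.Injective.extend_apply (f := fun q : rect y₀ y₁ => m.pt q)
    (fun a b e => Subtype.ext (h.injOn a.2 b.2 e)) _ _ ⟨q, hq⟩

theorem lift_of_notMem {E : Type*} [Zero E] (F : ℝ × ℝ → E) {x : Plane}
    (hx : x ∉ m.sector y₀ y₁) : m.lift y₀ y₁ F x = 0 := by
  refine Function.extend_apply' _ _ _ ?_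
  rintro ⟨q, rfl⟩
  exact hx ⟨q, q.2, rfl⟩

/-- Lusin-Souslin: an injective continuous map on a standard Borel space is a measurable embedding.
This makes extensions by zero outside the sector measurable. -/
theorem Good.measurableEmbedding (h : m.Good b₀ y₀ y₁) :
    MeasurableEmbedding (fun q : rect y₀ y₁ => m.pt q) := by
  have : StandardBorelSpace (rect y₀ y₁) := measurableSet_rect.standardBorel
  exact (continuous_pt.comp continuous_subtype_val).measurable.measurableEmbedding
    fun a b e => Subtype.ext (h.injOn a.2 b.2 e)

theorem Good.measurable_lift (h : m.Good b₀ y₀ y₁) {E : Type*} [Zero E] [MeasurableSpace E]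
    {F : ℝ × ℝ → E} (hF : Measurable F) : Measurable (m.lift y₀ y₁ F) :=
  h.measurableEmbedding.measurable_extend (hF.comp measurable_subtype_coe) measurable_const

theorem sector_subset_disc : m.sector y₀ y₁ ⊆ disc := by
  rintro _ ⟨q, hq, rfl⟩
  rw [disc, mem_ball_zero_iff, norm_pt hq.1.1.le]
  exact hq.1.2

end Motion

end Epi

end

/-! ### The Gauss-Green formula in a moving sector -/

noncomputable section

namespace Epi

/-- The unit tangent vector `(-sin θ, cos θ)` of the unit circle. -/
def circleTangent (θ : ℝ) : Plane := !₂[-Real.sin θ, Real.cos θ]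

theorem hasDerivAt_circlePoint (θ : ℝ) : HasDerivAt circlePoint (circleTangent θ) θ := by
  have h : HasDerivAt (fun θ => ![Real.cos θ, Real.sin θ]) ![-Real.sin θ, Real.cos θ] θ := by
    rw [hasDerivAt_pi]
    intro i
    fin_cases i
    · exact Real.hasDerivAt_cos θ
    · exact Real.hasDerivAt_sin θ
  exact ((PiLp.continuousLinearEquiv 2 ℝ (fun _ : Fin 2 => ℝ)).symm.toContinuousLinearMap.hasFDerivAt.comp_hasDerivAt θ h)

theorem continuous_circleTangent : Continuous circleTangent := by
  unfold circleTangent; fun_prop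

theorem hasDerivAt_circlePoint_apply (j : Fin 2) (θ : ℝ) :
    HasDerivAt (fun θ => circlePoint θ j) (circleTangent θ j) θ :=
  (EuclideanSpace.proj j : Plane →L[ℝ] ℝ).hasFDerivAt.comp_hasDerivAt θ (hasDerivAt_circlePoint θ)

theorem hasDerivAt_circleTangent_apply (j : Fin 2) (θ : ℝ) :
    HasDerivAt (fun θ => circleTangent θ j) (-circlePoint θ j) θ := by
  fin_cases j
  · exact (Real.hasDerivAt_sin θ).neg
  · exact Real.hasDerivAt_cos θ

theorem single_eq (j : Fin 2) (θ : ℝ) : EuclideanSpace.single j (1 : ℝ) =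
    circlePoint θ j • circlePoint θ + circleTangent θ j • circleTangent θ := by
  have := Real.sin_sq_add_cos_sq θ
  ext i
  fin_cases i <;> fin_cases j <;> simp [circlePoint, circleTangent] <;> linarith

theorem partialDeriv_eq (j : Fin 2) (φ : Plane → ℝ) (x : Plane) (θ : ℝ) :
    partialDeriv j φ x = circlePoint θ j * fderiv ℝ φ x (circlePoint θ) +
      circleTangent θ j * fderiv ℝ φ x (circleTangent θ) := by
  rw [partialDeriv, single_eq j θ, map_add, map_smul, map_smul, smul_eq_mul, smul_eq_mul]

namespace Motion

variable (m : Motion) {b₀ y₀ y₁ : ℝ}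

/-- The radial derivative of the angle. -/
def angR (q : ℝ × ℝ) : ℝ := -(m.s * m.disp q.2)

/-- The radial component of the cofactor matrix of `Motion.pt`. -/
def cofR (j : Fin 2) (q : ℝ × ℝ) : ℝ := m.jac q * circlePoint (m.ang q) j

/-- The angular component of the cofactor matrix of `Motion.pt`. -/
def cofA (j : Fin 2) (q : ℝ × ℝ) : ℝ :=
  circleTangent (m.ang q) j - q.1 * m.angR q * circlePoint (m.ang q) j

/-- The radial derivative of `φ(pt) cofR`. -/
def derivCofR (φ : Plane → ℝ) (j : Fin 2) (q : ℝ × ℝ) : ℝ :=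
  fderiv ℝ φ (m.pt q) (circlePoint (m.ang q) + (q.1 * m.angR q) • circleTangent (m.ang q)) *
    m.cofR j q + φ (m.pt q) * ((m.lam q.1 - q.1 * (m.s * m.p₁)) * circlePoint (m.ang q) j +
      m.jac q * (m.angR q * circleTangent (m.ang q) j))

/-- The angular derivative of `φ(pt) cofA`. -/
def derivCofA (φ : Plane → ℝ) (j : Fin 2) (q : ℝ × ℝ) : ℝ :=
  fderiv ℝ φ (m.pt q) (m.jac q • circleTangent (m.ang q)) *
    m.cofA j q - φ (m.pt q) * ((m.lam q.1 - q.1 * (m.s * m.p₁)) * circlePoint (m.ang q) j +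
      m.jac q * (m.angR q * circleTangent (m.ang q) j))

variable {m}

theorem hasDerivAt_ang_left (r y : ℝ) :
    HasDerivAt (fun r => m.ang (r, y)) (m.angR (r, y)) r := by
  have := (((hasDerivAt_id r).const_sub 1).const_mul m.s).mul_const (m.disp y) |>.const_add y
  exact this.congr_deriv (by simp [angR])

theorem hasDerivAt_ang_right (r y : ℝ) :
    HasDerivAt (fun y => m.ang (r, y)) (m.lam r) y := by
  have := (hasDerivAt_id y).add
    ((((hasDerivAt_id y).const_mul m.p₁).const_add m.p₀).const_mul (m.s * (1 - r)))
  exact this.congr_deriv (by simp [lam])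

theorem hasDerivAt_lam (r : ℝ) : HasDerivAt m.lam (-(m.s * m.p₁)) r := by
  have := ((((hasDerivAt_id r).const_sub 1).const_mul m.s).mul_const m.p₁).const_add 1
  exact this.congr_deriv (by ring)

theorem hasDerivAt_pt_left (r y : ℝ) : HasDerivAt (fun r => m.pt (r, y))
    (circlePoint (m.ang (r, y)) + (r * m.angR (r, y)) • circleTangent (m.ang (r, y))) r := by
  have := (hasDerivAt_id r).smul
    ((hasDerivAt_circlePoint (m.ang (r, y))).scomp r (hasDerivAt_ang_left r y))
  refine this.congr_deriv ?_
  simp [smul_smul, add_comm]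

theorem hasDerivAt_pt_right (r y : ℝ) : HasDerivAt (fun y => m.pt (r, y))
    (m.jac (r, y) • circleTangent (m.ang (r, y))) y := by
  have := ((hasDerivAt_circlePoint (m.ang (r, y))).scomp y (hasDerivAt_ang_right r y)).const_smul r
  refine this.congr_deriv ?_
  simp [smul_smul, jac]

theorem hasDerivAt_cofR {φ : Plane → ℝ} (hφ : Differentiable ℝ φ) (j : Fin 2) (r y : ℝ) :
    HasDerivAt (fun r => φ (m.pt (r, y)) * m.cofR j (r, y)) (m.derivCofR φ j (r, y)) r := by
  have h1 := (hφ (m.pt (r, y))).hasFDerivAt.comp_hasDerivAt r (hasDerivAt_pt_left r y)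
  have h2 := ((hasDerivAt_id r).mul (hasDerivAt_lam (m := m) r)).mul
    ((hasDerivAt_circlePoint_apply j (m.ang (r, y))).comp r (hasDerivAt_ang_left r y))
  refine (h1.mul h2).congr_deriv ?_
  simp only [derivCofR, cofR, jac, id_eq, Function.comp_apply, Pi.mul_apply]
  ring

theorem hasDerivAt_cofA {φ : Plane → ℝ} (hφ : Differentiable ℝ φ) (j : Fin 2) (r y : ℝ) :
    HasDerivAt (fun y => φ (m.pt (r, y)) * m.cofA j (r, y)) (m.derivCofA φ j (r, y)) y := by
  have h1 := (hφ (m.pt (r, y))).hasFDerivAt.comp_hasDerivAt y (hasDerivAt_pt_right r y)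
  have h3 : HasDerivAt (fun y => m.angR (r, y)) (-(m.s * m.p₁)) y :=
    ((((hasDerivAt_id y).const_mul m.p₁).const_add m.p₀).const_mul m.s).neg.congr_deriv (by ring)
  have h2 := ((hasDerivAt_circleTangent_apply j (m.ang (r, y))).comp y
    (hasDerivAt_ang_right r y)).sub ((h3.const_mul r).mul
    ((hasDerivAt_circlePoint_apply j (m.ang (r, y))).comp y (hasDerivAt_ang_right r y)))
  refine (h1.mul h2).congr_deriv ?_
  simp only [derivCofA, cofA, jac, Function.comp_apply, Pi.mul_apply, Pi.sub_apply]
  ring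

/-- Piola identity: the cofactor row (`cofR`, `cofA`) is divergence free, so the terms containing φ
itself cancel. The rest is the chain rule in the orthonormal frame at the moved angle. -/
theorem derivCofR_add_derivCofA (φ : Plane → ℝ) (j : Fin 2) (q : ℝ × ℝ) :
    m.derivCofR φ j q + m.derivCofA φ j q = m.jac q * partialDeriv j φ (m.pt q) := by
  rw [partialDeriv_eq j φ _ (m.ang q), derivCofR, derivCofA]
  simp only [map_add, map_smul, smul_eq_mul, cofR, cofA]
  ring

theorem continuous_angR : Continuous m.angR := by
  unfold angR disp; fun_prop

theorem continuous_circlePoint_ang (j : Fin 2) : Continuous fun q => circlePoint (m.ang q) j := by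
  have := continuous_circlePoint.comp (continuous_ang (m := m))
  exact (EuclideanSpace.proj j : Plane →L[ℝ] ℝ).continuous.comp this

theorem continuous_circleTangent_ang (j : Fin 2) :
    Continuous fun q => circleTangent (m.ang q) j := by
  have := continuous_circleTangent.comp (continuous_ang (m := m))
  exact (EuclideanSpace.proj j : Plane →L[ℝ] ℝ).continuous.comp this

theorem continuous_cofR (j : Fin 2) : Continuous (m.cofR j) :=
  continuous_jac.mul (continuous_circlePoint_ang j)

theorem continuous_cofA (j : Fin 2) : Continuous (m.cofA j) :=
  (continuous_circleTangent_ang j).sub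
    ((continuous_fst.mul continuous_angR).mul (continuous_circlePoint_ang j))

theorem continuous_derivCofR {φ : Plane → ℝ} (hφ : ContDiff ℝ ∞ φ) (j : Fin 2) :
    Continuous (m.derivCofR φ j) := by
  have h1 : Continuous (fderiv ℝ φ) := hφ.continuous_fderiv (by simp)
  have h2 := h1.comp (continuous_pt (m := m))
  have h3 := continuous_circlePoint.comp (continuous_ang (m := m))
  have h4 := continuous_circleTangent.comp (continuous_ang (m := m))
  have h5 := continuous_cofR (m := m) j
  have h6 := hφ.continuous.comp (continuous_pt (m := m))
  have h7 := continuous_angR (m := m)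
  have h8 := continuous_jac (m := m)
  have h9 : Continuous fun q : ℝ × ℝ => m.lam q.1 := continuous_lam.comp continuous_fst
  have h10 := continuous_circlePoint_ang (m := m) j
  have h11 := continuous_circleTangent_ang (m := m) j
  exact ((h2.clm_apply (h3.add ((continuous_fst.mul h7).smul h4))).mul h5).add
    (h6.mul (((h9.sub (continuous_fst.mul continuous_const)).mul h10).add
      (h8.mul (h7.mul h11))))

theorem continuous_derivCofA {φ : Plane → ℝ} (hφ : ContDiff ℝ ∞ φ) (j : Fin 2) :
    Continuous (m.derivCofA φ j) := by
  have e : m.derivCofA φ j = fun q => m.jac q * partialDeriv j φ (m.pt q) - m.derivCofR φ j q :=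
    funext fun q => by rw [← derivCofR_add_derivCofA]; ring
  rw [e]
  have h1 : Continuous (fderiv ℝ φ) := hφ.continuous_fderiv (by simp)
  exact (continuous_jac.mul ((h1.comp continuous_pt).clm_apply continuous_const)).sub
    (continuous_derivCofR hφ j)

end Motion

section Rect

variable {E : Type*} [NormedAddCommGroup E] [NormedSpace ℝ E] {y₀ y₁ : ℝ}

theorem restrict_rect : (volume : Measure (ℝ × ℝ)).restrict (rect y₀ y₁) =
    ((volume : Measure ℝ).restrict (Ioo 0 1)).prod ((volume : Measure ℝ).restrict (Ioo y₀ y₁)) := by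
  rw [rect, Measure.volume_eq_prod, Measure.prod_restrict]

theorem exists_bound_rect {F : Type*} [NormedAddCommGroup F] {a : ℝ × ℝ → F} (ha : Continuous a) :
    ∃ C, ∀ᵐ q ∂(volume.restrict (rect y₀ y₁)), ‖a q‖ ≤ C := by
  obtain ⟨C, hC⟩ := (isCompact_Icc.prod isCompact_Icc : IsCompact (Icc (0 : ℝ) 1 ×ˢ Icc y₀ y₁)).exists_bound_of_continuousOn
    ha.continuousOn
  refine ⟨C, (ae_restrict_mem measurableSet_rect).mono fun q hq => hC q ?_⟩
  exact ⟨Ioo_subset_Icc_self hq.1, Ioo_subset_Icc_self hq.2⟩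

theorem integrable_smul_snd {a : ℝ × ℝ → ℝ} (ha : Continuous a) {f : ℝ → E}
    (hf : IntegrableOn f (Ioo y₀ y₁)) :
    IntegrableOn (fun q => a q • f q.2) (rect y₀ y₁) := by
  obtain ⟨C, hC⟩ := exists_bound_rect (y₀ := y₀) (y₁ := y₁) ha
  refine Integrable.bdd_smul ?_ C ha.aestronglyMeasurable hC
  rw [restrict_rect]
  exact hf.comp_snd _

theorem integral_rect {f : ℝ × ℝ → E} (hf : IntegrableOn f (rect y₀ y₁)) (h : y₀ ≤ y₁) :
    ∫ q in rect y₀ y₁, f q = ∫ r in (0 : ℝ)..1, ∫ y in y₀..y₁, f (r, y) := by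
  rw [IntegrableOn, restrict_rect] at hf
  rw [restrict_rect, integral_prod _ hf, intervalIntegral.integral_of_le zero_le_one,
    integral_Ioc_eq_integral_Ioo]
  simp only [intervalIntegral.integral_of_le h, integral_Ioc_eq_integral_Ioo]

theorem integral_rect_symm {f : ℝ × ℝ → E} (hf : IntegrableOn f (rect y₀ y₁)) (h : y₀ ≤ y₁) :
    ∫ q in rect y₀ y₁, f q = ∫ y in y₀..y₁, ∫ r in (0 : ℝ)..1, f (r, y) := by
  rw [IntegrableOn, restrict_rect] at hf
  rw [restrict_rect, integral_prod_symm _ hf, intervalIntegral.integral_of_le h,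
    integral_Ioc_eq_integral_Ioo]
  simp only [intervalIntegral.integral_of_le zero_le_one, integral_Ioc_eq_integral_Ioo]

theorem IsPrimitive.integrableOn_Ioo {b b' : ℝ → E} (hb : IsPrimitive b b') :
    IntegrableOn b' (Ioo y₀ y₁) := (hb.int y₀ y₁).1.mono_set Ioo_subset_Ioc_self

end Rect

namespace Motion

variable {m : Motion} {b₀ y₀ y₁ : ℝ} {n : ℕ} {b b' : ℝ → Target n} {α α' : ℝ → ℝ}

/-- The Gauss-Green formula in the coordinates of a moving sector, for a function
`α(r) b(y)` in separated variables. -/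
theorem gaussGreen_rect (hy : y₀ ≤ y₁) (hb : IsPrimitive b b')
    (hα : ∀ r, HasDerivAt α (α' r) r) (hα' : Continuous α') (h0 : α 0 = 0)
    {φ : Plane → ℝ} (hφ : ContDiff ℝ ∞ φ) (j : Fin 2)
    (hbd : ∀ r, (φ (m.pt (r, y₁)) * m.cofA j (r, y₁)) • b y₁ =
      (φ (m.pt (r, y₀)) * m.cofA j (r, y₀)) • b y₀) :
    ∫ q in rect y₀ y₁, ((α q.1 * (m.jac q * partialDeriv j φ (m.pt q))) • b q.2 +
      φ (m.pt q) • ((α' q.1 * m.cofR j q) • b q.2 + (α q.1 * m.cofA j q) • b' q.2)) =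
    ∫ y in y₀..y₁, (α 1 * (φ (circlePoint y) * circlePoint y j)) • b y := by
  have hφd : Differentiable ℝ φ := hφ.differentiable (by simp)
  have hαc : Continuous α := continuous_iff_continuousAt.2 fun r => (hα r).continuousAt
  have c1 : Continuous fun q : ℝ × ℝ => α q.1 := hαc.comp continuous_fst
  have c2 : Continuous fun q : ℝ × ℝ => α' q.1 := hα'.comp continuous_fst
  have c3 : Continuous fun q => φ (m.pt q) := hφ.continuous.comp continuous_pt
  have c4 := continuous_cofR (m := m) j
  have c5 := continuous_cofA (m := m) j
  have c6 := continuous_derivCofR (m := m) hφ j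
  have c7 := continuous_derivCofA (m := m) hφ j
  have hbI : IntegrableOn b (Ioo y₀ y₁) :=
    (hb.continuous.integrableOn_Icc).mono_set Ioo_subset_Icc_self
  -- `T1` is the r-derivative of α φ `cofR` b and `T2` the y-derivative of α φ `cofA` b. Integrating
  -- `T1` first in r leaves only the trace at r = 1, since α(0) = 0. Integrating `T2` first in y
  -- gives zero by `hbd`.
  set T1 : ℝ × ℝ → Target n := fun q =>
    (α' q.1 * (φ (m.pt q) * m.cofR j q) + α q.1 * m.derivCofR φ j q) • b q.2 with hT1
  set T2 : ℝ × ℝ → Target n := fun q => (α q.1 * m.derivCofA φ j q) • b q.2 +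
    (α q.1 * (φ (m.pt q) * m.cofA j q)) • b' q.2 with hT2
  have i1 : IntegrableOn T1 (rect y₀ y₁) :=
    integrable_smul_snd ((c2.mul (c3.mul c4)).add (c1.mul c6)) hbI
  have i2 : IntegrableOn T2 (rect y₀ y₁) :=
    (integrable_smul_snd (c1.mul c7) hbI).add
      (integrable_smul_snd (c1.mul (c3.mul c5)) hb.integrableOn_Ioo)
  have e : ∀ q, (α q.1 * (m.jac q * partialDeriv j φ (m.pt q))) • b q.2 +
      φ (m.pt q) • ((α' q.1 * m.cofR j q) • b q.2 + (α q.1 * m.cofA j q) • b' q.2) =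
      T1 q + T2 q := fun q => by
    rw [hT1, hT2, ← derivCofR_add_derivCofA]
    module
  simp only [e]
  rw [integral_add i1 i2, integral_rect_symm i1 hy, integral_rect i2 hy]
  have z2 : ∀ r, ∫ y in y₀..y₁, T2 (r, y) = 0 := fun r => by
    have p1 : IsPrimitive (fun y => φ (m.pt (r, y)) * m.cofA j (r, y))
        (fun y => m.derivCofA φ j (r, y)) :=
      .of_hasDerivAt (hasDerivAt_cofA hφd j r) (c7.comp (by fun_prop))
    have e2 := (p1.smul hb).eq y₀ y₁
    rw [hbd r, sub_self] at e2
    have : ∀ y, T2 (r, y) = α r • (m.derivCofA φ j (r, y) • b y +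
        (φ (m.pt (r, y)) * m.cofA j (r, y)) • b' y) := fun y => by
      simp only [hT2]; module
    simp only [this]
    rw [intervalIntegral.integral_smul, e2, smul_zero]
  have z1 : ∀ y, ∫ r in (0 : ℝ)..1, T1 (r, y) =
      (α 1 * (φ (circlePoint y) * circlePoint y j)) • b y := fun y => by
    have hd : ∀ r, HasDerivAt (fun r => α r * (φ (m.pt (r, y)) * m.cofR j (r, y)))
        (α' r * (φ (m.pt (r, y)) * m.cofR j (r, y)) + α r * m.derivCofR φ j (r, y)) r :=
      fun r => (hα r).mul (hasDerivAt_cofR hφd j r y)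
    simp only [hT1]
    rw [intervalIntegral.integral_smul_const,
      intervalIntegral.integral_eq_sub_of_hasDerivAt (fun r _ => hd r)]
    · have : m.ang (1, y) = y := by simp [ang]
      simp [h0, cofR, jac, lam, pt, this]
    · refine Continuous.intervalIntegrable ?_ _ _
      exact (hα'.mul ((c3.mul c4).comp (by fun_prop : Continuous fun r : ℝ => (r, y)))).add
        (hαc.mul (c6.comp (by fun_prop : Continuous fun r : ℝ => (r, y))))
  simp [z1, z2]

end Motion

end Epi

end

/-! ### The competitor over one sector and its weak gradient -/

noncomputable section

namespace Epi

/-- The data of a competitor over a moving sector: on the interval `[y₀, y₁]` the boundary datum is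
`v + w`, the angles follow the motion `m`, and `w` is damped at the rate `K`. -/
structure PieceData (n : ℕ) where
  /-- the motion of the angles -/
  m : Motion
  /-- the damping rate -/
  K : ℝ
  /-- the left end point -/
  y₀ : ℝ
  /-- the right end point -/
  y₁ : ℝ
  /-- the undamped part -/
  v : ℝ → Target n
  /-- the derivative of the undamped part -/
  v' : ℝ → Target n
  /-- the damped part -/
  w : ℝ → Target n
  /-- the derivative of the damped part -/
  w' : ℝ → Target n

theorem IsH1.const_smul {n : ℕ} {b b' : ℝ → Target n} (h : IsH1 b b') (a : ℝ) :
    IsH1 (fun t => a • b t) (fun t => a • b' t) where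
  int x y := (h.int x y).smul a
  eq x y := by rw [intervalIntegral.integral_smul, h.eq, smul_sub]
  meas := h.meas.const_smul a
  sq x y := by simpa [norm_smul, mul_pow] using (h.sq x y).const_mul (a ^ 2)

theorem IsH1.memLp {n : ℕ} {b b' : ℝ → Target n} (h : IsH1 b b') (x y : ℝ) :
    MemLp b' 2 ((volume : Measure ℝ).restrict (Ioo x y)) :=
  (memLp_two_iff_integrable_sq_norm h.meas.aestronglyMeasurable).2
    ((h.sq x y).1.mono_set Ioo_subset_Ioc_self)

theorem memLp_two_of_continuous {n : ℕ} {b : ℝ → Target n} (h : Continuous b) (x y : ℝ) :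
    MemLp b 2 ((volume : Measure ℝ).restrict (Ioo x y)) :=
  (memLp_two_iff_integrable_sq_norm h.aestronglyMeasurable).2
    (((h.norm.pow 2).integrableOn_Icc).mono_set Ioo_subset_Icc_self)

theorem memLp_smul_snd {n : ℕ} {y₀ y₁ : ℝ} {a : ℝ × ℝ → ℝ}
    (ha : ContinuousOn a (Icc 0 1 ×ˢ Icc y₀ y₁)) {f : ℝ → Target n}
    (hf : MemLp f 2 ((volume : Measure ℝ).restrict (Ioo y₀ y₁))) :
    MemLp (fun q => a q • f q.2) 2 (volume.restrict (rect y₀ y₁)) := by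
  have hsub : rect y₀ y₁ ⊆ Icc 0 1 ×ˢ Icc y₀ y₁ :=
    prod_mono Ioo_subset_Icc_self Ioo_subset_Icc_self
  obtain ⟨C, hC⟩ := (isCompact_Icc.prod isCompact_Icc).exists_bound_of_continuousOn ha
  have h1 : MemLp (fun q : ℝ × ℝ => f q.2) 2 (volume.restrict (rect y₀ y₁)) := by
    rw [restrict_rect]; exact hf.comp_snd _
  refine h1.of_le_mul (c := C) ?_ ?_
  · exact ((ha.mono hsub).aestronglyMeasurable measurableSet_rect).smul h1.1
  · refine (ae_restrict_mem measurableSet_rect).mono fun q hq => ?_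
    rw [norm_smul]
    gcongr
    exact hC q (hsub hq)

namespace Motion

variable {m : Motion} {b₀ y₀ y₁ : ℝ}

theorem setIntegral_disc_of_zero {E : Type*} [NormedAddCommGroup E] [NormedSpace ℝ E]
    {f : Plane → E} (hf : ∀ x ∉ m.sector y₀ y₁, f x = 0) :
    ∫ x in disc, f x = ∫ x in m.sector y₀ y₁, f x :=
  (setIntegral_eq_of_subset_of_forall_sdiff_eq_zero Metric.isOpen_ball.measurableSet
    sector_subset_disc fun x hx => hf x hx.2)

theorem Good.memLp_lift (h : m.Good b₀ y₀ y₁) {n : ℕ} {F : ℝ × ℝ → Target n} (hFm : Measurable F)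
    (hF : MemLp F 2 (volume.restrict (rect y₀ y₁))) :
    MemLp (m.lift y₀ y₁ F) 2 (volume.restrict disc) := by
  have hm := h.measurable_lift hFm
  rw [memLp_two_iff_integrable_sq_norm hm.aestronglyMeasurable]
  have hz : ∀ x ∉ m.sector y₀ y₁, ‖m.lift y₀ y₁ F x‖ ^ 2 = 0 := fun x hx => by
    simp [lift_of_notMem F hx]
  have : IntegrableOn (fun x => ‖m.lift y₀ y₁ F x‖ ^ 2) (m.sector y₀ y₁) := by
    rw [h.integrableOn_sector]
    obtain ⟨C, hC⟩ := exists_bound_rect (y₀ := y₀) (y₁ := y₁) (continuous_jac (m := m))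
    have i1 : IntegrableOn (fun q => m.jac q • ‖F q‖ ^ 2) (rect y₀ y₁) :=
      Integrable.bdd_smul ((memLp_two_iff_integrable_sq_norm hF.1).1 hF) C
        continuous_jac.aestronglyMeasurable hC
    exact i1.congr_fun (fun q hq => by simp only [h.lift_pt F hq]) measurableSet_rect
  refine Integrable.integrableOn ?_
  rwa [integrableOn_iff_integrable_of_support_subset] at this
  intro x hx
  by_contra hx'
  exact hx (hz x hx')

end Motion

namespace PieceData

variable {n : ℕ} (P : PieceData n) {b₀ : ℝ}

/-- The damping factor at radius `r`. -/
def beta (r : ℝ) : ℝ := 1 - P.K * P.m.s * (1 - r)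

/-- The competitor in the coordinates of the sector. -/
def field (q : ℝ × ℝ) : Target n := q.1 • P.v q.2 + (q.1 * P.beta q.1) • P.w q.2

/-- The gradient of the competitor in the coordinates of the sector. -/
def grad (j : Fin 2) (q : ℝ × ℝ) : Target n :=
  circlePoint (P.m.ang q) j • (P.v q.2 + (P.beta q.1 + q.1 * (P.K * P.m.s)) • P.w q.2) +
    (P.m.cofA j q * (P.m.lam q.1)⁻¹) • (P.v' q.2 + P.beta q.1 • P.w' q.2)

/-- The boundary datum. -/
def datum (y : ℝ) : Target n := P.v y + P.w y

/-- The competitor on the plane, extended by zero. -/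
def fn : Plane → Target n := P.m.lift P.y₀ P.y₁ P.field

/-- The gradient of the competitor on the plane, extended by zero. -/
def gradFn (j : Fin 2) : Plane → Target n := P.m.lift P.y₀ P.y₁ (P.grad j)

/-- The conditions under which the competitor is an `H¹` function. -/
structure Admissible (b₀ : ℝ) : Prop where
  good : P.m.Good b₀ P.y₀ P.y₁
  hv : IsH1 P.v P.v'
  hw : IsH1 P.w P.w'
  bd : (P.v P.y₀ = 0 ∧ P.v P.y₁ = 0 ∧ P.w P.y₀ = 0 ∧ P.w P.y₁ = 0) ∨
    (P.y₁ = P.y₀ + 2 * Real.pi ∧ P.m.p₀ = 0 ∧ P.m.p₁ = 0 ∧ P.v P.y₁ = P.v P.y₀ ∧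
      P.w P.y₁ = P.w P.y₀)

variable {P}

theorem continuous_beta : Continuous P.beta := by unfold beta; fun_prop

theorem Admissible.measurable_field (h : P.Admissible b₀) : Measurable P.field := by
  have h1 := h.hv.continuous
  have h2 := h.hw.continuous
  have h3 := continuous_beta (P := P)
  exact Continuous.measurable ((continuous_fst.smul (h1.comp continuous_snd)).add
    ((continuous_fst.mul (h3.comp continuous_fst)).smul (h2.comp continuous_snd)))

theorem Admissible.measurable_grad (h : P.Admissible b₀) (j : Fin 2) : Measurable (P.grad j) := by
  have h1 : Measurable fun q : ℝ × ℝ => P.v q.2 := h.hv.continuous.measurable.comp measurable_snd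
  have h2 : Measurable fun q : ℝ × ℝ => P.w q.2 := h.hw.continuous.measurable.comp measurable_snd
  have h3 : Measurable fun q : ℝ × ℝ => P.beta q.1 :=
    (continuous_beta (P := P)).measurable.comp measurable_fst
  have h4 := (Motion.continuous_circlePoint_ang (m := P.m) j).measurable
  have h5 := (Motion.continuous_cofA (m := P.m) j).measurable
  have h6 : Measurable fun q : ℝ × ℝ => P.m.lam q.1 :=
    (Motion.continuous_lam (m := P.m)).measurable.comp measurable_fst
  have h7 : Measurable fun q : ℝ × ℝ => P.v' q.2 := h.hv.meas.measurable.comp measurable_snd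
  have h8 : Measurable fun q : ℝ × ℝ => P.w' q.2 := h.hw.meas.measurable.comp measurable_snd
  exact (h4.smul (h1.add ((h3.add (measurable_fst.mul measurable_const)).smul h2))).add
    ((h5.mul h6.inv).smul (h7.add (h3.smul h8)))

theorem Admissible.memLp_fn (h : P.Admissible b₀) : MemLp P.fn 2 (volume.restrict disc) := by
  refine h.good.memLp_lift h.measurable_field ?_
  have h3 := continuous_beta (P := P)
  exact (memLp_smul_snd continuous_fst.continuousOn
    (memLp_two_of_continuous h.hv.continuous P.y₀ P.y₁)).add
    (memLp_smul_snd (continuous_fst.mul (h3.comp continuous_fst)).continuousOn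
      (memLp_two_of_continuous h.hw.continuous P.y₀ P.y₁))

theorem Admissible.continuousOn_inv_lam (h : P.Admissible b₀) :
    ContinuousOn (fun q : ℝ × ℝ => (P.m.lam q.1)⁻¹) (Icc 0 1 ×ˢ Icc P.y₀ P.y₁) :=
  (Motion.continuous_lam.comp continuous_fst).continuousOn.inv₀
    fun _ hq => (h.good.lam_pos _ hq.1).ne'

theorem Admissible.memLp_grad (h : P.Admissible b₀) (j : Fin 2) :
    MemLp (P.grad j) 2 (volume.restrict (rect P.y₀ P.y₁)) := by
  have h3 := (continuous_beta (P := P)).comp (continuous_fst (Y := ℝ))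
  have h4 := Motion.continuous_circlePoint_ang (m := P.m) j
  have h5 := (Motion.continuous_cofA (m := P.m) j).continuousOn.mul h.continuousOn_inv_lam
  have e : P.grad j = fun q => circlePoint (P.m.ang q) j • P.v q.2 +
      (circlePoint (P.m.ang q) j * (P.beta q.1 + q.1 * (P.K * P.m.s))) • P.w q.2 +
      ((P.m.cofA j q * (P.m.lam q.1)⁻¹) • P.v' q.2 +
      (P.m.cofA j q * (P.m.lam q.1)⁻¹ * P.beta q.1) • P.w' q.2) := by
    ext1 q; rw [grad]; module
  rw [e]
  exact ((memLp_smul_snd h4.continuousOn (memLp_two_of_continuous h.hv.continuous _ _)).add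
    (memLp_smul_snd (h4.mul (h3.add (continuous_fst.mul continuous_const))).continuousOn
      (memLp_two_of_continuous h.hw.continuous _ _))).add
    ((memLp_smul_snd h5 (h.hv.memLp _ _)).add
      (memLp_smul_snd (h5.mul h3.continuousOn) (h.hw.memLp _ _)))

theorem Admissible.memLp_gradFn (h : P.Admissible b₀) (j : Fin 2) :
    MemLp (P.gradFn j) 2 (volume.restrict disc) :=
  h.good.memLp_lift (h.measurable_grad j) (h.memLp_grad j)

/-- Nothing is left on the lateral rays: either the datum vanishes there, or the two rays are the
two sides of one motionless slit and their contributions coincide. -/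
theorem Admissible.bd_smul (h : P.Admissible b₀) {b : ℝ → Target n} (hb : b = P.v ∨ b = P.w)
    (φ : Plane → ℝ) (j : Fin 2) (r : ℝ) :
    (φ (P.m.pt (r, P.y₁)) * P.m.cofA j (r, P.y₁)) • b P.y₁ =
      (φ (P.m.pt (r, P.y₀)) * P.m.cofA j (r, P.y₀)) • b P.y₀ := by
  rcases h.bd with ⟨h1, h2, h3, h4⟩ | ⟨h1, h2, h3, h4, h5⟩
  · rcases hb with rfl | rfl
    · rw [h1, h2, smul_zero, smul_zero]
    · rw [h3, h4, smul_zero, smul_zero]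
  · have e1 : P.m.pt (r, P.y₁) = P.m.pt (r, P.y₀) := by
      simp [Motion.pt, Motion.ang, Motion.disp, h1, h2, h3, circlePoint_periodic P.y₀]
    have e2 : P.m.cofA j (r, P.y₁) = P.m.cofA j (r, P.y₀) := by
      simp [Motion.cofA, Motion.ang, Motion.angR, Motion.disp, h1, h2, h3, circleTangent]
    rcases hb with rfl | rfl
    · rw [e1, e2, h4]
    · rw [e1, e2, h5]

/-- The Gauss-Green formula for the competitor. -/
theorem Admissible.gaussGreen (h : P.Admissible b₀) {φ : Plane → ℝ} (hφ : ContDiff ℝ ∞ φ)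
    (j : Fin 2) :
    ∫ x in disc, (partialDeriv j φ x • P.fn x + φ x • P.gradFn j x) =
      ∫ y in P.y₀..P.y₁, (φ (circlePoint y) * circlePoint y j) • P.datum y := by
  have hg := h.good
  have hy := hg.lt.le
  rw [Motion.setIntegral_disc_of_zero (m := P.m) (y₀ := P.y₀) (y₁ := P.y₁) fun x hx => by
      simp [fn, gradFn, Motion.lift_of_notMem _ hx], hg.setIntegral_sector]
  have hβ : ∀ r, HasDerivAt (fun r => r * P.beta r) (P.beta r + r * (P.K * P.m.s)) r := fun r => by
    have h1 : HasDerivAt P.beta (P.K * P.m.s) r :=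
      ((((hasDerivAt_id r).const_sub 1).const_mul (P.K * P.m.s)).const_sub 1).congr_deriv
        (by ring)
    exact ((hasDerivAt_id r).mul h1).congr_deriv (by simp)
  have cβ := continuous_beta (P := P)
  have g1 := Motion.gaussGreen_rect (m := P.m) hy h.hv.toIsPrimitive hasDerivAt_id
    continuous_const rfl hφ j (h.bd_smul (Or.inl rfl) φ j)
  have g2 := Motion.gaussGreen_rect (m := P.m) hy h.hw.toIsPrimitive hβ
    (by fun_prop) (by simp) hφ j (h.bd_smul (Or.inr rfl) φ j)
  have c0 : Continuous fun q => partialDeriv j φ (P.m.pt q) :=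
    ((hφ.continuous_fderiv (by simp)).comp Motion.continuous_pt).clm_apply continuous_const
  have c3 : Continuous fun q => φ (P.m.pt q) := hφ.continuous.comp Motion.continuous_pt
  have c4 := Motion.continuous_cofR (m := P.m) j
  have c5 := Motion.continuous_cofA (m := P.m) j
  have c6 := Motion.continuous_jac (m := P.m)
  have hint : ∀ {b b' : ℝ → Target n} {α α' : ℝ → ℝ}, IsH1 b b' → Continuous α → Continuous α' →
      IntegrableOn (fun q : ℝ × ℝ =>
      (α q.1 * (P.m.jac q * partialDeriv j φ (P.m.pt q))) • b q.2 +
      φ (P.m.pt q) • ((α' q.1 * P.m.cofR j q) • b q.2 + (α q.1 * P.m.cofA j q) • b' q.2))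
      (rect P.y₀ P.y₁) := by
    intro b b' α α' hb hα hα'
    have d1 := hα.comp (continuous_fst (Y := ℝ))
    have d2 := hα'.comp (continuous_fst (Y := ℝ))
    have hbI : IntegrableOn b (Ioo P.y₀ P.y₁) :=
      (hb.continuous.integrableOn_Icc).mono_set Ioo_subset_Icc_self
    have := (integrable_smul_snd (d1.mul (c6.mul c0)) hbI).add
      ((integrable_smul_snd (c3.mul (d2.mul c4)) hbI).add
        (integrable_smul_snd (c3.mul (d1.mul c5)) hb.integrableOn_Ioo))
    refine this.congr (Filter.Eventually.of_forall fun q => ?_)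
    simp only [Pi.add_apply, Pi.mul_apply, Function.comp_apply]
    module
  have i1 := hint h.hv continuous_id continuous_const (α' := fun _ => 1)
  have i2 := hint h.hw (α := fun r => r * P.beta r)
    (α' := fun r => P.beta r + r * (P.K * P.m.s)) (by fun_prop) (by fun_prop)
  have e : ∫ q in rect P.y₀ P.y₁, P.m.jac q • (partialDeriv j φ (P.m.pt q) • P.fn (P.m.pt q) +
      φ (P.m.pt q) • P.gradFn j (P.m.pt q)) = ∫ q in rect P.y₀ P.y₁,
      (((id q.1 * (P.m.jac q * partialDeriv j φ (P.m.pt q))) • P.v q.2 +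
      φ (P.m.pt q) • ((1 * P.m.cofR j q) • P.v q.2 + (id q.1 * P.m.cofA j q) • P.v' q.2)) +
      ((q.1 * P.beta q.1 * (P.m.jac q * partialDeriv j φ (P.m.pt q))) • P.w q.2 +
      φ (P.m.pt q) • (((P.beta q.1 + q.1 * (P.K * P.m.s)) * P.m.cofR j q) • P.w q.2 +
      (q.1 * P.beta q.1 * P.m.cofA j q) • P.w' q.2))) := by
    refine setIntegral_congr_fun measurableSet_rect fun q hq => ?_
    simp only [fn, gradFn, hg.lift_pt _ hq, field, grad, id_eq, Motion.cofR]
    have hl := (hg.lam_pos _ (Ioo_subset_Icc_self hq.1)).ne'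
    -- The factor λ⁻¹ of the angular gradient is absorbed by the Jacobian rλ, which gives the form
    -- required by `gaussGreen_rect`.
    have hJ : P.m.jac q * (P.m.cofA j q * (P.m.lam q.1)⁻¹) = q.1 * P.m.cofA j q := by
      rw [Motion.jac]; field_simp
    have : P.m.jac q • (partialDeriv j φ (P.m.pt q) •
        (q.1 • P.v q.2 + (q.1 * P.beta q.1) • P.w q.2) + φ (P.m.pt q) •
        (circlePoint (P.m.ang q) j • (P.v q.2 + (P.beta q.1 + q.1 * (P.K * P.m.s)) • P.w q.2) +
        (P.m.cofA j q * (P.m.lam q.1)⁻¹) • (P.v' q.2 + P.beta q.1 • P.w' q.2))) =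
        (P.m.jac q * partialDeriv j φ (P.m.pt q)) •
        (q.1 • P.v q.2 + (q.1 * P.beta q.1) • P.w q.2) + φ (P.m.pt q) •
        ((P.m.jac q * circlePoint (P.m.ang q) j) •
          (P.v q.2 + (P.beta q.1 + q.1 * (P.K * P.m.s)) • P.w q.2) +
        (P.m.jac q * (P.m.cofA j q * (P.m.lam q.1)⁻¹)) •
          (P.v' q.2 + P.beta q.1 • P.w' q.2)) := by module
    rw [this, hJ]
    module
  rw [e, integral_add i1 i2, g1, g2, ← intervalIntegral.integral_add]
  · refine intervalIntegral.integral_congr fun y _ => ?_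
    simp only [datum, beta, id_eq]
    module
  · have := hφ.continuous.comp continuous_circlePoint
    have c := h.hv.continuous
    have d : Continuous fun y => circlePoint y j :=
      (EuclideanSpace.proj j : Plane →L[ℝ] ℝ).continuous.comp continuous_circlePoint
    exact ((continuous_const.mul (this.mul d)).smul c).intervalIntegrable _ _
  · have := hφ.continuous.comp continuous_circlePoint
    have c := h.hw.continuous
    have d : Continuous fun y => circlePoint y j :=
      (EuclideanSpace.proj j : Plane →L[ℝ] ℝ).continuous.comp continuous_circlePoint
    exact ((continuous_const.mul (this.mul d)).smul c).intervalIntegrable _ _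

end PieceData

end Epi

end

/-! ### The slicing formula for the Weiss energy -/

noncomputable section

namespace Epi

theorem sum_norm_sq_frame {n : ℕ} (θ : ℝ) (a b : Target n) :
    ∑ j : Fin 2, ‖circlePoint θ j • a + circleTangent θ j • b‖ ^ 2 = ‖a‖ ^ 2 + ‖b‖ ^ 2 := by
  have h := Real.sin_sq_add_cos_sq θ
  simp only [Fin.sum_univ_two, norm_add_sq_real, norm_smul, mul_pow, inner_smul_left,
    inner_smul_right, circlePoint, circleTangent, Real.norm_eq_abs, sq_abs]
  simp
  linear_combination (‖a‖ ^ 2 + ‖b‖ ^ 2) * h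

namespace PieceData

variable {n : ℕ} (P : PieceData n) {b₀ : ℝ}

/-- The angular profile of the competitor at radius `r`. -/
def prof (r y : ℝ) : Target n := P.v y + P.beta r • P.w y

/-- The angular derivative of the profile of the competitor at radius `r`. -/
def profDeriv (r y : ℝ) : Target n := P.v' y + P.beta r • P.w' y

/-- The radial derivative of the profile of the competitor. -/
def eta (r y : ℝ) : Target n :=
  (P.K * P.m.s) • P.w y + (P.m.s * P.m.disp y * (P.m.lam r)⁻¹) • P.profDeriv r y

/-- The conditions under which the two parts of the datum decouple. -/
structure Orthogonal : Prop where
  inner_eq : ∫ y in P.y₀..P.y₁, inner ℝ (P.v y) (P.w y) = 0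
  inner_deriv_eq : ∫ y in P.y₀..P.y₁, inner ℝ (P.v' y) (P.w' y) = 0

/-- The mass of the undamped part. -/
def massV : ℝ := ∫ y in P.y₀..P.y₁, ‖P.v y‖ ^ 2

/-- The mass of the damped part. -/
def massW : ℝ := ∫ y in P.y₀..P.y₁, ‖P.w y‖ ^ 2

/-- The Dirichlet energy of the undamped part. -/
def dirV : ℝ := ∫ y in P.y₀..P.y₁, ‖P.v' y‖ ^ 2

/-- The Dirichlet energy of the damped part. -/
def dirW : ℝ := ∫ y in P.y₀..P.y₁, ‖P.w' y‖ ^ 2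

variable {P}

/-- In the orthonormal frame at the moved angle, the radial component is prof + r eta and the
tangential one is λ⁻¹ profDeriv. The radial drift of the angle, contained in `cofA`, supplies the
displacement term of `eta`. -/
theorem sum_norm_grad (q : ℝ × ℝ) : ∑ j, ‖P.grad j q‖ ^ 2 =
    ‖P.prof q.1 q.2 + q.1 • P.eta q.1 q.2‖ ^ 2 +
      ‖(P.m.lam q.1)⁻¹ • P.profDeriv q.1 q.2‖ ^ 2 := by
  rw [← sum_norm_sq_frame (P.m.ang q)]
  refine Finset.sum_congr rfl fun j _ => ?_
  congr 2
  rw [grad, prof, eta, profDeriv, Motion.cofA, Motion.angR]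
  module

theorem Admissible.isH1_prof (h : P.Admissible b₀) (r : ℝ) : IsH1 (P.prof r) (P.profDeriv r) :=
  h.hv.add (h.hw.const_smul _)

theorem integral_norm_add_smul_sq {f g : ℝ → Target n} {x y a : ℝ}
    (hf : IntervalIntegrable (fun t => ‖f t‖ ^ 2) volume x y)
    (hg : IntervalIntegrable (fun t => ‖g t‖ ^ 2) volume x y)
    (hfg : IntervalIntegrable (fun t => inner ℝ (f t) (g t)) volume x y)
    (h0 : ∫ t in x..y, inner ℝ (f t) (g t) = 0) :
    ∫ t in x..y, ‖f t + a • g t‖ ^ 2 =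
      (∫ t in x..y, ‖f t‖ ^ 2) + a ^ 2 * ∫ t in x..y, ‖g t‖ ^ 2 := by
  have : ∀ t, ‖f t + a • g t‖ ^ 2 =
      ‖f t‖ ^ 2 + a ^ 2 * ‖g t‖ ^ 2 + 2 * a * inner ℝ (f t) (g t) := fun t => by
    rw [norm_add_sq_real, inner_smul_right, norm_smul, mul_pow, Real.norm_eq_abs, sq_abs]; ring
  simp only [this]
  rw [intervalIntegral.integral_add (hf.add (hg.const_mul _)) (hfg.const_mul _),
    intervalIntegral.integral_add hf (hg.const_mul _), intervalIntegral.integral_const_mul,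
    intervalIntegral.integral_const_mul, h0]
  ring

theorem Admissible.integral_prof (h : P.Admissible b₀) (ho : P.Orthogonal) (r : ℝ) :
    ∫ y in P.y₀..P.y₁, ‖P.prof r y‖ ^ 2 = P.massV + P.beta r ^ 2 * P.massW :=
  integral_norm_add_smul_sq ((h.hv.continuous.norm.pow 2).intervalIntegrable _ _)
    ((h.hw.continuous.norm.pow 2).intervalIntegrable _ _)
    ((h.hv.continuous.inner h.hw.continuous).intervalIntegrable _ _) ho.inner_eq

theorem Admissible.integral_profDeriv (h : P.Admissible b₀) (ho : P.Orthogonal) (r : ℝ) :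
    ∫ y in P.y₀..P.y₁, ‖P.profDeriv r y‖ ^ 2 = P.dirV + P.beta r ^ 2 * P.dirW :=
  integral_norm_add_smul_sq (h.hv.sq _ _) (h.hw.sq _ _) (h.hv.inner_int h.hw _ _)
    ho.inner_deriv_eq

theorem Admissible.integral_inner_prof_w (h : P.Admissible b₀) (ho : P.Orthogonal) (r : ℝ) :
    ∫ y in P.y₀..P.y₁, inner ℝ (P.prof r y) (P.w y) = P.beta r * P.massW := by
  simp only [prof, inner_add_left, inner_smul_left, real_inner_self_eq_norm_sq]
  have i1 : IntervalIntegrable (fun y => inner ℝ (P.v y) (P.w y)) volume P.y₀ P.y₁ :=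
    (h.hv.continuous.inner h.hw.continuous).intervalIntegrable _ _
  have i2 : IntervalIntegrable (fun y => P.beta r * ‖P.w y‖ ^ 2) volume P.y₀ P.y₁ :=
    ((h.hw.continuous.norm.pow 2).intervalIntegrable _ _).const_mul _
  have := intervalIntegral.integral_add i1 i2
  rw [ho.inner_eq, intervalIntegral.integral_const_mul, zero_add] at this
  simpa [massW] using this

theorem Admissible.disp_bd (h : P.Admissible b₀) (r : ℝ) :
    P.m.disp P.y₁ * ‖P.prof r P.y₁‖ ^ 2 = P.m.disp P.y₀ * ‖P.prof r P.y₀‖ ^ 2 := by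
  rcases h.bd with ⟨h1, h2, h3, h4⟩ | ⟨-, h2, h3, -⟩
  · simp [prof, h1, h2, h3, h4]
  · simp [Motion.disp, h2, h3]

theorem continuous_disp : Continuous P.m.disp := by unfold Motion.disp; fun_prop

theorem Admissible.intervalIntegrable_inner_prof (h : P.Admissible b₀) (r : ℝ) {a : ℝ → ℝ}
    (ha : Continuous a) : IntervalIntegrable
      (fun y => a y * inner ℝ (P.profDeriv r y) (P.prof r y)) volume P.y₀ P.y₁ := by
  have hu := h.isH1_prof r
  have hw : IsPrimitive (fun y => inner ℝ (P.prof r y) (P.prof r y)) _ :=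
    hu.toIsPrimitive.inner hu.toIsPrimitive
  have := (hw.int P.y₀ P.y₁).continuousOn_mul
    (continuous_const.mul ha : Continuous fun y => 2⁻¹ * a y).continuousOn
  refine this.congr (fun y _ => ?_)
  simp only [real_inner_comm, Pi.mul_apply]
  ring

/-- Integration of the derivative of disp · |prof|², whose boundary values agree by `disp_bd`. -/
theorem Admissible.integral_disp_inner (h : P.Admissible b₀) (ho : P.Orthogonal) (r : ℝ) :
    2 * ∫ y in P.y₀..P.y₁, P.m.disp y * inner ℝ (P.profDeriv r y) (P.prof r y) =
      -(P.m.p₁ * (P.massV + P.beta r ^ 2 * P.massW)) := by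
  have hu := h.isH1_prof r
  have hd : IsPrimitive P.m.disp (fun _ => P.m.p₁) :=
    .of_hasDerivAt (fun t => (((hasDerivAt_id t).const_mul P.m.p₁).const_add P.m.p₀).congr_deriv
      (by simp)) continuous_const
  have e := (hd.mul (hu.toIsPrimitive.inner hu.toIsPrimitive)).eq P.y₀ P.y₁
  simp only [real_inner_self_eq_norm_sq] at e
  rw [h.disp_bd, sub_self] at e
  have i1 : IntervalIntegrable (fun y => P.m.p₁ * ‖P.prof r y‖ ^ 2) volume P.y₀ P.y₁ :=
    ((hu.continuous.norm.pow 2).intervalIntegrable _ _).const_mul _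
  have i2 := (h.intervalIntegrable_inner_prof r (continuous_disp (P := P))).const_mul 2
  have e2 : ∫ y in P.y₀..P.y₁, (P.m.p₁ * ‖P.prof r y‖ ^ 2 + P.m.disp y *
      (inner ℝ (P.profDeriv r y) (P.prof r y) + inner ℝ (P.prof r y) (P.profDeriv r y))) =
      ∫ y in P.y₀..P.y₁, (P.m.p₁ * ‖P.prof r y‖ ^ 2 +
        2 * (P.m.disp y * inner ℝ (P.profDeriv r y) (P.prof r y))) := by
    refine intervalIntegral.integral_congr fun y _ => ?_
    simp only [real_inner_comm (P.prof r y)]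
    rw [real_inner_comm]
    ring
  rw [e2, intervalIntegral.integral_add i1 i2, intervalIntegral.integral_const_mul,
    intervalIntegral.integral_const_mul, h.integral_prof ho] at e
  linarith

theorem Admissible.memLp_eta (h : P.Admissible b₀) (r : ℝ) :
    IntervalIntegrable (fun y => ‖P.eta r y‖ ^ 2) volume P.y₀ P.y₁ := by
  have hu := h.isH1_prof r
  have i1 : IntervalIntegrable (fun y => 2 * ‖(P.K * P.m.s) • P.w y‖ ^ 2) volume P.y₀ P.y₁ := by
    have := h.hw.continuous
    exact (by fun_prop : Continuous fun y => 2 * ‖(P.K * P.m.s) • P.w y‖ ^ 2).intervalIntegrable _ _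
  have c : Continuous fun y => 2 * (P.m.s * P.m.disp y * (P.m.lam r)⁻¹) ^ 2 := by
    have := continuous_disp (P := P)
    fun_prop
  have i2 := (hu.sq P.y₀ P.y₁).continuousOn_mul c.continuousOn
  refine (i1.add i2).mono_fun ?_ (Filter.Eventually.of_forall fun y => ?_)
  · have c2 : Continuous fun y => (P.m.s * P.m.disp y * (P.m.lam r)⁻¹) := by
      have := continuous_disp (P := P)
      fun_prop
    exact (((h.hw.continuous.const_smul (P.K * P.m.s)).stronglyMeasurable.add
      (c2.stronglyMeasurable.smul hu.meas)).norm.pow 2).aestronglyMeasurable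
  · show ‖‖P.eta r y‖ ^ 2‖ ≤ ‖_‖
    rw [Real.norm_of_nonneg (sq_nonneg _)]
    refine (sq_norm_add_le _ _).trans (le_trans (le_of_eq ?_) (le_abs_self _))
    simp only [norm_smul, mul_pow, Real.norm_eq_abs, sq_abs]
    ring

/-- The cross terms between prof and eta are the rate of change of the mass of the slices. They
complete the first bracket to the r-derivative of r²λ(massV + β² massW), whose integral over [0, 1]
is the boundary mass subtracted in the Weiss energy. The second bracket is `weissDensity`. -/
theorem Admissible.integral_inner (h : P.Admissible b₀) (ho : P.Orthogonal) {r : ℝ}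
    (hr : r ∈ Icc (0 : ℝ) 1) :
    ∫ y in P.y₀..P.y₁, P.m.jac (r, y) * ∑ j, ‖P.grad j (r, y)‖ ^ 2 =
      (2 * r * (P.m.lam r * (P.massV + P.beta r ^ 2 * P.massW)) +
        r ^ 2 * (-(P.m.s * P.m.p₁) * (P.massV + P.beta r ^ 2 * P.massW) +
          P.m.lam r * (2 * P.beta r * (P.K * P.m.s) * P.massW))) +
      (r * ((P.dirV + P.beta r ^ 2 * P.dirW) / P.m.lam r -
        P.m.lam r * (P.massV + P.beta r ^ 2 * P.massW)) +
        r ^ 3 * P.m.lam r * ∫ y in P.y₀..P.y₁, ‖P.eta r y‖ ^ 2) := by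
  have hl := (h.good.lam_pos r hr).ne'
  have hu := h.isH1_prof r
  have e : ∀ y, P.m.jac (r, y) * ∑ j, ‖P.grad j (r, y)‖ ^ 2 =
      (r * P.m.lam r) * ‖P.prof r y‖ ^ 2 +
      (2 * r ^ 2 * P.m.lam r * (P.K * P.m.s)) * inner ℝ (P.prof r y) (P.w y) +
      (r ^ 2 * P.m.s * 2) * (P.m.disp y * inner ℝ (P.profDeriv r y) (P.prof r y)) +
      (r ^ 3 * P.m.lam r) * ‖P.eta r y‖ ^ 2 +
      (r * (P.m.lam r)⁻¹) * ‖P.profDeriv r y‖ ^ 2 := fun y => by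
    have hin : inner ℝ (P.prof r y) (P.eta r y) = (P.K * P.m.s) * inner ℝ (P.prof r y) (P.w y) +
        (P.m.s * P.m.disp y * (P.m.lam r)⁻¹) * inner ℝ (P.profDeriv r y) (P.prof r y) := by
      rw [eta, inner_add_right, inner_smul_right, inner_smul_right,
        real_inner_comm (P.profDeriv r y)]
    rw [sum_norm_grad, norm_add_sq_real, inner_smul_right, norm_smul, norm_smul, mul_pow, mul_pow,
      Real.norm_eq_abs, Real.norm_eq_abs, sq_abs, sq_abs, Motion.jac, hin]
    field_simp
    ring
  simp only [e]
  have i1 : IntervalIntegrable (fun y => (r * P.m.lam r) * ‖P.prof r y‖ ^ 2) volume P.y₀ P.y₁ :=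
    ((hu.continuous.norm.pow 2).intervalIntegrable _ _).const_mul _
  have i2 : IntervalIntegrable (fun y => (2 * r ^ 2 * P.m.lam r * (P.K * P.m.s)) *
      inner ℝ (P.prof r y) (P.w y)) volume P.y₀ P.y₁ :=
    ((hu.continuous.inner h.hw.continuous).intervalIntegrable _ _).const_mul _
  have i3 := (h.intervalIntegrable_inner_prof r (continuous_disp (P := P))).const_mul
    (r ^ 2 * P.m.s * 2)
  have i4 := (h.memLp_eta r).const_mul (r ^ 3 * P.m.lam r)
  have i5 := (hu.sq P.y₀ P.y₁).const_mul (r * (P.m.lam r)⁻¹)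
  rw [intervalIntegral.integral_add (((i1.add i2).add i3).add i4) i5,
    intervalIntegral.integral_add ((i1.add i2).add i3) i4,
    intervalIntegral.integral_add (i1.add i2) i3,
    intervalIntegral.integral_add i1 i2]
  simp only [intervalIntegral.integral_const_mul]
  rw [h.integral_prof ho, h.integral_inner_prof_w ho, h.integral_profDeriv ho]
  have := h.integral_disp_inner ho r
  rw [div_eq_mul_inv]
  linear_combination (r ^ 2 * P.m.s) * this

theorem Admissible.integrableOn_density (h : P.Admissible b₀) :
    IntegrableOn (fun q => P.m.jac q * ∑ j, ‖P.grad j q‖ ^ 2) (rect P.y₀ P.y₁) := by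
  obtain ⟨C, hC⟩ := exists_bound_rect (y₀ := P.y₀) (y₁ := P.y₁) (Motion.continuous_jac (m := P.m))
  have : Integrable (fun q => ∑ j, ‖P.grad j q‖ ^ 2) (volume.restrict (rect P.y₀ P.y₁)) :=
    integrable_finsetSum _ fun j _ =>
      (memLp_two_iff_integrable_sq_norm (h.memLp_grad j).1).1 (h.memLp_grad j)
  exact this.bdd_smul C Motion.continuous_jac.aestronglyMeasurable hC

theorem Admissible.integral_disc (h : P.Admissible b₀) :
    ∫ x in disc, ∑ j, ‖P.gradFn j x‖ ^ 2 =
      ∫ q in rect P.y₀ P.y₁, P.m.jac q * ∑ j, ‖P.grad j q‖ ^ 2 := by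
  rw [Motion.setIntegral_disc_of_zero (m := P.m) (y₀ := P.y₀) (y₁ := P.y₁) fun x hx => by
      simp [gradFn, Motion.lift_of_notMem _ hx], h.good.setIntegral_sector]
  refine setIntegral_congr_fun measurableSet_rect fun q hq => ?_
  simp only [gradFn, h.good.lift_pt _ hq, smul_eq_mul]

variable (P) in
/-- The radial density of the Weiss energy of the competitor. -/
def weissDensity (r : ℝ) : ℝ :=
  r * ((P.dirV + P.beta r ^ 2 * P.dirW) / P.m.lam r -
    P.m.lam r * (P.massV + P.beta r ^ 2 * P.massW)) +
  r ^ 3 * P.m.lam r * ∫ y in P.y₀..P.y₁, ‖P.eta r y‖ ^ 2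

/-- The slicing formula for the Weiss energy of the competitor. -/
theorem Admissible.energy_eq (h : P.Admissible b₀) (ho : P.Orthogonal) :
    IntervalIntegrable P.weissDensity volume 0 1 ∧
    (∫ x in disc, ∑ j, ‖P.gradFn j x‖ ^ 2) - (P.massV + P.massW) =
      ∫ r in (0 : ℝ)..1, P.weissDensity r := by
  have hy := h.good.lt.le
  set D : ℝ → ℝ := fun r => 2 * r * (P.m.lam r * (P.massV + P.beta r ^ 2 * P.massW)) +
        r ^ 2 * (-(P.m.s * P.m.p₁) * (P.massV + P.beta r ^ 2 * P.massW) +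
          P.m.lam r * (2 * P.beta r * (P.K * P.m.s) * P.massW)) with hD
  have hDd : ∀ r, HasDerivAt (fun r => r ^ 2 * (P.m.lam r * (P.massV + P.beta r ^ 2 * P.massW)))
      (D r) r := fun r => by
    have h1 : HasDerivAt P.beta (P.K * P.m.s) r :=
      ((((hasDerivAt_id r).const_sub 1).const_mul (P.K * P.m.s)).const_sub 1).congr_deriv
        (by ring)
    refine (((hasDerivAt_id r).pow 2).mul ((Motion.hasDerivAt_lam (m := P.m) r).mul
      (((h1.pow 2).mul_const P.massW).const_add P.massV))).congr_deriv ?_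
    simp [hD]
  have hDc : Continuous D := by
    have c1 := continuous_beta (P := P)
    have c2 := Motion.continuous_lam (m := P.m)
    simp only [hD]
    fun_prop
  have hDi : ∫ r in (0 : ℝ)..1, D r = P.massV + P.massW := by
    rw [intervalIntegral.integral_eq_sub_of_hasDerivAt (fun r _ => hDd r)
      (hDc.intervalIntegrable _ _)]
    simp [beta, Motion.lam]
  have hI : IntervalIntegrable (fun r => ∫ y in P.y₀..P.y₁,
      P.m.jac (r, y) * ∑ j, ‖P.grad j (r, y)‖ ^ 2) volume 0 1 := by
    have := h.integrableOn_density
    rw [IntegrableOn, restrict_rect] at this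
    rw [intervalIntegrable_iff_integrableOn_Ioo_of_le zero_le_one]
    refine this.integral_prod_left.congr (Filter.Eventually.of_forall fun r => ?_)
    simp only [intervalIntegral.integral_of_le hy, integral_Ioc_eq_integral_Ioo]
  have e : ∀ r ∈ Icc (0 : ℝ) 1, ∫ y in P.y₀..P.y₁, P.m.jac (r, y) * ∑ j, ‖P.grad j (r, y)‖ ^ 2 =
      D r + P.weissDensity r := fun r hr => h.integral_inner ho hr
  have hI2 : IntervalIntegrable P.weissDensity volume 0 1 := by
    refine (hI.sub (hDc.intervalIntegrable 0 1)).congr fun r hr => ?_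
    rw [uIoc_of_le zero_le_one] at hr
    simp only [e r (Ioc_subset_Icc_self hr)]
    ring
  refine ⟨hI2, ?_⟩
  rw [h.integral_disc, integral_rect h.integrableOn_density hy,
    intervalIntegral.integral_congr (g := fun r => D r + P.weissDensity r)
      (fun r hr => e r (by rwa [uIcc_of_le zero_le_one] at hr)),
    intervalIntegral.integral_add (hDc.intervalIntegrable _ _) hI2, hDi]
  ring

/-- The area of the positivity set of the competitor. -/
theorem Admissible.volume_pos (h : P.Admissible b₀) :
    volume.real ({x | 0 < ‖P.fn x‖} ∩ disc) =
      ∫ q in rect P.y₀ P.y₁, P.m.jac q * {q | P.field q ≠ 0}.indicator 1 q := by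
  have hm : Measurable P.fn := h.good.measurable_lift h.measurable_field
  have hS : MeasurableSet {x | 0 < ‖P.fn x‖} := measurableSet_lt measurable_const hm.norm
  have e1 : volume.real ({x | 0 < ‖P.fn x‖} ∩ disc) =
      ∫ x in disc, {x | 0 < ‖P.fn x‖}.indicator (1 : Plane → ℝ) x := by
    rw [setIntegral_indicator hS, inter_comm]
    simp
  rw [e1, Motion.setIntegral_disc_of_zero (m := P.m) (y₀ := P.y₀) (y₁ := P.y₁) fun x hx => by
      simp [fn, Motion.lift_of_notMem _ hx], h.good.setIntegral_sector]
  refine setIntegral_congr_fun measurableSet_rect fun q hq => ?_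
  simp only [smul_eq_mul, indicator, mem_ofPred_eq, fn, h.good.lift_pt _ hq, norm_pos_iff,
    Pi.one_apply]

end PieceData

end Epi

end

/-! ### The energy estimate for one sector -/

noncomputable section

namespace Epi

/-- The damping rate used for functions with a spectral gap `γ`. -/
def dampRate (γ : ℝ) : ℝ := 1 + 3 * (2 + γ) / γ

/-- The constant in the estimate of the kinetic term. -/
def kineticConst (γ C₀ : ℝ) : ℝ := 3 * dampRate γ ^ 2 + 8 * C₀ + 128 * Real.pi ^ 2

/-- Here P and Q are the Dirichlet energy and mass of the damped part, p is the dilation rate and K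
= `dampRate γ`. Dilation costs at most 2t(P + Q), while (1 - Kt)² ≤ 1 - Kt gains Kt(P - Q). The gap
gives P + Q ≤ ((2 + γ)/γ)(P - Q), so K is chosen such that (K - 1)(P - Q) ≥ 3(P + Q). This covers
the dilation and leaves the surplus t(P + Q). -/
theorem damped_bound {P Q γ t p : ℝ} (hQ : 0 ≤ Q) (hγ : 0 < γ) (hgap : (1 + γ) * Q ≤ P)
    (ht0 : 0 ≤ t) (ht : t ≤ 1 / 2) (hK : dampRate γ * t ≤ 1) (hp : |p| ≤ 1) :
    (1 - dampRate γ * t) ^ 2 * (P / (1 + t * p) - (1 + t * p) * Q) ≤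
      (1 - t) * (P - Q) - t * (P + Q) := by
  obtain ⟨hp1, hp2⟩ := abs_le.1 hp
  have hP : 0 ≤ P := by nlinarith
  have htp1 : -t ≤ t * p := by nlinarith
  have htp2 : t * p ≤ t := by nlinarith
  have hl : 0 < 1 + t * p := by linarith
  have hX1 : P / (1 + t * p) ≤ P * (1 + 2 * t) := by
    rw [div_le_iff₀ hl]
    have : 1 ≤ (1 + 2 * t) * (1 + t * p) := by nlinarith
    nlinarith
  -- Together with `hX1`, which rests on (1 + 2t)(1 - t) ≥ 1 for 0 ≤ t ≤ 1/2, this bounds the effect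
  -- of the dilation.
  have hX2 : (1 - t) * Q ≤ (1 + t * p) * Q := by gcongr; linarith
  set K := dampRate γ with hKdef
  have hY : 0 ≤ (P - Q) + 2 * t * (P + Q) := by nlinarith [mul_nonneg hγ.le hQ, mul_nonneg ht0 hP, mul_nonneg ht0 hQ]
  have hK0 : 0 ≤ K := by rw [hKdef, dampRate]; positivity
  have hKg : 3 * (P + Q) ≤ (K - 1) * (P - Q) := by
    have : K - 1 = 3 * (2 + γ) / γ := by rw [hKdef, dampRate]; ring
    rw [this, div_mul_eq_mul_div, le_div_iff₀ hγ]
    nlinarith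
  have h1 : (1 - K * t) ^ 2 * (P / (1 + t * p) - (1 + t * p) * Q) ≤
      (1 - K * t) ^ 2 * ((P - Q) + 2 * t * (P + Q)) := by
    gcongr
    nlinarith
  have h2 : (1 - K * t) ^ 2 ≤ 1 - K * t := by
    have : 0 ≤ K * t := mul_nonneg hK0 ht0
    nlinarith
  have h3 : (1 - K * t) ^ 2 * ((P - Q) + 2 * t * (P + Q)) ≤
      (1 - K * t) * ((P - Q) + 2 * t * (P + Q)) := by gcongr
  have h4 : 0 ≤ K * t * (2 * t * (P + Q)) := by positivity
  have h5 : t * (3 * (P + Q)) ≤ t * ((K - 1) * (P - Q)) := by gcongr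
  nlinarith

namespace PieceData

variable {n : ℕ} {P : PieceData n} {b₀ : ℝ}

theorem massW_nonneg (hy : P.y₀ ≤ P.y₁) : 0 ≤ P.massW :=
  intervalIntegral.integral_nonneg hy fun _ _ => sq_nonneg _

/-- Everything that is needed for the energy estimate over a moving sector of length `ℓ`, with
target length `L`, spectral gap `γ` and energy gain `D`. -/
structure Improving (P : PieceData n) (b₀ γ C₀ L D : ℝ) (S : Set ℝ) : Prop where
  adm : P.Admissible b₀
  orth : P.Orthogonal
  gap_pos : 0 < γ
  gap : (1 + γ) * P.massW ≤ P.dirW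
  rate : P.K = dampRate γ
  speed_nonneg : 0 ≤ P.m.s
  speed_le : P.m.s ≤ 1 / 2
  speed_rate : dampRate γ * P.m.s ≤ 1
  speed_kin : kineticConst γ C₀ * P.m.s ≤ 2 / 3
  const_nonneg : 0 ≤ C₀
  p₁_le : |P.m.p₁| ≤ 1
  gain_nonneg : 0 ≤ D
  gain : ∀ t ∈ Icc (0 : ℝ) (1 / 2), P.dirV / (1 + t * P.m.p₁) - (1 + t * P.m.p₁) * P.massV ≤
    (1 - t) * (P.dirV - P.massV) - t * D
  disp_sq : ∫ y in P.y₀..P.y₁, P.m.disp y ^ 2 * ‖P.v' y‖ ^ 2 ≤ C₀ * D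
  disp_le : ∀ y ∈ Icc P.y₀ P.y₁, |P.m.disp y| ≤ 4 * Real.pi
  meas : MeasurableSet S
  zero : ∀ y ∈ Ioo P.y₀ P.y₁, y ∉ S → P.v y = 0 ∧ P.w y = 0
  target : P.m.p₁ * volume.real (S ∩ Ioo P.y₀ P.y₁) ≤ L - volume.real (S ∩ Ioo P.y₀ P.y₁)

namespace Improving

variable {γ C₀ L D : ℝ} {S : Set ℝ}

theorem lam_mem (h : P.Improving b₀ γ C₀ L D S) {r : ℝ} (hr : r ∈ Icc (0 : ℝ) 1) :
    P.m.lam r ∈ Icc (1 / 2 : ℝ) (3 / 2) := by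
  have := abs_le.1 h.p₁_le
  have h1 := h.speed_nonneg
  have h2 := h.speed_le
  have ht : P.m.s * (1 - r) ∈ Icc (0 : ℝ) (1 / 2) := by
    constructor <;> nlinarith [hr.1, hr.2]
  rw [Motion.lam]
  constructor <;> nlinarith [ht.1, ht.2]

/-- Every term of `eta` carries a factor s, whence s². The part with disp² |v'|² is paid by the gain
`D` through `disp_sq`, and the part with w' by the bound 4π on the displacement. The coefficients
3K², 8 and 128π² = 8 · 16π² come from λ ≤ 3/2, λ⁻¹ ≤ 2 and |a + b|² ≤ 2|a|² + 2|b|². -/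
theorem kinetic (h : P.Improving b₀ γ C₀ L D S) {r : ℝ} (hr : r ∈ Icc (0 : ℝ) 1) :
    P.m.lam r * ∫ y in P.y₀..P.y₁, ‖P.eta r y‖ ^ 2 ≤
      P.m.s ^ 2 * (kineticConst γ C₀ * (D + P.dirW + P.massW)) := by
  have hl := h.lam_mem hr
  have hlpos : 0 < P.m.lam r := by linarith [hl.1]
  have hy := h.adm.good.lt.le
  have hdc := continuous_disp (P := P)
  have hs := h.speed_nonneg
  have hβ : P.beta r ^ 2 ≤ 1 := by
    have h1 : 0 ≤ dampRate γ * P.m.s * (1 - r) := by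
      have : 0 ≤ dampRate γ := by have := h.gap_pos; rw [dampRate]; positivity
      have := sub_nonneg.2 hr.2
      positivity
    have h2 : dampRate γ * P.m.s * (1 - r) ≤ 1 := by
      nlinarith [h.speed_rate, hr.1, hr.2]
    rw [beta, h.rate]
    nlinarith
  have i0 : IntervalIntegrable (fun y => ‖P.w y‖ ^ 2) volume P.y₀ P.y₁ :=
    (h.adm.hw.continuous.norm.pow 2).intervalIntegrable _ _
  have i1 := (h.adm.hv.sq P.y₀ P.y₁).continuousOn_mul (hdc.pow 2).continuousOn
  have i2 := h.adm.hw.sq P.y₀ P.y₁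
  have hle : ∀ y ∈ Icc P.y₀ P.y₁, P.m.lam r * ‖P.eta r y‖ ^ 2 ≤
      P.m.s ^ 2 * (3 * dampRate γ ^ 2) * ‖P.w y‖ ^ 2 +
      P.m.s ^ 2 * 8 * (P.m.disp y ^ 2 * ‖P.v' y‖ ^ 2) +
      P.m.s ^ 2 * (128 * Real.pi ^ 2) * ‖P.w' y‖ ^ 2 := by
    intro y hyy
    have e1 : ‖P.eta r y‖ ^ 2 ≤ 2 * ((dampRate γ * P.m.s) ^ 2 * ‖P.w y‖ ^ 2) +
        2 * ((P.m.s * P.m.disp y * (P.m.lam r)⁻¹) ^ 2 * ‖P.profDeriv r y‖ ^ 2) := by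
      refine (sq_norm_add_le _ _).trans (le_of_eq ?_)
      simp only [norm_smul, mul_pow, Real.norm_eq_abs, sq_abs, h.rate]
    have e2 : ‖P.profDeriv r y‖ ^ 2 ≤ 2 * ‖P.v' y‖ ^ 2 + 2 * ‖P.w' y‖ ^ 2 := by
      refine (sq_norm_add_le _ _).trans ?_
      rw [norm_smul, mul_pow, Real.norm_eq_abs, sq_abs]
      nlinarith [sq_nonneg ‖P.w' y‖]
    have e3 : P.m.disp y ^ 2 ≤ 16 * Real.pi ^ 2 := by
      have := h.disp_le y hyy
      rw [← sq_abs]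
      nlinarith [abs_nonneg (P.m.disp y)]
    have e4 : P.m.lam r * (P.m.lam r)⁻¹ ^ 2 ≤ 2 := by
      have : P.m.lam r * (P.m.lam r)⁻¹ ^ 2 = (P.m.lam r)⁻¹ := by field_simp
      rw [this]
      have := inv_anti₀ (by norm_num : (0 : ℝ) < 1 / 2) hl.1
      simpa using this
    calc P.m.lam r * ‖P.eta r y‖ ^ 2
        ≤ P.m.lam r * (2 * ((dampRate γ * P.m.s) ^ 2 * ‖P.w y‖ ^ 2) +
          2 * ((P.m.s * P.m.disp y * (P.m.lam r)⁻¹) ^ 2 *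
            (2 * ‖P.v' y‖ ^ 2 + 2 * ‖P.w' y‖ ^ 2))) := by
          gcongr
          refine e1.trans ?_
          gcongr
      _ = P.m.lam r * (2 * ((dampRate γ * P.m.s) ^ 2 * ‖P.w y‖ ^ 2)) +
          4 * ((P.m.lam r * (P.m.lam r)⁻¹ ^ 2) * (P.m.s ^ 2 *
            (P.m.disp y ^ 2 * ‖P.v' y‖ ^ 2 + P.m.disp y ^ 2 * ‖P.w' y‖ ^ 2))) := by ring
      _ ≤ (3 / 2) * (2 * ((dampRate γ * P.m.s) ^ 2 * ‖P.w y‖ ^ 2)) +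
          4 * (2 * (P.m.s ^ 2 *
            (P.m.disp y ^ 2 * ‖P.v' y‖ ^ 2 + 16 * Real.pi ^ 2 * ‖P.w' y‖ ^ 2))) := by
          gcongr
          exact hl.2
      _ = _ := by ring
  have hi := intervalIntegral.integral_mono_on hy ((h.adm.memLp_eta r).const_mul (P.m.lam r))
    (((i0.const_mul _).add (i1.const_mul _)).add (i2.const_mul _)) hle
  rw [intervalIntegral.integral_const_mul, intervalIntegral.integral_add
    ((i0.const_mul _).add (i1.const_mul _)) (i2.const_mul _), intervalIntegral.integral_add
    (i0.const_mul _) (i1.const_mul _)] at hi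
  simp only [intervalIntegral.integral_const_mul] at hi
  refine hi.trans ?_
  have hd := h.disp_sq
  have hW : 0 ≤ P.massW := massW_nonneg hy
  have hW' : 0 ≤ P.dirW := by nlinarith [h.gap, h.gap_pos]
  have hD := h.gain_nonneg
  have hC := h.const_nonneg
  have : P.m.s ^ 2 * (3 * dampRate γ ^ 2) * P.massW + P.m.s ^ 2 * 8 * (C₀ * D) +
      P.m.s ^ 2 * (128 * Real.pi ^ 2) * P.dirW ≤
      P.m.s ^ 2 * (kineticConst γ C₀ * (D + P.dirW + P.massW)) := by
    have : 0 ≤ P.m.s ^ 2 * ((3 * dampRate γ ^ 2 + 128 * Real.pi ^ 2) * D +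
      (3 * dampRate γ ^ 2 + 8 * C₀) * P.dirW + (8 * C₀ + 128 * Real.pi ^ 2) * P.massW) := by
      positivity
    rw [kineticConst]
    nlinarith
  refine le_trans ?_ this
  have : P.m.s ^ 2 * 8 * ∫ y in P.y₀..P.y₁, P.m.disp y ^ 2 * ‖P.v' y‖ ^ 2 ≤
      P.m.s ^ 2 * 8 * (C₀ * D) := by gcongr
  change P.m.s ^ 2 * (3 * dampRate γ ^ 2) * P.massW + _ +
    P.m.s ^ 2 * (128 * Real.pi ^ 2) * P.dirW ≤ _
  exact add_le_add (add_le_add le_rfl this) le_rfl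

/-- The Weiss energy functional of the boundary datum on an interval. -/
def _root_.Epi.PieceData.bdryEnergy (P : PieceData n) (S : Set ℝ) : ℝ :=
  P.dirV + P.dirW - (P.massV + P.massW) + volume.real (S ∩ Ioo P.y₀ P.y₁)

/-- With t = s(1 - r), the undamped, damped and length parts of the ring energy each satisfy the
linear decay estimate towards 0, 0 and L respectively. The surplus t(D + dirW + massW) is kept to
pay for the kinetic term. -/
theorem density_le (h : P.Improving b₀ γ C₀ L D S) {r : ℝ} (hr : r ∈ Icc (0 : ℝ) 1) :
    P.weissDensity r + r * P.m.lam r * volume.real (S ∩ Ioo P.y₀ P.y₁) ≤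
      r * P.bdryEnergy S -
        P.m.s * (r - r ^ 2) * (P.bdryEnergy S - L + (D + P.dirW + P.massW)) +
        r ^ 3 * (P.m.s ^ 2 * (kineticConst γ C₀ * (D + P.dirW + P.massW))) := by
  set t := P.m.s * (1 - r) with ht
  have h1 := h.speed_nonneg
  have h2 := h.speed_le
  have ht0 : 0 ≤ t := mul_nonneg h1 (sub_nonneg.2 hr.2)
  have hts : t ≤ P.m.s := by nlinarith [hr.1]
  have hK0 : 0 ≤ dampRate γ := by have := h.gap_pos; rw [dampRate]; positivity
  have hl : P.m.lam r = 1 + t * P.m.p₁ := by rw [Motion.lam]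
  have hb : P.beta r = 1 - dampRate γ * t := by rw [beta, h.rate, ht]; ring
  have hw := damped_bound (massW_nonneg h.adm.good.lt.le) h.gap_pos h.gap ht0 (by linarith)
    (by nlinarith [h.speed_rate] : dampRate γ * t ≤ 1) h.p₁_le
  have hv := h.gain t ⟨ht0, by linarith⟩
  have hk := h.kinetic hr
  have hm : t * (P.m.p₁ * volume.real (S ∩ Ioo P.y₀ P.y₁)) ≤
      t * (L - volume.real (S ∩ Ioo P.y₀ P.y₁)) := by
    have := h.target
    gcongr
  rw [← hl, ← hb] at hw
  rw [← hl] at hv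
  have e1 : P.weissDensity r = r * ((P.dirV / P.m.lam r - P.m.lam r * P.massV) +
      P.beta r ^ 2 * (P.dirW / P.m.lam r - P.m.lam r * P.massW)) +
      r ^ 3 * (P.m.lam r * ∫ y in P.y₀..P.y₁, ‖P.eta r y‖ ^ 2) := by
    rw [weissDensity]; ring
  have e2 : r * ((P.dirV / P.m.lam r - P.m.lam r * P.massV) +
      P.beta r ^ 2 * (P.dirW / P.m.lam r - P.m.lam r * P.massW)) ≤
      r * (((1 - t) * (P.dirV - P.massV) - t * D) +
        ((1 - t) * (P.dirW - P.massW) - t * (P.dirW + P.massW))) := by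
    have := hr.1
    gcongr
  have e3 : r ^ 3 * (P.m.lam r * ∫ y in P.y₀..P.y₁, ‖P.eta r y‖ ^ 2) ≤
      r ^ 3 * (P.m.s ^ 2 * (kineticConst γ C₀ * (D + P.dirW + P.massW))) := by
    have := hr.1
    gcongr
  have e4 : r * P.m.lam r * volume.real (S ∩ Ioo P.y₀ P.y₁) ≤
      r * (volume.real (S ∩ Ioo P.y₀ P.y₁) + t * (L - volume.real (S ∩ Ioo P.y₀ P.y₁))) := by
    rw [mul_assoc]
    have := hr.1
    gcongr
    rw [hl]
    linarith
  rw [e1, bdryEnergy]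
  have e5 : P.m.s * (r - r ^ 2) = r * t := by rw [ht]; ring
  rw [e5]
  linarith

/-- With E = D + dirW + massW, integrating the density bound gives F/2 - s(F - L + E)/6 + k/4, where
k is the kinetic bound. The threshold 2/3 in `speed_kin` is what makes k/4 ≤ sE/6, and the remaining
terms are the right-hand side. -/
theorem integral_density_le (h : P.Improving b₀ γ C₀ L D S) :
    (∫ x in disc, ∑ j, ‖P.gradFn j x‖ ^ 2) - (P.massV + P.massW) +
      volume.real ({x | 0 < ‖P.fn x‖} ∩ disc) ≤
      (1 - P.m.s / 3) * ((P.bdryEnergy S - L) / 2) + L / 2 := by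
  obtain ⟨hI, he⟩ := h.adm.energy_eq h.orth
  set μ := volume.real (S ∩ Ioo P.y₀ P.y₁) with hμ
  have hy := h.adm.good.lt.le
  have cl := Motion.continuous_lam (m := P.m)
  have cj := Motion.continuous_jac (m := P.m)
  obtain ⟨C, hC⟩ := exists_bound_rect (y₀ := P.y₀) (y₁ := P.y₁) cj
  have hfinite : IsFiniteMeasure (volume.restrict (rect P.y₀ P.y₁)) := by
    rw [restrict_rect]; infer_instance
  have hmeas1 : MeasurableSet {q | P.field q ≠ 0} :=
    (measurableSet_eq_fun h.adm.measurable_field measurable_const).compl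
  have hmeas2 : MeasurableSet {q : ℝ × ℝ | q.2 ∈ S} := measurable_snd h.meas
  have j1 : IntegrableOn (fun q => P.m.jac q * {q | P.field q ≠ 0}.indicator 1 q)
      (rect P.y₀ P.y₁) :=
    Integrable.bdd_mul ((integrable_const (1 : ℝ)).indicator hmeas1)
      cj.aestronglyMeasurable hC
  have j2 : IntegrableOn (fun q : ℝ × ℝ => P.m.jac q * {q : ℝ × ℝ | q.2 ∈ S}.indicator 1 q)
      (rect P.y₀ P.y₁) :=
    Integrable.bdd_mul ((integrable_const (1 : ℝ)).indicator hmeas2)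
      cj.aestronglyMeasurable hC
  -- At radius r, the positive angles of the competitor come from parameters in S, and the motion
  -- dilates lengths by `lam`.
  have hvol : volume.real ({x | 0 < ‖P.fn x‖} ∩ disc) ≤
      ∫ r in (0 : ℝ)..1, r * P.m.lam r * μ := by
    rw [h.adm.volume_pos]
    calc ∫ q in rect P.y₀ P.y₁, P.m.jac q * {q | P.field q ≠ 0}.indicator 1 q
        ≤ ∫ q in rect P.y₀ P.y₁, P.m.jac q * {q : ℝ × ℝ | q.2 ∈ S}.indicator 1 q := by
          refine setIntegral_mono_on j1 j2 measurableSet_rect fun q hq => ?_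
          refine mul_le_mul_of_nonneg_left ?_ (h.adm.good.jac_nonneg hq)
          by_cases hqS : q.2 ∈ S
          · rw [indicator_of_mem (s := {q : ℝ × ℝ | q.2 ∈ S}) hqS]
            exact indicator_le_self' (fun _ _ => zero_le_one) q
          · have hz := h.zero q.2 hq.2 hqS
            have : q ∉ {q | P.field q ≠ 0} := by simp [field, hz]
            rw [indicator_of_notMem this]
            exact indicator_nonneg (fun _ _ => zero_le_one) q
      _ = ∫ r in (0 : ℝ)..1, r * P.m.lam r * μ := by
          rw [integral_rect j2 hy]
          refine intervalIntegral.integral_congr fun r _ => ?_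
          simp only [Motion.jac]
          rw [intervalIntegral.integral_const_mul, intervalIntegral.integral_of_le hy,
            integral_Ioc_eq_integral_Ioo]
          congr 1
          have : ∀ y, {q : ℝ × ℝ | q.2 ∈ S}.indicator (1 : ℝ × ℝ → ℝ) (r, y) =
            S.indicator (1 : ℝ → ℝ) y := fun y => by simp [indicator]
          simp only [this]
          rw [integral_indicator_one h.meas, hμ, measureReal_restrict_apply h.meas]
  set E := D + P.dirW + P.massW with hE
  set F := P.bdryEnergy S with hF
  set k := P.m.s ^ 2 * (kineticConst γ C₀ * E) with hk
  have hcont : Continuous fun r : ℝ => r * F - P.m.s * (r - r ^ 2) * (F - L + E) + r ^ 3 * k := by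
    fun_prop
  have i2 : IntervalIntegrable (fun r => r * P.m.lam r * μ) volume 0 1 :=
    (by fun_prop : Continuous fun r => r * P.m.lam r * μ).intervalIntegrable _ _
  have hmono := intervalIntegral.integral_mono_on zero_le_one (hI.add i2)
    (hcont.intervalIntegrable 0 1) fun r hr => h.density_le hr
  rw [intervalIntegral.integral_add hI i2] at hmono
  have hpoly : ∫ r in (0 : ℝ)..1, (r * F - P.m.s * (r - r ^ 2) * (F - L + E) + r ^ 3 * k) =
      F / 2 - P.m.s * (F - L + E) / 6 + k / 4 := by
    have hd : ∀ r : ℝ, HasDerivAt (fun r => r ^ 2 / 2 * F -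
        P.m.s * (r ^ 2 / 2 - r ^ 3 / 3) * (F - L + E) + r ^ 4 / 4 * k)
        (r * F - P.m.s * (r - r ^ 2) * (F - L + E) + r ^ 3 * k) r := fun r => by
      have p2 := hasDerivAt_pow 2 r
      have p3 := hasDerivAt_pow 3 r
      have p4 := hasDerivAt_pow 4 r
      refine ((((p2.div_const 2).mul_const F).sub
        ((((p2.div_const 2).sub (p3.div_const 3)).const_mul P.m.s).mul_const (F - L + E))).add
        ((p4.div_const 4).mul_const k)).congr_deriv ?_
      norm_num
    rw [intervalIntegral.integral_eq_sub_of_hasDerivAt (fun r _ => hd r)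
      (hcont.intervalIntegrable _ _)]
    norm_num
    ring
  rw [hpoly] at hmono
  have hEn : 0 ≤ E := by
    have := massW_nonneg hy
    have : 0 ≤ P.dirW := by nlinarith [h.gap, h.gap_pos]
    have := h.gain_nonneg
    positivity
  have hkk : k ≤ P.m.s * (2 / 3 * E) := by
    have h1 := h.speed_kin
    have h2 := h.speed_nonneg
    have : kineticConst γ C₀ * P.m.s * E ≤ 2 / 3 * E := by gcongr
    calc k = P.m.s * (kineticConst γ C₀ * P.m.s * E) := by rw [hk]; ring
      _ ≤ _ := by gcongr
  linarith

end Improving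

end PieceData

end Epi

end

/-! ### From the Gauss-Green formula to traces; gluing of wedges -/

noncomputable section

namespace Epi

variable {n : ℕ}

theorem isFiniteMeasure_disc : IsFiniteMeasure (volume.restrict disc) :=
  ⟨by simp [disc]⟩

theorem IsWeakGradient.weakGradient_ae_eq {u : Plane → Target n} {G : Fin 2 → Plane → Target n}
    (h : IsWeakGradient u G) (j : Fin 2) : weakGradient u j =ᵐ[volume.restrict disc] G j := by
  have he : ∃ G, IsWeakGradient u G := ⟨G, h⟩
  rw [weakGradient, dif_pos he]
  exact he.choose_spec.ae_eq h j

theorem IsTrace.trace_ae_eq {u c : Plane → Target n} (h : IsTrace u c) :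
    trace u =ᵐ[arcLength] c := by
  have he : ∃ T, IsTrace u T := ⟨c, h⟩
  rw [trace, dif_pos he]
  exact he.choose_spec.ae_eq h

theorem integral_arcLength_period {E : Type*} [NormedAddCommGroup E] [NormedSpace ℝ E]
    {f : Plane → E} (hf : AEStronglyMeasurable f arcLength) {g : ℝ → E}
    (hg : Function.Periodic g (2 * Real.pi)) (hfg : ∀ᵐ θ, f (circlePoint θ) = g θ) (b : ℝ) :
    ∫ x, f x ∂arcLength = ∫ y in b..(b + 2 * Real.pi), g y := by
  have e : Real.pi = -Real.pi + 2 * Real.pi := by ring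
  rw [integral_arcLength hf, ← hg.intervalIntegral_add_eq (-Real.pi) b, ← e]
  refine intervalIntegral.integral_congr_ae ?_
  filter_upwards [hfg] with θ hθ _
  exact hθ

/-- A Gauss-Green formula up to the boundary identifies the weak gradient, the trace and the Weiss
energy. -/
theorem weissV_of_gaussGreen {u c : Plane → Target n} {G : Fin 2 → Plane → Target n}
    {C : ℝ → Target n} {b : ℝ} (hu : MemLp u 2 (volume.restrict disc))
    (hG : ∀ j, MemLp (G j) 2 (volume.restrict disc)) (hcm : MemLp c 2 arcLength)
    (hper : Function.Periodic C (2 * Real.pi)) (hc : ∀ᵐ θ, c (circlePoint θ) = C θ)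
    (hg : ∀ (j : Fin 2) (φ : Plane → ℝ), ContDiff ℝ ∞ φ →
      ∫ x in disc, (partialDeriv j φ x • u x + φ x • G j x) =
        ∫ y in b..(b + 2 * Real.pi), (φ (circlePoint y) * circlePoint y j) • C y) :
    MemH1Disc u ∧ IsTrace u c ∧ weissV u = (∫ x in disc, ∑ j, ‖G j x‖ ^ 2) -
      (∫ y in b..(b + 2 * Real.pi), ‖C y‖ ^ 2) + volume.real ({x | 0 < ‖u x‖} ∩ disc) := by
  have hfin := isFiniteMeasure_disc
  -- Test functions supported in the open disc vanish on the circle, so the boundary term drops.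
  -- General test functions then identify the trace.
  have hw : IsWeakGradient u G := by
    refine ⟨hG, fun j φ h1 h2 h3 => ?_⟩
    have hz : ∀ y, φ (circlePoint y) = 0 := fun y => by
      refine image_eq_zero_of_notMem_tsupport fun h => ?_
      have := h3 h
      rw [disc, mem_ball_zero_iff, norm_circlePoint] at this
      exact lt_irrefl _ this
    have e := hg j φ h1
    simp only [hz, zero_mul, zero_smul, intervalIntegral.integral_zero] at e
    obtain ⟨K, hK⟩ := h1.continuous.bounded_above_of_compact_support h2
    have c2 : Continuous (partialDeriv j φ) :=
      (h1.continuous_fderiv (by simp)).clm_apply continuous_const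
    have s2 : HasCompactSupport (partialDeriv j φ) :=
      (h2.fderiv (𝕜 := ℝ)).comp_left (g := fun T : Plane →L[ℝ] ℝ => T (EuclideanSpace.single j 1))
        (by simp)
    obtain ⟨K', hK'⟩ := c2.bounded_above_of_compact_support s2
    have i1 : Integrable (fun x => partialDeriv j φ x • u x) (volume.restrict disc) :=
      (hu.integrable (by norm_num)).bdd_smul K' c2.aestronglyMeasurable
        (Filter.Eventually.of_forall hK')
    have i2 : Integrable (fun x => φ x • G j x) (volume.restrict disc) :=
      ((hG j).integrable (by norm_num)).bdd_smul K h1.continuous.aestronglyMeasurable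
        (Filter.Eventually.of_forall hK)
    rw [integral_add i1 i2] at e
    exact eq_neg_of_add_eq_zero_left e
  have ht : IsTrace u c := by
    refine ⟨hcm, fun j φ h1 => ?_⟩
    have e : ∫ x in disc, (partialDeriv j φ x • u x + φ x • weakGradient u j x) =
        ∫ x in disc, (partialDeriv j φ x • u x + φ x • G j x) := by
      refine integral_congr_ae ?_
      filter_upwards [hw.weakGradient_ae_eq j] with x hx
      rw [hx]
    have cj : Continuous fun x : Plane => x j := (EuclideanSpace.proj j : Plane →L[ℝ] ℝ).continuous
    rw [e, hg j φ h1]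
    symm
    refine integral_arcLength_period
      (f := fun x => (φ x * x j) • c x)
      (g := fun y => (φ (circlePoint y) * circlePoint y j) • C y) ?_ ?_ ?_ b
    · exact (h1.continuous.mul cj).aestronglyMeasurable.smul hcm.1
    · intro y
      simp only [circlePoint_periodic y, hper y]
    · filter_upwards [hc] with θ hθ
      rw [hθ]
  refine ⟨⟨hu, G, hw⟩, ht, ?_⟩
  rw [weissV, weissZero]
  congr 2
  · refine integral_congr_ae ?_
    filter_upwards [hw.weakGradient_ae_eq 0, hw.weakGradient_ae_eq 1] with x h0 h1
    simp only [Fin.sum_univ_two, h0, h1]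
  · rw [integral_congr_ae (g := fun x => ‖c x‖ ^ 2)
      (by filter_upwards [ht.trace_ae_eq] with x hx; rw [hx])]
    refine integral_arcLength_period (f := fun x => ‖c x‖ ^ 2) (g := fun y => ‖C y‖ ^ 2) (hcm.1.norm.pow 2) ?_ ?_ b
    · intro y
      simp only [hper y]
    · filter_upwards [hc] with θ hθ
      rw [hθ]

/-- The Weiss energy of a function on an interval of the circle. -/
def ringEnergy (C C' : ℝ → Target n) (a b : ℝ) : ℝ :=
  (∫ y in a..b, ‖C' y‖ ^ 2) - (∫ y in a..b, ‖C y‖ ^ 2) +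
    ∫ y in a..b, {t | C t ≠ 0}.indicator (1 : ℝ → ℝ) y

theorem measurableSet_ne_zero {C : ℝ → Target n} (h : Continuous C) :
    MeasurableSet {t | C t ≠ 0} :=
  (isOpen_ne_fun h continuous_const).measurableSet

theorem intervalIntegrable_indicator {C : ℝ → Target n} (h : Continuous C) (a b : ℝ) :
    IntervalIntegrable ({t | C t ≠ 0}.indicator (1 : ℝ → ℝ)) volume a b := by
  have := (measurableSet_ne_zero h)
  exact ⟨(integrable_const (1 : ℝ)).indicator this, (integrable_const (1 : ℝ)).indicator this⟩

theorem integral_indicator_eq {S : Set ℝ} (hS : MeasurableSet S) {a b : ℝ} (hab : a ≤ b) :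
    ∫ y in a..b, S.indicator (1 : ℝ → ℝ) y = volume.real (S ∩ Ioo a b) := by
  rw [intervalIntegral.integral_of_le hab, integral_Ioc_eq_integral_Ioo,
    integral_indicator_one hS, measureReal_restrict_apply hS]

theorem IsH1.ringEnergy_add {C C' : ℝ → Target n} (h : IsH1 C C') (x y z : ℝ) :
    ringEnergy C C' x y + ringEnergy C C' y z = ringEnergy C C' x z := by
  have hc : Continuous fun t => ‖C t‖ ^ 2 := h.continuous.norm.pow 2
  rw [ringEnergy, ringEnergy, ringEnergy,
    ← intervalIntegral.integral_add_adjacent_intervals (hc.intervalIntegrable x y)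
    (hc.intervalIntegrable y z),
    ← intervalIntegral.integral_add_adjacent_intervals (h.sq x y) (h.sq y z),
    ← intervalIntegral.integral_add_adjacent_intervals
      (intervalIntegrable_indicator h.continuous x y)
      (intervalIntegrable_indicator h.continuous y z)]
  ring

/-- The part of the disc between two moving rays. -/
def wedge (b₀ s a b A B : ℝ) : Set Plane :=
  {x | ∃ r ∈ Ioo (0 : ℝ) 1, ∃ θ ∈ Ioo b₀ (b₀ + 2 * Real.pi),
    θ ∈ Ioo (a + s * (1 - r) * (A - a)) (b + s * (1 - r) * (B - b)) ∧ x = r • circlePoint θ}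

/-- The two wedges lie on opposite sides of the same moving ray, and the polar angle is unique in
the common window of length 2π. -/
theorem wedge_disjoint {b₀ s a b c A B D : ℝ} {x : Plane} (h1 : x ∈ wedge b₀ s a b A B)
    (h2 : x ∈ wedge b₀ s b c B D) : False := by
  obtain ⟨r, hr, θ, hθ, hθ', hx⟩ := h1
  obtain ⟨r', hr', η, hη, hη', hx'⟩ := h2
  have e1 : r = r' := by
    have h3 : ‖x‖ = r := by rw [hx, norm_smul, norm_circlePoint, mul_one, Real.norm_of_nonneg hr.1.le]
    have h4 : ‖x‖ = r' := by
      rw [hx', norm_smul, norm_circlePoint, mul_one, Real.norm_of_nonneg hr'.1.le]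
    rw [← h3, h4]
  subst e1
  have e2 : θ = η := by
    refine circlePoint_inj ?_ ?_
    · rw [hx] at hx'
      exact smul_right_injective _ hr.1.ne' hx'
    · rw [abs_lt]
      constructor <;> linarith [hθ.1, hθ.2, hη.1, hη.2]
  subst e2
  linarith [hθ'.2, hη'.1]

/-- The wedge between the moving rays from `a` to `A` and from `b` to `B` carries a competitor for
the datum `C` on `[a, b]` that gains energy relative to the limit energy `L / 2`. -/
structure IsFilling (C C' : ℝ → Target n) (b₀ s a b A B L : ℝ) (u : Plane → Target n)
    (G : Fin 2 → Plane → Target n) : Prop where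
  memLp : MemLp u 2 (volume.restrict disc)
  memLp_grad : ∀ j, MemLp (G j) 2 (volume.restrict disc)
  gaussGreen : ∀ (j : Fin 2) (φ : Plane → ℝ), ContDiff ℝ ∞ φ →
    ∫ x in disc, (partialDeriv j φ x • u x + φ x • G j x) =
      ∫ y in a..b, (φ (circlePoint y) * circlePoint y j) • C y
  zero : ∀ x ∉ wedge b₀ s a b A B, u x = 0 ∧ ∀ j, G j x = 0
  energy : (∫ x in disc, ∑ j, ‖G j x‖ ^ 2) - (∫ y in a..b, ‖C y‖ ^ 2) +
    volume.real ({x | 0 < ‖u x‖} ∩ disc) ≤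
      (1 - s / 3) * ((ringEnergy C C' a b - L) / 2) + L / 2

/-- There is a filling of the wedge. -/
def Fills (C C' : ℝ → Target n) (b₀ s a b A B L : ℝ) : Prop :=
  ∃ u G, IsFilling C C' b₀ s a b A B L u G

theorem exists_bound_disc {f : Plane → ℝ} (hf : Continuous f) :
    ∃ K, ∀ᵐ x ∂volume.restrict disc, ‖f x‖ ≤ K := by
  obtain ⟨K, hK⟩ := (isCompact_closedBall (0 : Plane) 1).exists_bound_of_continuousOn
    hf.continuousOn
  exact ⟨K, (ae_restrict_mem Metric.isOpen_ball.measurableSet).mono fun x hx =>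
    hK x (Metric.ball_subset_closedBall hx)⟩

theorem integrable_smul_disc {f : Plane → ℝ} (hf : Continuous f) {u : Plane → Target n}
    (hu : MemLp u 2 (volume.restrict disc)) :
    Integrable (fun x => f x • u x) (volume.restrict disc) := by
  have := isFiniteMeasure_disc
  obtain ⟨K, hK⟩ := exists_bound_disc hf
  exact (hu.integrable (by norm_num)).bdd_smul K hf.aestronglyMeasurable hK

theorem Fills.refl (C C' : ℝ → Target n) (b₀ s a A B : ℝ) : Fills C C' b₀ s a a A B 0 :=
  ⟨0, 0, by simp, fun j => by simp, fun j φ _ => by simp, fun _ _ => by simp,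
    by simp [ringEnergy]⟩

/-- The two competitors and their gradients live in disjoint wedges, so Dirichlet energies add and
areas are subadditive. The energy bounds add as well, because both pieces use the same s and the
bound is linear in the ring energy and the limit length. -/
theorem Fills.append {C C' : ℝ → Target n} (hC : IsH1 C C') {b₀ s a b c A B D L M : ℝ}
    (h : Fills C C' b₀ s a b A B L) (k : Fills C C' b₀ s b c B D M)
    (hs0 : 0 ≤ s) (hs1 : s ≤ 1) (hab : a ≤ b) (hbc : b ≤ c) (hAB : A ≤ B) (hBD : B ≤ D) :
    Fills C C' b₀ s a c A D (L + M) := by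
  obtain ⟨u, G, h⟩ := h
  obtain ⟨v, H, k⟩ := k
  have hfin := isFiniteMeasure_disc
  -- A moving ray is a convex combination of its start and its target, with weight s(1 - r) ≤ 1, so
  -- the order of rays is preserved.
  have hray : ∀ {p q P Q : ℝ}, p ≤ q → P ≤ Q → ∀ r ∈ Ioo (0 : ℝ) 1,
      p + s * (1 - r) * (P - p) ≤ q + s * (1 - r) * (Q - q) := fun {p q P Q} h1 h2 r hr => by
    have t0 : 0 ≤ s * (1 - r) := mul_nonneg hs0 (sub_nonneg.2 hr.2.le)
    have t1 : s * (1 - r) ≤ 1 := mul_le_one₀ hs1 (sub_nonneg.2 hr.2.le) (by linarith [hr.1])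
    nlinarith
  have hw1 : wedge b₀ s a b A B ⊆ wedge b₀ s a c A D := by
    rintro x ⟨r, hr, θ, hθ, hθ', hx⟩
    exact ⟨r, hr, θ, hθ, ⟨hθ'.1, hθ'.2.trans_le (hray hbc hBD r hr)⟩, hx⟩
  have hw2 : wedge b₀ s b c B D ⊆ wedge b₀ s a c A D := by
    rintro x ⟨r, hr, θ, hθ, hθ', hx⟩
    exact ⟨r, hr, θ, hθ, ⟨(hray hab hAB r hr).trans_lt hθ'.1, hθ'.2⟩, hx⟩
  have hsep : ∀ x, (u x = 0 ∧ ∀ j, G j x = 0) ∨ (v x = 0 ∧ ∀ j, H j x = 0) := fun x => by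
    by_cases hx : x ∈ wedge b₀ s a b A B
    · exact Or.inr (k.zero x fun hx' => wedge_disjoint hx hx')
    · exact Or.inl (h.zero x hx)
  refine ⟨fun x => u x + v x, fun j x => G j x + H j x, h.memLp.add k.memLp,
    fun j => (h.memLp_grad j).add (k.memLp_grad j), fun j φ hφ => ?_, fun x hx => ?_, ?_⟩
  · have c2 : Continuous (partialDeriv j φ) :=
      (hφ.continuous_fderiv (by simp)).clm_apply continuous_const
    have i1 : Integrable (fun x => partialDeriv j φ x • u x + φ x • G j x)
        (volume.restrict disc) := (integrable_smul_disc c2 h.memLp).add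
      (integrable_smul_disc hφ.continuous (h.memLp_grad j))
    have i2 : Integrable (fun x => partialDeriv j φ x • v x + φ x • H j x)
        (volume.restrict disc) := (integrable_smul_disc c2 k.memLp).add
      (integrable_smul_disc hφ.continuous (k.memLp_grad j))
    have cc : Continuous fun y => (φ (circlePoint y) * circlePoint y j) • C y :=
      ((hφ.continuous.comp continuous_circlePoint).mul
        ((EuclideanSpace.proj j : Plane →L[ℝ] ℝ).continuous.comp continuous_circlePoint)).smul
        hC.continuous
    rw [← intervalIntegral.integral_add_adjacent_intervals (cc.intervalIntegrable a b)
      (cc.intervalIntegrable b c), ← h.gaussGreen j φ hφ, ← k.gaussGreen j φ hφ,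
      ← integral_add i1 i2]
    refine integral_congr_ae (Filter.Eventually.of_forall fun x => ?_)
    dsimp only
    module
  · obtain ⟨h1, h2⟩ := h.zero x fun hx' => hx (hw1 hx')
    obtain ⟨k1, k2⟩ := k.zero x fun hx' => hx (hw2 hx')
    exact ⟨by simp [h1, k1], fun j => by simp [h2, k2]⟩
  · have i1 : Integrable (fun x => ∑ j, ‖G j x‖ ^ 2) (volume.restrict disc) :=
      integrable_finsetSum _ fun j _ =>
        (memLp_two_iff_integrable_sq_norm (h.memLp_grad j).1).1 (h.memLp_grad j)
    have i2 : Integrable (fun x => ∑ j, ‖H j x‖ ^ 2) (volume.restrict disc) :=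
      integrable_finsetSum _ fun j _ =>
        (memLp_two_iff_integrable_sq_norm (k.memLp_grad j).1).1 (k.memLp_grad j)
    have e1 : ∫ x in disc, ∑ j, ‖G j x + H j x‖ ^ 2 =
        (∫ x in disc, ∑ j, ‖G j x‖ ^ 2) + ∫ x in disc, ∑ j, ‖H j x‖ ^ 2 := by
      rw [← integral_add i1 i2]
      refine integral_congr_ae (Filter.Eventually.of_forall fun x => ?_)
      rcases hsep x with ⟨-, hx⟩ | ⟨-, hx⟩ <;> simp [hx]
    have e2 : volume.real ({x | 0 < ‖u x + v x‖} ∩ disc) ≤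
        volume.real ({x | 0 < ‖u x‖} ∩ disc) + volume.real ({x | 0 < ‖v x‖} ∩ disc) := by
      refine (measureReal_mono ?_ ?_).trans (measureReal_union_le _ _)
      · rintro x ⟨hx, hxd⟩
        rcases hsep x with ⟨h0, -⟩ | ⟨h0, -⟩
        · exact Or.inr ⟨by simpa [h0] using hx, hxd⟩
        · exact Or.inl ⟨by simpa [h0] using hx, hxd⟩
      · refine ((measure_mono (union_subset inter_subset_right inter_subset_right)).trans_lt
          ?_).ne
        exact measure_ball_lt_top
    have e3 := hC.ringEnergy_add a b c
    have hc : Continuous fun t => ‖C t‖ ^ 2 := hC.continuous.norm.pow 2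
    rw [e1, ← e3, ← intervalIntegral.integral_add_adjacent_intervals (hc.intervalIntegrable a b)
      (hc.intervalIntegrable b c)]
    have := h.energy
    have := k.energy
    linarith

theorem Fills.exists_competitor {C C' : ℝ → Target n} {b₀ s A B L : ℝ} {c : Plane → Target n}
    (h : Fills C C' b₀ s b₀ (b₀ + 2 * Real.pi) A B L) (hcm : MemLp c 2 arcLength)
    (hper : Function.Periodic C (2 * Real.pi)) (hc : ∀ᵐ θ, c (circlePoint θ) = C θ) :
    ∃ u, MemH1Disc u ∧ IsTrace u c ∧ weissV u ≤
      (1 - s / 3) * ((ringEnergy C C' b₀ (b₀ + 2 * Real.pi) - L) / 2) + L / 2 := by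
  obtain ⟨u, G, h⟩ := h
  obtain ⟨h1, h2, h3⟩ := weissV_of_gaussGreen h.memLp h.memLp_grad hcm hper hc h.gaussGreen
  exact ⟨u, h1, h2, h3.trans_le h.energy⟩

theorem PieceData.Improving.fills {P : PieceData n} {C C' : ℝ → Target n}
    {b₀ γ C₀ L D : ℝ} (h : P.Improving b₀ γ C₀ L D {t | C t ≠ 0})
    (hd : ∀ t, P.v t + P.w t = C t) (hd' : ∀ t, P.v' t + P.w' t = C' t) :
    Fills C C' b₀ P.m.s P.y₀ P.y₁ (P.y₀ + P.m.disp P.y₀) (P.y₁ + P.m.disp P.y₁) L := by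
  have hy := h.adm.good.lt.le
  have o1 : ∫ y in P.y₀..P.y₁, ‖C y‖ ^ 2 = P.massV + P.massW := by
    have := integral_norm_add_smul_sq (a := 1)
      ((h.adm.hv.continuous.norm.pow 2).intervalIntegrable P.y₀ P.y₁ (μ := volume))
      ((h.adm.hw.continuous.norm.pow 2).intervalIntegrable _ _)
      ((h.adm.hv.continuous.inner h.adm.hw.continuous).intervalIntegrable _ _) h.orth.inner_eq
    simpa [hd, massV, massW] using this
  have o2 : ∫ y in P.y₀..P.y₁, ‖C' y‖ ^ 2 = P.dirV + P.dirW := by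
    have := integral_norm_add_smul_sq (a := 1) (h.adm.hv.sq P.y₀ P.y₁) (h.adm.hw.sq _ _)
      (h.adm.hv.inner_int h.adm.hw _ _) h.orth.inner_deriv_eq
    simpa [hd', dirV, dirW] using this
  have hF : ringEnergy C C' P.y₀ P.y₁ = P.bdryEnergy {t | C t ≠ 0} := by
    rw [ringEnergy, bdryEnergy, o1, o2, integral_indicator_eq h.meas hy]
  refine ⟨P.fn, P.gradFn, h.adm.memLp_fn, h.adm.memLp_gradFn, fun j φ hφ => ?_, fun x hx => ?_,
    ?_⟩
  · rw [h.adm.gaussGreen hφ j]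
    simp only [datum, hd]
  · have : x ∉ P.m.sector P.y₀ P.y₁ := by
      rintro ⟨q, hq, rfl⟩
      refine hx ⟨q.1, hq.1, P.m.ang q, h.adm.good.ang_mem hq, ?_, rfl⟩
      have hl := h.adm.good.lam_pos _ (Ioo_subset_Icc_self hq.1)
      have e1 := P.m.ang_eq q.1 q.2 P.y₀
      have e2 := P.m.ang_eq q.1 P.y₁ q.2
      have m1 := mul_pos hl (sub_pos.2 hq.2.1)
      have m2 := mul_pos hl (sub_pos.2 hq.2.2)
      have e3 : ∀ y, P.m.ang (q.1, y) = y + P.m.s * (1 - q.1) * (y + P.m.disp y - y) :=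
        fun y => by rw [Motion.ang]; ring
      rw [← e3, ← e3]
      constructor <;> [skip; skip] <;> simp only [Prod.mk.eta] at e1 e2 <;> linarith
    exact ⟨Motion.lift_of_notMem _ this, fun j => Motion.lift_of_notMem _ this⟩
  · rw [o1, hF]
    exact h.integral_density_le

end Epi

end

/-! ### Filling wedges by stretching low modes -/

noncomputable section

namespace Epi

variable {n : ℕ}

/-- The constraints on the speed `s` for a spectral gap `γ` and a displacement constant `C₀`. -/
structure IsSpeed (γ C₀ s : ℝ) : Prop where
  gap_pos : 0 < γ
  const_nonneg : 0 ≤ C₀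
  pos : 0 < s
  le_half : s ≤ 1 / 2
  rate : dampRate γ * s ≤ 1
  kin : kineticConst γ C₀ * s ≤ 2 / 3

theorem exists_isSpeed {γ C₀ : ℝ} (hγ : 0 < γ) (hC : 0 ≤ C₀) : ∃ s, IsSpeed γ C₀ s := by
  have h1 : 0 < dampRate γ := by unfold dampRate; positivity
  have h2 : 0 < kineticConst γ C₀ := by unfold kineticConst; positivity
  refine ⟨min (1 / 2) (min (1 / dampRate γ) (2 / 3 / kineticConst γ C₀)), hγ, hC, by positivity,
    min_le_left _ _, ?_, ?_⟩
  · calc _ ≤ dampRate γ * (1 / dampRate γ) := by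
          gcongr; exact (min_le_right _ _).trans (min_le_left _ _)
      _ = 1 := by field_simp
  · calc _ ≤ kineticConst γ C₀ * (2 / 3 / kineticConst γ C₀) := by
          gcongr; exact (min_le_right _ _).trans (min_le_right _ _)
      _ = 2 / 3 := by field_simp

/-- Energy gain of a mode that is stretched to the unit frequency. -/
theorem mode_gain {l t : ℝ} (h1 : 1 / 2 ≤ l) (h2 : l ≤ 2) (ht : t ∈ Icc (0 : ℝ) (1 / 2)) :
    l ^ 2 / (1 + t * (l - 1)) - (1 + t * (l - 1)) ≤
      (1 - t) * (l ^ 2 - 1) - t * ((l - 1) ^ 2 / 8) := by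
  obtain ⟨h0, h3⟩ := ht
  have hl : 0 < 1 + t * (l - 1) := by nlinarith
  have hl' : 1 + t * (l - 1) ≤ 3 / 2 := by nlinarith
  -- Linear interpolation between l² - 1 at t = 0 and 0 at t = 1, minus an exact convexity defect
  -- that is quadratic in l - 1.
  have e : l ^ 2 / (1 + t * (l - 1)) - (1 + t * (l - 1)) =
      (1 - t) * (l ^ 2 - 1) - l * (1 - t) / (1 + t * (l - 1)) * (t * (l - 1) ^ 2) := by
    field_simp
    ring
  have : 1 / 8 ≤ l * (1 - t) / (1 + t * (l - 1)) := by
    rw [le_div_iff₀ hl]; nlinarith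
  rw [e]
  nlinarith [mul_nonneg h0 (sq_nonneg (l - 1))]

/-- Energy gain of a mode that is stretched to half the unit frequency. -/
theorem half_mode_gain {l t : ℝ} (h1 : 1 ≤ l) (h2 : l ≤ 2) (ht : t ∈ Icc (0 : ℝ) (1 / 2)) :
    (l / 2) ^ 2 / (1 + t * (l - 1)) - (1 + t * (l - 1)) ≤
      (1 - t) * ((l / 2) ^ 2 - 1) - t * (1 / 2) := by
  obtain ⟨h0, h3⟩ := ht
  have hl : 1 ≤ 1 + t * (l - 1) := by nlinarith
  have : (l / 2) ^ 2 / (1 + t * (l - 1)) ≤ (l / 2) ^ 2 := div_le_self (sq_nonneg _) hl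
  -- l²/4 - l + 1/2 ≤ 0 on [1, 2]. The gain does not degenerate at l = 1, since frequency 1/2 has
  -- strictly negative energy.
  have : t * ((l / 2) ^ 2) ≤ t * (l - 1 / 2) := by
    gcongr; nlinarith
  nlinarith

section Fill

variable {C C' : ℝ → Target n} {b₀ γ C₀ s : ℝ}

/-- A wedge can be filled if the low modes gain energy and the high modes have a spectral gap. -/
theorem fills_of_modes (hC : IsH1 C C') (hs : IsSpeed γ C₀ s) {m : ℕ} {a b A B E : ℝ}
    (hab : a < b) (ha : C a = 0) (hb : C b = 0)
    (ha₀ : b₀ ≤ a) (hb₀ : b ≤ b₀ + 2 * Real.pi) (hA₀ : b₀ ≤ A) (hB₀ : B ≤ b₀ + 2 * Real.pi)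
    (hAB : A ≤ B) (hΛ : (B - A) / (b - a) ≤ 2) (hE : E ≤ 4 * Real.pi)
    (hAE : |A - a| ≤ E) (hBE : |B - b| ≤ E)
    (hgap : ∀ B, (∀ i : Fin m, ∫ t in a..b, sine a b i t •
        (C t - combo (fun k : Fin m => sine a b k) B t) = 0) →
      (1 + γ) * ∫ t in a..b, ‖C t - combo (fun k : Fin m => sine a b k) B t‖ ^ 2 ≤
      ∫ t in a..b, ‖C' t - combo (fun k : Fin m => sineDeriv a b k) B t‖ ^ 2)
    (hz : ∀ t ∈ Ioo a b, C t = 0 → m = 0)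
    {d : Fin m → ℝ} (hd : ∀ k, 0 ≤ d k)
    (hgain : ∀ k : Fin m, ∀ t ∈ Icc (0 : ℝ) (1 / 2),
      freq a b k ^ 2 / (1 + t * ((B - A) / (b - a) - 1)) - (1 + t * ((B - A) / (b - a) - 1)) ≤
        (1 - t) * (freq a b k ^ 2 - 1) - t * d k)
    (hdisp : ∀ k : Fin m, E ^ 2 * freq a b k ^ 2 ≤ C₀ * d k) :
    Fills C C' b₀ s a b A B (B - A) := by
  have hba := sub_pos.2 hab
  have fam := eigenFamily_sine hab m
  set Λ := (B - A) / (b - a) with hΛdef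
  have hΛ0 : 0 ≤ Λ := div_nonneg (sub_nonneg.2 hAB) hba.le
  set β := projCoeff (fun k : Fin m => sine a b k) (fun _ => (b - a) / 2) a b C with hβ
  have hort := fun i => fam.integral_smul_sub_proj hC.continuous i
  -- The displacement is affine with value A - a at a and slope Λ - 1, hence equals B - b at b.
  set P : PieceData n :=
    { m := ⟨s, A - a - (Λ - 1) * a, Λ - 1⟩, K := dampRate γ, y₀ := a, y₁ := b
      v := combo (fun k : Fin m => sine a b k) β
      v' := combo (fun k : Fin m => sineDeriv a b k) β
      w := fun t => C t - combo (fun k : Fin m => sine a b k) β t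
      w' := fun t => C' t - combo (fun k : Fin m => sineDeriv a b k) β t } with hP
  have hv := fam.isH1_combo β
  have hw := hC.sub hv
  have hva : combo (fun k : Fin m => sine a b k) β a = 0 := by simp [combo, sine_left]
  have hvb : combo (fun k : Fin m => sine a b k) β b = 0 := by simp [combo, sine_right hab]
  have dA : P.m.disp a = A - a := by simp [hP, Motion.disp]
  have dB : P.m.disp b = B - b := by
    have : Λ * (b - a) = B - A := by rw [hΛdef]; field_simp
    simp only [hP, Motion.disp]; linarith
  have dE : ∀ y ∈ Icc a b, |P.m.disp y| ≤ E := fun y hy => by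
    have hdy : P.m.disp y = P.m.disp a + (Λ - 1) * (y - a) := by
      simp only [hP, Motion.disp]; ring
    have hdy' : P.m.disp y = P.m.disp b - (Λ - 1) * (b - y) := by
      simp only [hP, Motion.disp]; ring
    rw [← dA] at hAE
    rw [← dB] at hBE
    obtain ⟨x1, x2⟩ := abs_le.1 hAE
    obtain ⟨x3, x4⟩ := abs_le.1 hBE
    rw [abs_le]
    rcases le_total 0 (Λ - 1) with h | h
    · have := mul_nonneg h (sub_nonneg.2 hy.1)
      have := mul_nonneg h (sub_nonneg.2 hy.2)
      constructor <;> linarith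
    · have := mul_nonneg (neg_nonneg.2 h) (sub_nonneg.2 hy.1)
      have := mul_nonneg (neg_nonneg.2 h) (sub_nonneg.2 hy.2)
      constructor <;> linarith
  have htr : ∀ r ∈ Icc (0 : ℝ) 1, s * (1 - r) ∈ Icc (0 : ℝ) (1 / 2) := fun r hr => by
    have := hs.pos
    have := hs.le_half
    constructor <;> nlinarith [hr.1, hr.2]
  have good : P.m.Good b₀ a b := by
    refine ⟨fun r hr => ?_, fun r hr => ?_, fun r hr => ?_, hab⟩
    · have := htr r hr
      simp only [hP, Motion.lam]
      nlinarith [this.1, this.2]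
    · have := htr r hr
      rw [Motion.ang, dA]
      simp only [hP]
      nlinarith [this.1, this.2]
    · have := htr r hr
      rw [Motion.ang, dB]
      simp only [hP]
      nlinarith [this.1, this.2]
  set M : Fin m → ℝ := fun k => (b - a) / 2 * ‖β k‖ ^ 2 with hM
  have hM0 : ∀ k, 0 ≤ M k := fun k => by positivity
  have mV : P.massV = ∑ k, M k := fam.integral_norm_combo β
  have dV : P.dirV = ∑ k : Fin m, freq a b k ^ 2 * M k := fam.integral_norm_combo_deriv β
  have him : P.Improving b₀ γ C₀ (B - A) (∑ k, d k * M k) {t | C t ≠ 0} := by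
    refine
    { adm := ⟨good, hv, hw, Or.inl ⟨hva, hvb, by simp [hP, hva, ha], by simp [hP, hvb, hb]⟩⟩
      orth := ⟨fam.integral_inner_eq_zero hw.toIsPrimitive hort β,
        fam.integral_inner_deriv_eq_zero hw.toIsPrimitive hort
          (by simp [hva, hvb, ha, hb]) β⟩
      gap_pos := hs.gap_pos
      gap := hgap β hort
      rate := rfl
      speed_nonneg := hs.pos.le
      speed_le := hs.le_half
      speed_rate := hs.rate
      speed_kin := hs.kin
      const_nonneg := hs.const_nonneg
      p₁_le := abs_le.2 ⟨by simp only [hP]; linarith, by simp only [hP]; linarith⟩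
      gain_nonneg := Finset.sum_nonneg fun k _ => mul_nonneg (hd k) (hM0 k)
      gain := fun t ht => ?_
      disp_sq := ?_
      disp_le := fun y hy => (dE y hy).trans hE
      meas := measurableSet_ne_zero hC.continuous
      zero := fun y hyI hy => ?_
      target := ?_ }
    · rw [mV, dV, Finset.sum_div, Finset.mul_sum, ← Finset.sum_sub_distrib,
        ← Finset.sum_sub_distrib, Finset.mul_sum, Finset.mul_sum, ← Finset.sum_sub_distrib]
      refine Finset.sum_le_sum fun k _ => ?_
      have := mul_le_mul_of_nonneg_right (hgain k t ht) (hM0 k)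
      simp only [hP]
      calc _ = (freq a b k ^ 2 / (1 + t * (Λ - 1)) - (1 + t * (Λ - 1))) * M k := by ring
        _ ≤ _ := this
        _ = _ := by ring
    · calc ∫ y in a..b, P.m.disp y ^ 2 * ‖P.v' y‖ ^ 2 ≤ ∫ y in a..b, E ^ 2 * ‖P.v' y‖ ^ 2 := by
            refine intervalIntegral.integral_mono_on hab.le
              ((hv.sq a b).continuousOn_mul ((PieceData.continuous_disp (P := P)).pow 2).continuousOn)
              ((hv.sq a b).const_mul _) fun y hy => ?_
            have := dE y hy
            rw [← sq_abs (P.m.disp y)]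
            gcongr
        _ = E ^ 2 * P.dirV := by rw [intervalIntegral.integral_const_mul]; rfl
        _ ≤ _ := by
            rw [dV, Finset.mul_sum, Finset.mul_sum]
            refine Finset.sum_le_sum fun k _ => ?_
            have := mul_le_mul_of_nonneg_right (hdisp k) (hM0 k)
            linarith
    -- Interior zeros are allowed only when no mode is kept: then v = 0 and w = C. A kept mode could
    -- be nonzero at a zero of C and enlarge the positivity set.
    · have hCy : C y = 0 := not_not.1 hy
      have : IsEmpty (Fin m) := by rw [hz y hyI hCy]; infer_instance
      have hv0 : combo (fun k : Fin m => sine a b k) β y = 0 := by simp [combo]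
      exact ⟨hv0, by simp only [hP, hv0, hCy, sub_zero]⟩
    · have h1 : volume.real ({t | C t ≠ 0} ∩ Ioo a b) ≤ b - a := by
        refine (measureReal_mono inter_subset_right measure_Ioo_lt_top.ne).trans (le_of_eq ?_)
        rw [Real.volume_real_Ioo_of_le hab.le]
      have h2 : Λ * volume.real ({t | C t ≠ 0} ∩ Ioo a b) ≤ B - A := by
        calc _ ≤ Λ * (b - a) := by gcongr
          _ = B - A := by rw [hΛdef]; field_simp
      simp only [hP]
      linarith
  have := him.fills (C := C) (C' := C') (fun t => by simp [hP]) (fun t => by simp [hP])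
  rwa [show P.y₀ + P.m.disp P.y₀ = A by rw [dA]; simp [hP],
    show P.y₁ + P.m.disp P.y₁ = B by rw [dB]; simp [hP]] at this

/-- The constant controlling the displacements of the moving wedges. -/
def dispConst : ℝ := 512 * Real.pi ^ 2

/-- The spectral gap of a datum that vanishes on a set of length `δ`. -/
def gapOf (δ : ℝ) : ℝ := (2 * Real.pi / (2 * Real.pi - δ)) ^ 2 - 1

theorem gapOf_pos {δ : ℝ} (h0 : 0 < δ) (h1 : δ ≤ 2 * Real.pi / 3) : 0 < gapOf δ := by
  have hpi := Real.pi_pos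
  have h2 : 0 < 2 * Real.pi - δ := by linarith
  have : 1 < 2 * Real.pi / (2 * Real.pi - δ) := by rw [one_lt_div h2]; linarith
  unfold gapOf
  nlinarith

/-- 9/4 is the constant of `trig_gap`, and also a lower bound for the third Dirichlet eigenvalue of
an interval of length at most 2π. The cap on δ keeps one common gap below both. -/
theorem gapOf_le {δ : ℝ} (h0 : 0 < δ) (h1 : δ ≤ 2 * Real.pi / 3) : 1 + gapOf δ ≤ 9 / 4 := by
  have hpi := Real.pi_pos
  have h2 : 0 < 2 * Real.pi - δ := by linarith
  have h3 : 2 * Real.pi / (2 * Real.pi - δ) ≤ 3 / 2 := by rw [div_le_iff₀ h2]; linarith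
  have h4 : 0 ≤ 2 * Real.pi / (2 * Real.pi - δ) := by positivity
  unfold gapOf
  nlinarith

/-- Every zero-free interval between two zeros in `[x, y]` has length at most `L`. -/
def ShortGaps (C : ℝ → Target n) (L x y : ℝ) : Prop :=
  ∀ p q, x ≤ p → p < q → q ≤ y → C p = 0 → C q = 0 → (∀ t ∈ Ioo p q, C t ≠ 0) → q - p ≤ L

variable {δ : ℝ}

/-- No mode is kept. All zero-free arcs have length at most π - δ/2, so the Poincaré constant is
(π/(π - δ/2))² = 1 + `gapOf δ`. The whole datum is damped while its interval contracts towards the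
single angle A. -/
theorem fills_point (hC : IsH1 C C') (hs : IsSpeed (gapOf δ) dispConst s) (hδ0 : 0 < δ)
    (hδ : δ ≤ 2 * Real.pi / 3) {a b A : ℝ}
    (hab : a ≤ b) (ha : C a = 0) (hb : C b = 0)
    (ha₀ : b₀ ≤ a) (hb₀ : b ≤ b₀ + 2 * Real.pi) (hA₀ : b₀ ≤ A) (hB₀ : A ≤ b₀ + 2 * Real.pi)
    (hsh : ShortGaps C (Real.pi - δ / 2) a b) : Fills C C' b₀ s a b A A 0 := by
  have hpi := Real.pi_pos
  rcases hab.eq_or_lt with rfl | hab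
  · exact Fills.refl _ _ _ _ _ _ _
  have := fills_of_modes (m := 0) (E := 2 * Real.pi) (B := A) (d := fun _ => 0) hC hs hab ha hb
    ha₀ hb₀ hA₀ hB₀ le_rfl (by simp) (by linarith) (abs_le.2 ⟨by linarith, by linarith⟩)
    (abs_le.2 ⟨by linarith, by linarith⟩) (fun B _ => ?_) (fun _ _ _ => rfl) (fun k => k.elim0)
    (fun k => k.elim0) (fun k => k.elim0)
  · rwa [sub_self] at this
  · have h := hC.poincare_of_gaps hab.le (by linarith : 0 < Real.pi - δ / 2) ha hb hsh
    have e : 1 + gapOf δ = (Real.pi / (Real.pi - δ / 2)) ^ 2 := by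
      have : 2 * Real.pi - δ = 2 * (Real.pi - δ / 2) := by ring
      rw [gapOf, this, mul_div_mul_left _ _ two_ne_zero]; ring
    simpa [combo, e] using h

/-- The first Dirichlet mode is kept; on the target length π it has frequency 1 and zero energy. The
second eigenvalue provides the gap because b - a ≤ 2π - δ. The end points may move only by a
multiple of |π - (b - a)|, since the gain of the mode is quadratic in Λ - 1. -/
theorem fills_one (hC : IsH1 C C') (hs : IsSpeed (gapOf δ) dispConst s) (hδ0 : 0 < δ)
    (hδ : δ ≤ 2 * Real.pi / 3) {a b A : ℝ}
    (ha : C a = 0) (hb : C b = 0)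
    (ha₀ : b₀ ≤ a) (hb₀ : b ≤ b₀ + 2 * Real.pi) (hA₀ : b₀ ≤ A) (hB₀ : A ≤ b₀ + Real.pi)
    (h1 : Real.pi / 2 ≤ b - a) (h2 : b - a ≤ 2 * Real.pi - δ)
    (hAa : |A - a| ≤ 2 * |Real.pi - (b - a)|) (hBb : |A + Real.pi - b| ≤ 2 * |Real.pi - (b - a)|)
    (hz : ∀ t ∈ Ioo a b, C t ≠ 0) : Fills C C' b₀ s a b A (A + Real.pi) Real.pi := by
  have hpi := Real.pi_pos
  have hab : a < b := by linarith
  have hba := sub_pos.2 hab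
  set Λ := Real.pi / (b - a) with hΛ
  have hΛ' : (A + Real.pi - A) / (b - a) = Λ := by rw [add_sub_cancel_left]
  have hΛ2 : Λ ≤ 2 := by rw [hΛ, div_le_iff₀ hba]; linarith
  have hΛ1 : 1 / 2 ≤ Λ := by rw [hΛ, le_div_iff₀ hba]; linarith
  have hf : freq a b 0 = Λ := by simp [freq, hΛ]
  have hk : Real.pi - (b - a) = (Λ - 1) * (b - a) := by rw [hΛ]; field_simp
  have hEpi : 2 * |Real.pi - (b - a)| ≤ 4 * Real.pi := by
    have : |Real.pi - (b - a)| ≤ 2 * Real.pi := abs_le.2 ⟨by linarith, by linarith⟩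
    linarith
  have := fills_of_modes (m := 1) (B := A + Real.pi) (d := fun _ => (Λ - 1) ^ 2 / 8) hC hs hab ha hb
    ha₀ hb₀ hA₀ (by linarith) (by linarith) (by rw [hΛ']; exact hΛ2) hEpi hAa hBb
    (fun B ho => ?_) (fun t ht h0 => absurd h0 (hz t ht)) (fun k => by positivity)
    (fun k t ht => ?_) (fun k => ?_)
  · rwa [add_sub_cancel_left] at this
  · have fam := eigenFamily_sine hab 1
    have hw := hC.sub (fam.isH1_combo B)
    have h := sine_gap_one hab hw (by simp [ha, combo, sine_left])
      (by simp [hb, combo, sine_right hab]) ho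
    refine le_trans ?_ h
    have h0 : 0 ≤ ∫ t in a..b, ‖C t - combo (fun k : Fin 1 => sine a b k) B t‖ ^ 2 :=
      intervalIntegral.integral_nonneg hab.le fun _ _ => sq_nonneg _
    have : 1 + gapOf δ ≤ (2 * Real.pi / (b - a)) ^ 2 := by
      have : 0 < 2 * Real.pi - δ := by linarith
      rw [gapOf, add_sub_cancel]
      gcongr
    gcongr
  · rw [hΛ']
    fin_cases k
    simp only [hf]
    exact mode_gain hΛ1 hΛ2 ht
  · fin_cases k
    simp only [hf]
    rw [mul_pow, sq_abs, hk, dispConst]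
    have h3 : (b - a) ^ 2 ≤ 4 * Real.pi ^ 2 := by nlinarith
    have h4 : Λ ^ 2 ≤ 4 := by nlinarith
    -- Source of `dispConst`: (b - a)² ≤ 4π² and Λ² ≤ 4 give 64π²(Λ - 1)², which is 512π² times the
    -- gain (Λ - 1)²/8.
    calc 2 ^ 2 * ((Λ - 1) * (b - a)) ^ 2 * Λ ^ 2
        = 4 * (Λ - 1) ^ 2 * ((b - a) ^ 2 * Λ ^ 2) := by ring
      _ ≤ 4 * (Λ - 1) ^ 2 * (4 * Real.pi ^ 2 * 4) := by gcongr
      _ = 512 * Real.pi ^ 2 * ((Λ - 1) ^ 2 / 8) := by ring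

/-- Two modes are kept, of frequencies Λ/2 and Λ, which tend to 1/2 and 1 on the full length 2π. The
third eigenvalue is at least 9/4 and provides the gap even when b - b₀ is close to 2π. -/
theorem fills_two (hC : IsH1 C C') (hs : IsSpeed (gapOf δ) dispConst s) (hδ0 : 0 < δ)
    (hδ : δ ≤ 2 * Real.pi / 3) {b : ℝ}
    (ha : C b₀ = 0) (hb : C b = 0) (hb₀ : b ≤ b₀ + 2 * Real.pi)
    (h1 : Real.pi ≤ b - b₀) (hz : ∀ t ∈ Ioo b₀ b, C t ≠ 0) :
    Fills C C' b₀ s b₀ b b₀ (b₀ + 2 * Real.pi) (2 * Real.pi) := by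
  have hpi := Real.pi_pos
  have hab : b₀ < b := by linarith
  have hba := sub_pos.2 hab
  set Λ := 2 * Real.pi / (b - b₀) with hΛ
  have hΛ' : (b₀ + 2 * Real.pi - b₀) / (b - b₀) = Λ := by rw [add_sub_cancel_left]
  have hΛ2 : Λ ≤ 2 := by rw [hΛ, div_le_iff₀ hba]; linarith
  have hΛ1 : 1 ≤ Λ := by rw [hΛ, le_div_iff₀ hba]; linarith
  have hf0 : freq b₀ b 0 = Λ / 2 := by simp [freq, hΛ]; field_simp
  have hf1 : freq b₀ b 1 = Λ := by simp [freq, hΛ]; norm_num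
  have hk : 2 * Real.pi - (b - b₀) = (Λ - 1) * (b - b₀) := by rw [hΛ]; field_simp
  have hE0 : 0 ≤ 2 * Real.pi - (b - b₀) := by linarith
  have := fills_of_modes (m := 2) (B := b₀ + 2 * Real.pi) (E := 2 * Real.pi - (b - b₀))
    (d := ![1 / 2, (Λ - 1) ^ 2 / 8]) hC hs hab ha hb le_rfl hb₀ le_rfl le_rfl (by linarith)
    (by rw [hΛ']; exact hΛ2) (by linarith) (by simpa using hE0)
    (le_of_eq (by rw [← abs_of_nonneg hE0]; congr 1; ring))
    (fun B ho => ?_) (fun t ht h0 => absurd h0 (hz t ht)) (fun k => ?_)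
    (fun k t ht => ?_) (fun k => ?_)
  · rwa [add_sub_cancel_left] at this
  · have fam := eigenFamily_sine hab 2
    have hw := hC.sub (fam.isH1_combo B)
    have h := sine_gap_two hab hw (by simp [ha, combo, sine_left])
      (by simp [hb, combo, sine_right hab]) ho
    refine le_trans ?_ h
    have h0 : 0 ≤ ∫ t in b₀..b, ‖C t - combo (fun k : Fin 2 => sine b₀ b k) B t‖ ^ 2 :=
      intervalIntegral.integral_nonneg hab.le fun _ _ => sq_nonneg _
    have h3 : 3 / 2 ≤ 3 * Real.pi / (b - b₀) := by rw [le_div_iff₀ hba]; linarith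
    have : 1 + gapOf δ ≤ (3 * Real.pi / (b - b₀)) ^ 2 :=
      (gapOf_le hδ0 hδ).trans (by nlinarith)
    gcongr
  · fin_cases k <;> simp; positivity
  · rw [hΛ']
    fin_cases k
    · simpa [hf0] using half_mode_gain hΛ1 hΛ2 ht
    · simpa [hf1] using mode_gain (by linarith) hΛ2 ht
  · have h3 : (b - b₀) ^ 2 ≤ 4 * Real.pi ^ 2 := by nlinarith
    have h4 : Λ ^ 2 ≤ 4 := by nlinarith
    have h5 : (Λ - 1) ^ 2 ≤ 1 := by nlinarith
    fin_cases k
    · simp only [Fin.zero_eta, hf0, dispConst, hk, Matrix.cons_val_zero]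
      calc ((Λ - 1) * (b - b₀)) ^ 2 * (Λ / 2) ^ 2
          = (Λ - 1) ^ 2 * (b - b₀) ^ 2 * Λ ^ 2 / 4 := by ring
        _ ≤ 1 * (4 * Real.pi ^ 2) * 4 / 4 := by gcongr
        _ ≤ 512 * Real.pi ^ 2 * (1 / 2) := by nlinarith [sq_nonneg Real.pi]
    · simp only [Fin.mk_one, hf1, dispConst, hk, Matrix.cons_val_one,
        Matrix.cons_val_fin_one]
      calc ((Λ - 1) * (b - b₀)) ^ 2 * Λ ^ 2
          = (Λ - 1) ^ 2 * ((b - b₀) ^ 2 * Λ ^ 2) := by ring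
        _ ≤ (Λ - 1) ^ 2 * (4 * Real.pi ^ 2 * 4) := by gcongr
        _ ≤ 512 * Real.pi ^ 2 * ((Λ - 1) ^ 2 / 8) := by
          nlinarith [mul_nonneg (sq_nonneg Real.pi) (sq_nonneg (Λ - 1))]

/-- The competitor for a datum on the whole circle, without zeros. -/
theorem fills_circle (hC : IsH1 C C') (hper : Function.Periodic C (2 * Real.pi))
    (hs : IsSpeed (gapOf δ) dispConst s) (hδ0 : 0 < δ) (hδ : δ ≤ 2 * Real.pi / 3)
    (hz : ∀ t, C t ≠ 0) :
    Fills C C' b₀ s b₀ (b₀ + 2 * Real.pi) b₀ (b₀ + 2 * Real.pi) (2 * Real.pi) := by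
  have hpi := Real.pi_pos
  have hlt : b₀ < b₀ + 2 * Real.pi := by linarith
  have fam := eigenFamily_trig b₀
  set β := projCoeff (trig b₀) ![2 * Real.pi, Real.pi, Real.pi] b₀ (b₀ + 2 * Real.pi) C with hβ
  have hort := fun i => fam.integral_smul_sub_proj hC.continuous i
  have hv := fam.isH1_combo β
  have hw := hC.sub hv
  have hvp : combo (trig b₀) β (b₀ + 2 * Real.pi) = combo (trig b₀) β b₀ := by
    refine Finset.sum_congr rfl fun i _ => ?_
    fin_cases i <;> simp [trig]
  set P : PieceData n :=
    { m := ⟨s, 0, 0⟩, K := dampRate (gapOf δ), y₀ := b₀, y₁ := b₀ + 2 * Real.pi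
      v := combo (trig b₀) β
      v' := combo (trigDeriv b₀) β
      w := fun t => C t - combo (trig b₀) β t
      w' := fun t => C' t - combo (trigDeriv b₀) β t } with hP
  have hwp : P.w (b₀ + 2 * Real.pi) = P.w b₀ := by simp only [hP, hvp, hper b₀]
  have hdisp : ∀ y, P.m.disp y = 0 := fun y => by simp [hP, Motion.disp]
  have hang : ∀ r y, P.m.ang (r, y) = y := fun r y => by simp [Motion.ang, hdisp]
  have mV : P.massV = ∑ k, ![2 * Real.pi, Real.pi, Real.pi] k * ‖β k‖ ^ 2 :=
    fam.integral_norm_combo β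
  have dV : P.dirV = ∑ k, ![0, 1, 1] k * (![2 * Real.pi, Real.pi, Real.pi] k * ‖β k‖ ^ 2) :=
    fam.integral_norm_combo_deriv β
  have hgap : 9 / 4 * P.massW ≤ P.dirW := trig_gap hw hwp hort
  have hW0 : 0 ≤ P.massW := P.massW_nonneg hlt.le
  have him : P.Improving b₀ (gapOf δ) dispConst (2 * Real.pi) 0 {t | C t ≠ 0} := by
    refine
    { adm := ⟨⟨fun r _ => by simp [hP, Motion.lam], fun r _ => (hang _ _).ge,
          fun r _ => (hang _ _).le, hlt⟩, hv, hw, Or.inr ⟨rfl, rfl, rfl, hvp, hwp⟩⟩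
      orth := ⟨fam.integral_inner_eq_zero hw.toIsPrimitive hort β,
        fam.integral_inner_deriv_eq_zero hw.toIsPrimitive hort (fun i => ?_) β⟩
      gap_pos := hs.gap_pos
      gap := le_trans (mul_le_mul_of_nonneg_right (gapOf_le hδ0 hδ) hW0) hgap
      rate := rfl
      speed_nonneg := hs.pos.le
      speed_le := hs.le_half
      speed_rate := hs.rate
      speed_kin := hs.kin
      const_nonneg := hs.const_nonneg
      p₁_le := by simp [hP]
      gain_nonneg := le_rfl
      gain := fun t ht => ?_
      disp_sq := by simp [hdisp]
      disp_le := fun y _ => by rw [hdisp, abs_zero]; positivity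
      meas := measurableSet_ne_zero hC.continuous
      zero := fun y _ hy => absurd (not_not.1 hy) (hz y)
      target := ?_ }
    · have := hwp
      simp only [hP] at this
      rw [this]
      fin_cases i <;> simp [trigDeriv]
    -- Nothing moves and gain 0 suffices: constants have negative energy and degree one has zero
    -- energy, so dirV ≤ massV, and multiplying a nonpositive number by 1 - t does not decrease it.
    · simp only [hP, mul_zero, add_zero, div_one, one_mul, sub_zero]
      have : P.dirV ≤ P.massV := by
        rw [mV, dV]
        simp only [Fin.sum_univ_three]
        simp
        positivity
      simp only [hP] at this
      nlinarith [ht.1]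
    · have h1 : volume.real ({t | C t ≠ 0} ∩ Ioo b₀ (b₀ + 2 * Real.pi)) ≤ 2 * Real.pi := by
        refine (measureReal_mono inter_subset_right measure_Ioo_lt_top.ne).trans (le_of_eq ?_)
        rw [Real.volume_real_Ioo_of_le hlt.le]; ring
      simp only [hP]
      linarith
  have := him.fills (C := C) (C' := C') (fun t => by simp [hP]) (fun t => by simp [hP])
  simpa only [hdisp, add_zero] using this

end Fill

end Epi

end

/-! ### The one-homogeneous extension -/

noncomputable section

namespace Epi

variable {n : ℕ}

theorem measurableSet_disc : MeasurableSet disc := Metric.isOpen_ball.measurableSet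

theorem exists_polar (x : Plane) (b : ℝ) :
    ∃ θ ∈ Ico b (b + 2 * Real.pi), x = ‖x‖ • circlePoint θ := by
  set z : ℂ := ⟨x 0, x 1⟩ with hz
  have hn : ‖z‖ = ‖x‖ := by
    rw [EuclideanSpace.norm_eq, Complex.norm_def, Complex.normSq_apply]
    simp [hz, Fin.sum_univ_two, sq]
  obtain ⟨θ, hθ, e⟩ := circlePoint_periodic.exists_mem_Ico (by positivity : 0 < 2 * Real.pi)
    z.arg b
  refine ⟨θ, hθ, ?_⟩
  rw [← e, ← hn]
  have h0 := Complex.norm_mul_cos_arg z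
  have h1 := Complex.norm_mul_sin_arg z
  ext i
  fin_cases i
  · exact h0.symm
  · exact h1.symm

/-- The rays with angles in a null set form a null set. -/
theorem volume_rays_eq_zero {N : Set ℝ} (hN : volume N = 0) :
    volume {x : Plane | ∃ r : ℝ, ∃ θ ∈ N, x = r • circlePoint θ} = 0 := by
  set m : Motion := ⟨0, 0, 0⟩ with hm
  have h0 : volume ((univ : Set ℝ) ×ˢ N) = 0 := by
    rw [Measure.volume_eq_prod, Measure.prod_prod, hN, mul_zero]
  have h1 : volume (m.ptPair '' (univ ×ˢ N)) = 0 :=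
    addHaar_image_eq_zero_of_differentiableOn_of_addHaar_eq_zero volume
      (fun q _ => (Motion.hasFDerivAt_ptPair q).differentiableAt.differentiableWithinAt) h0
  have h2 : volume (planeEquiv '' (m.ptPair '' (univ ×ˢ N))) = 0 := by
    rw [MeasurableEquiv.image_eq_preimage_symm,
      (measurePreserving_planeEquiv.symm).measure_preimage_equiv, h1]
  refine measure_mono_null ?_ h2
  rintro x ⟨r, θ, hθ, rfl⟩
  refine ⟨_, ⟨(r, θ), ⟨mem_univ _, hθ⟩, rfl⟩, ?_⟩
  rw [Motion.planeEquiv_ptPair]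
  simp [Motion.pt, Motion.ang, hm]

/-- The one-homogeneous extension as a motionless piece. -/
def homPiece (C C' : ℝ → Target n) (b : ℝ) : PieceData n where
  m := ⟨0, 0, 0⟩
  K := 0
  y₀ := b
  y₁ := b + 2 * Real.pi
  v := C
  v' := C'
  w := 0
  w' := 0

variable {C C' : ℝ → Target n} {b : ℝ}

theorem homPiece_admissible (hC : IsH1 C C') (hper : Function.Periodic C (2 * Real.pi)) :
    (homPiece C C' b).Admissible b where
  good := ⟨fun r _ => by simp [homPiece, Motion.lam],
    fun r _ => by simp [homPiece, Motion.ang],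
    fun r _ => by simp [homPiece, Motion.ang],
    by simp only [homPiece]; linarith [Real.pi_pos]⟩
  hv := hC
  hw := IsH1.of_hasDerivAt (fun t => hasDerivAt_const t 0) continuous_const
  bd := Or.inr ⟨rfl, rfl, rfl, hper b, rfl⟩

/-- The two functions can differ only on rays whose angle lies in the null set where c and C
disagree, and on the slit at angle b. -/
theorem homPiece_fn_ae_eq (hC : IsH1 C C') (hper : Function.Periodic C (2 * Real.pi))
    {c : Plane → Target n} (hc : ∀ᵐ θ, c (circlePoint θ) = C θ) :
    ∀ᵐ x ∂volume.restrict disc, (homPiece C C' b).fn x = oneHomExt c x := by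
  have hN : volume ({θ | c (circlePoint θ) ≠ C θ} ∪ {b}) = 0 :=
    measure_union_null hc (measure_singleton b)
  rw [ae_restrict_iff' measurableSet_disc]
  have hnull := volume_rays_eq_zero hN
  rw [measure_eq_zero_iff_ae_notMem] at hnull
  filter_upwards [hnull] with x hx hxd
  obtain ⟨θ, hθ, e⟩ := exists_polar x b
  have hθN : θ ∉ {θ | c (circlePoint θ) ≠ C θ} ∪ {b} := fun h => hx ⟨_, θ, h, e⟩
  rw [mem_union, not_or] at hθN
  have h1 : c (circlePoint θ) = C θ := not_not.1 hθN.1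
  have h2 : θ ≠ b := hθN.2
  have hx0 : 0 < ‖x‖ := by
    rw [norm_pos_iff]
    rintro rfl
    exact hx ⟨0, b, Or.inr rfl, by simp⟩
  have hx1 : ‖x‖ < 1 := mem_ball_zero_iff.1 hxd
  set r := ‖x‖ with hr
  have hq : (r, θ) ∈ rect (homPiece C C' b).y₀ (homPiece C C' b).y₁ :=
    ⟨⟨hx0, hx1⟩, ⟨lt_of_le_of_ne hθ.1 h2.symm, hθ.2⟩⟩
  have hpt : (homPiece C C' b).m.pt (r, θ) = x := by
    rw [e]; simp [homPiece, Motion.pt, Motion.ang]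
  have h3 := (homPiece_admissible (b := b) hC hper).good.lift_pt (homPiece C C' b).field hq
  rw [hpt] at h3
  rw [PieceData.fn, h3, oneHomExt, ← hr]
  have h4 : r⁻¹ • x = circlePoint θ := by
    rw [e, smul_smul, inv_mul_cancel₀ hx0.ne', one_smul]
  rw [h4]
  simp [PieceData.field, homPiece, h1]

theorem homPiece_volume (hC : IsH1 C C') (hper : Function.Periodic C (2 * Real.pi)) :
    volume.real ({x | 0 < ‖(homPiece C C' b).fn x‖} ∩ disc) =
      (∫ y in b..(b + 2 * Real.pi), {t | C t ≠ 0}.indicator (1 : ℝ → ℝ) y) / 2 := by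
  have hle : b ≤ b + 2 * Real.pi := by linarith [Real.pi_pos]
  have hm : MeasurableSet {q : ℝ × ℝ | C q.2 ≠ 0} :=
    measurable_snd (measurableSet_ne_zero hC.continuous)
  have hfin : IsFiniteMeasure (volume.restrict (rect b (b + 2 * Real.pi))) := by
    rw [restrict_rect]; infer_instance
  obtain ⟨K, hK⟩ := exists_bound_rect (y₀ := b) (y₁ := b + 2 * Real.pi) continuous_fst
  have hi : IntegrableOn (fun q : ℝ × ℝ => q.1 * {q : ℝ × ℝ | C q.2 ≠ 0}.indicator 1 q)
      (rect b (b + 2 * Real.pi)) :=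
    Integrable.bdd_mul ((integrable_const (1 : ℝ)).indicator hm)
      continuous_fst.aestronglyMeasurable hK
  have e : ∫ q in rect b (b + 2 * Real.pi), (homPiece C C' b).m.jac q *
      {q | (homPiece C C' b).field q ≠ 0}.indicator 1 q =
      ∫ q in rect b (b + 2 * Real.pi), q.1 * {q : ℝ × ℝ | C q.2 ≠ 0}.indicator 1 q := by
    refine setIntegral_congr_fun measurableSet_rect fun q hq => ?_
    have h0 : q.1 ≠ 0 := hq.1.1.ne'
    simp [homPiece, Motion.jac, Motion.lam, PieceData.field, indicator, h0]
  rw [(homPiece_admissible (b := b) hC hper).volume_pos]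
  refine e.trans ?_
  rw [integral_rect hi hle]
  set J := ∫ y in b..(b + 2 * Real.pi), {t | C t ≠ 0}.indicator (1 : ℝ → ℝ) y with hJ
  have : ∀ r : ℝ, ∫ y in b..(b + 2 * Real.pi), r * {q : ℝ × ℝ | C q.2 ≠ 0}.indicator 1 (r, y) =
      r * J := fun r => by
    rw [intervalIntegral.integral_const_mul]
    rfl
  simp only [this]
  rw [intervalIntegral.integral_mul_const, integral_id]
  ring

/-- The one-homogeneous extension and its Weiss energy. -/
theorem weissV_oneHomExt (hC : IsH1 C C') (hper : Function.Periodic C (2 * Real.pi))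
    {c : Plane → Target n} (hcm : MemLp c 2 arcLength) (hc : ∀ᵐ θ, c (circlePoint θ) = C θ)
    (b : ℝ) :
    MemH1Disc (oneHomExt c) ∧ IsTrace (oneHomExt c) c ∧
      weissV (oneHomExt c) = ringEnergy C C' b (b + 2 * Real.pi) / 2 := by
  set P := homPiece C C' b with hP
  have adm : P.Admissible b := homPiece_admissible hC hper
  have hae := homPiece_fn_ae_eq (b := b) hC hper hc
  obtain ⟨h1, h2, h3⟩ := weissV_of_gaussGreen (u := oneHomExt c) (G := P.gradFn) (b := b)
    ((memLp_congr_ae hae).1 adm.memLp_fn) adm.memLp_gradFn hcm hper hc fun j φ hφ => by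
      have := adm.gaussGreen hφ j
      have hd : ∀ y, P.datum y = C y := fun y => add_zero _
      simp only [hd] at this
      refine Eq.trans ?_ this
      refine integral_congr_ae ?_
      filter_upwards [hae] with x hx
      simp only [← hx]
      rfl
  refine ⟨h1, h2, h3.trans ?_⟩
  have hvol : volume.real ({x | 0 < ‖oneHomExt c x‖} ∩ disc) =
      volume.real ({x | 0 < ‖P.fn x‖} ∩ disc) := by
    refine measureReal_congr ?_
    rw [ae_restrict_iff' measurableSet_disc] at hae
    filter_upwards [hae] with x hx
    refine propext (and_congr_left fun hxd => ?_)
    simp only [mem_ofPred_eq]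
    rw [← hx hxd]
  have ho : P.Orthogonal := ⟨by simp [hP, homPiece], by simp [hP, homPiece]⟩
  have he := (adm.energy_eq ho).2
  have hden : ∀ r, P.weissDensity r = r * (P.dirV - P.massV) := fun r => by
    have hW : P.dirW = 0 := by simp [hP, homPiece, PieceData.dirW]
    have hW' : P.massW = 0 := by simp [hP, homPiece, PieceData.massW]
    have he0 : ∀ y, P.eta r y = 0 := fun y => by simp [hP, homPiece, PieceData.eta]
    have hl : P.m.lam r = 1 := by simp [hP, homPiece, Motion.lam]
    simp [PieceData.weissDensity, hW, hW', he0, hl]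
  have hW' : P.massW = 0 := by simp [hP, homPiece, PieceData.massW]
  simp only [hden] at he
  rw [intervalIntegral.integral_mul_const, integral_id, hW', add_zero] at he
  have e1 : P.massV = ∫ y in b..(b + 2 * Real.pi), ‖C y‖ ^ 2 := rfl
  have e2 : P.dirV = ∫ y in b..(b + 2 * Real.pi), ‖C' y‖ ^ 2 := rfl
  rw [hvol, homPiece_volume hC hper, ringEnergy, ← e1, ← e2]
  linarith

end Epi

end

/-! ### Case distinction by the long zero-free arcs -/

noncomputable section

namespace Epi

variable {n : ℕ}

theorem integral_indicator_mono {C : ℝ → Target n} (hC : Continuous C) {x y a b : ℝ} (hxa : x ≤ a)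
    (hab : a ≤ b) (hby : b ≤ y) (hz : ∀ t ∈ Ioo a b, C t ≠ 0) :
    b - a ≤ ∫ t in x..y, {t | C t ≠ 0}.indicator (1 : ℝ → ℝ) t := by
  rw [integral_indicator_eq (measurableSet_ne_zero hC) (hxa.trans (hab.trans hby)),
    ← Real.volume_real_Ioo_of_le hab]
  refine measureReal_mono (fun t ht => ⟨hz t ht, hxa.trans_lt ht.1, ht.2.trans_le hby⟩) ?_
  exact ((measure_mono inter_subset_right).trans_lt measure_Ioo_lt_top).ne

/-- The length of the positivity set on the circle. -/
theorem arcLength_pos_eq {C : ℝ → Target n} {c : Plane → Target n} (hcm : MemLp c 2 arcLength)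
    (hper : Function.Periodic C (2 * Real.pi)) (hc : ∀ᵐ θ, c (circlePoint θ) = C θ) (b : ℝ) :
    arcLength.real ({x | 0 < ‖c x‖} ∩ unitCircle) =
      ∫ t in b..(b + 2 * Real.pi), {t | C t ≠ 0}.indicator (1 : ℝ → ℝ) t := by
  have hS : NullMeasurableSet {x | 0 < ‖c x‖} arcLength :=
    nullMeasurableSet_lt aemeasurable_const hcm.1.norm.aemeasurable
  have e1 : arcLength.real ({x | 0 < ‖c x‖} ∩ unitCircle) = arcLength.real {x | 0 < ‖c x‖} := by
    refine measureReal_congr ?_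
    filter_upwards [ae_arcLength_mem_unitCircle] with x hx
    exact propext (and_iff_left hx)
  have e2 : arcLength.real {x | 0 < ‖c x‖} =
      ∫ x, {x | 0 < ‖c x‖}.indicator (1 : Plane → ℝ) x ∂arcLength := by
    rw [integral_indicator₀ hS]
    simp
  rw [e1, e2]
  refine integral_arcLength_period (f := {x | 0 < ‖c x‖}.indicator (1 : Plane → ℝ))
    (g := {t | C t ≠ 0}.indicator (1 : ℝ → ℝ)) ?_ ?_ ?_ b
  · exact aestronglyMeasurable_const.indicator₀ hS
  · intro t
    simp [indicator, hper t]
  · filter_upwards [hc] with θ hθ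
    simp [indicator, hθ]

section Cases

variable {C C' : ℝ → Target n} {δ s : ℝ}

theorem shortGaps_of_length {L x y : ℝ} (h : y - x ≤ L) : ShortGaps C L x y :=
  fun p q hp _ hq _ _ _ => by linarith

/-- The two arcs are moved to the half circles [p, p + π] and [p + π, p + 2π]. The two intervals
between them have total length less than δ ≤ π - δ/2 and contract to points. Since the second arc is
the shorter one, k = π - (q' - p') is nonnegative; its near end moves by at most k and its far end
by at most 2k, hence the factor 2 in `fills_one`. -/
theorem fills_two_long (hC : IsH1 C C') (hper : Function.Periodic C (2 * Real.pi))
    (hs : IsSpeed (gapOf δ) dispConst s) (hδ0 : 0 < δ) (hδ : δ ≤ 2 * Real.pi / 3)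
    {p q p' q' : ℝ} (hp : C p = 0) (hq : C q = 0) (hp' : C p' = 0) (hq' : C q' = 0)
    (hz : ∀ t ∈ Ioo p q, C t ≠ 0) (hz' : ∀ t ∈ Ioo p' q', C t ≠ 0)
    (h1 : q ≤ p') (h2 : q' ≤ p + 2 * Real.pi) (h3 : Real.pi - δ / 2 < q' - p')
    (h4 : q' - p' ≤ q - p) :
    Fills C C' p s p (p + 2 * Real.pi) p (p + 2 * Real.pi) (2 * Real.pi) ∧
      2 * Real.pi - δ <
        ∫ t in p..(p + 2 * Real.pi), {t | C t ≠ 0}.indicator (1 : ℝ → ℝ) t := by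
  have hpi := Real.pi_pos
  have hs0 := hs.pos.le
  have hs1 : s ≤ 1 := by linarith [hs.le_half]
  have hpe : C (p + 2 * Real.pi) = 0 := by rw [hper, hp]
  have hle : q' - p' ≤ Real.pi := by linarith
  have hk : |Real.pi - (q' - p')| = Real.pi - (q' - p') := abs_of_nonneg (by linarith)
  constructor
  · have f1 : Fills C C' p s p q p (p + Real.pi) Real.pi :=
      fills_one hC hs hδ0 hδ hp hq le_rfl (by linarith) le_rfl (by linarith) (by linarith) (by linarith)
        (by simp) (by
          have : p + Real.pi - q = Real.pi - (q - p) := by ring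
          rw [this]; linarith [abs_nonneg (Real.pi - (q - p))]) hz
    have f2 : Fills C C' p s q p' (p + Real.pi) (p + Real.pi) 0 :=
      fills_point hC hs hδ0 hδ h1 hq hp' (by linarith) (by linarith) (by linarith) (by linarith)
        (shortGaps_of_length (by linarith))
    have f3 : Fills C C' p s p' q' (p + Real.pi) (p + Real.pi + Real.pi) Real.pi :=
      fills_one hC hs hδ0 hδ hp' hq' (by linarith) h2 (by linarith) le_rfl (by linarith)
        (by linarith) (by rw [hk, abs_le]; constructor <;> linarith)
        (by rw [hk, abs_le]; constructor <;> linarith) hz'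
    have f4 : Fills C C' p s q' (p + 2 * Real.pi) (p + Real.pi + Real.pi)
        (p + Real.pi + Real.pi) 0 :=
      fills_point hC hs hδ0 hδ h2 hq' hpe (by linarith) le_rfl (by linarith) (by linarith)
        (shortGaps_of_length (by linarith))
    have g1 := f1.append hC f2 hs0 hs1 (by linarith) h1 (by linarith) le_rfl
    have g2 := g1.append hC f3 hs0 hs1 (by linarith) (by linarith) (by linarith) (by linarith)
    have g3 := g2.append hC f4 hs0 hs1 (by linarith) h2 (by linarith) le_rfl
    have e1 : p + Real.pi + Real.pi = p + 2 * Real.pi := by ring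
    have e2 : Real.pi + 0 + Real.pi + 0 = 2 * Real.pi := by ring
    rwa [e1, e2] at g3
  · have m1 := integral_indicator_mono hC.continuous (x := p) (y := q) le_rfl (by linarith) le_rfl hz
    have m2 := integral_indicator_mono hC.continuous (x := q) h1 (by linarith) h2 hz'
    rw [← intervalIntegral.integral_add_adjacent_intervals
      (intervalIntegrable_indicator hC.continuous p q) (intervalIntegrable_indicator hC.continuous _ _)]
    linarith

/-- The limit length is governed by the number of zero-free arcs longer than π - δ/2. Whenever it
exceeds π, the arcs responsible already make the positivity set longer than 2π - δ. -/
theorem exists_fills (hC : IsH1 C C') (hper : Function.Periodic C (2 * Real.pi))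
    (hs : IsSpeed (gapOf δ) dispConst s) (hδ0 : 0 < δ) (hδ : δ ≤ 2 * Real.pi / 3) :
    ∃ b A B L, Fills C C' b s b (b + 2 * Real.pi) A B L ∧ L ≤ 2 * Real.pi ∧
      ((∫ t in b..(b + 2 * Real.pi), {t | C t ≠ 0}.indicator (1 : ℝ → ℝ) t) ≤
        2 * Real.pi - δ → L ≤ Real.pi) := by
  have hpi := Real.pi_pos
  have hs0 := hs.pos.le
  have hs1 : s ≤ 1 := by linarith [hs.le_half]
  by_cases hz : ∀ t, C t ≠ 0
  · refine ⟨0, _, _, _, fills_circle hC hper hs hδ0 hδ hz, le_rfl, fun h => ?_⟩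
    have := integral_indicator_mono hC.continuous (x := 0) (a := 0) (b := 0 + 2 * Real.pi) le_rfl
      (by linarith) le_rfl fun t _ => hz t
    linarith
  push Not at hz
  obtain ⟨t₀, ht₀⟩ := hz
  by_cases hsh : ShortGaps C (Real.pi - δ / 2) t₀ (t₀ + 2 * Real.pi)
  · exact ⟨t₀, t₀, t₀, 0, fills_point hC hs hδ0 hδ (by linarith) ht₀ (by rw [hper, ht₀]) le_rfl
      le_rfl le_rfl (by linarith) hsh, by linarith, fun _ => hpi.le⟩
  rw [ShortGaps] at hsh
  push Not at hsh
  -- The period is now based at the left end of a long arc, so that this arc comes first and need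
  -- not be moved at p.
  obtain ⟨p, q, hp₀, hpq, hq₀, hp, hq, hz, hl⟩ := hsh
  have hqp : q ≤ p + 2 * Real.pi := by linarith
  have hpe : C (p + 2 * Real.pi) = 0 := by rw [hper, hp]
  -- Beyond this length the second eigenvalue no longer guarantees the gap, so two modes are kept.
  -- The complement is shorter than δ ≤ π - δ/2 and contracts.
  by_cases hlong : 2 * Real.pi - δ < q - p
  · have f1 := fills_two hC hs hδ0 hδ hp hq hqp (by linarith) hz
    have f2 : Fills C C' p s q (p + 2 * Real.pi) (p + 2 * Real.pi) (p + 2 * Real.pi) 0 :=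
      fills_point hC hs hδ0 hδ hqp hq hpe hpq.le le_rfl (by linarith) le_rfl
        (shortGaps_of_length (by linarith))
    refine ⟨p, _, _, _, f1.append hC f2 hs0 hs1 hpq.le hqp (by linarith) le_rfl, by linarith,
      fun h => ?_⟩
    have := integral_indicator_mono hC.continuous le_rfl hpq.le hqp hz
    linarith
  by_cases hsh : ShortGaps C (Real.pi - δ / 2) q (p + 2 * Real.pi)
  · have f1 : Fills C C' p s p q p (p + Real.pi) Real.pi :=
      fills_one hC hs hδ0 hδ hp hq le_rfl (by linarith) le_rfl (by linarith) (by linarith) (by linarith)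
        (by simp) (by
          have : p + Real.pi - q = Real.pi - (q - p) := by ring
          rw [this]; linarith [abs_nonneg (Real.pi - (q - p))]) hz
    have f2 : Fills C C' p s q (p + 2 * Real.pi) (p + Real.pi) (p + Real.pi) 0 :=
      fills_point hC hs hδ0 hδ hqp hq hpe hpq.le le_rfl (by linarith) (by linarith) hsh
    exact ⟨p, _, _, _, f1.append hC f2 hs0 hs1 hpq.le hqp (by linarith) le_rfl, by linarith,
      fun h => by linarith⟩
  rw [ShortGaps] at hsh
  push Not at hsh
  obtain ⟨p', q', hp₀', hpq', hq₀', hp', hq', hz', hl'⟩ := hsh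
  rcases le_total (q' - p') (q - p) with h | h
  · obtain ⟨f, hf⟩ := fills_two_long hC hper hs hδ0 hδ hp hq hp' hq' hz hz' hp₀' hq₀' hl' h
    exact ⟨p, _, _, _, f, le_rfl, fun h => by linarith⟩
  -- The longer arc must come first: the period is based at p' and the other arc is translated by
  -- 2π.
  · obtain ⟨f, hf⟩ := fills_two_long hC hper hs hδ0 hδ hp' hq' hpe (by rw [hper, hq]) hz'
      (p' := p + 2 * Real.pi) (q' := q + 2 * Real.pi)
      (fun t ht => by
        have := hz (t - 2 * Real.pi) ⟨by linarith [ht.1], by linarith [ht.2]⟩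
        rwa [hper.sub_eq] at this) hq₀' (by linarith) (by linarith) (by linarith)
    exact ⟨p', _, _, _, f, le_rfl, fun h => by linarith⟩

end Cases

end Epi

end

/-! ### Conclusion -/

theorem theorem1p3 (n : ℕ) (hn : 1 ≤ n) (δ₀ : ℝ) (hδ₀ : 0 < δ₀) :
    ∃ ε : ℝ, 0 < ε ∧ ∀ c : Epi.Plane → Epi.Target n, Epi.MemH1Circle c →
      (Epi.MemH1Disc (Epi.oneHomExt c) ∧ Epi.IsTrace (Epi.oneHomExt c) c) ∧
      (Epi.arcLength.real ({x | 0 < ‖c x‖} ∩ Epi.unitCircle) ≤ 2 * Real.pi - δ₀ →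
        ∃ h : Epi.Plane → Epi.Target n, Epi.MemH1Disc h ∧ Epi.IsTrace h c ∧
          Epi.weissV h - Real.pi / 2 ≤
            (1 - ε) * (Epi.weissV (Epi.oneHomExt c) - Real.pi / 2)) ∧
      (∃ h : Epi.Plane → Epi.Target n, Epi.MemH1Disc h ∧ Epi.IsTrace h c ∧
          Epi.weissV h - Real.pi ≤
            (1 - ε) * (Epi.weissV (Epi.oneHomExt c) - Real.pi)) := by
  have hpi := Real.pi_pos
  -- The bound δ ≤ 2π/3 is equivalent to δ ≤ π - δ/2, so leftover intervals shorter than δ are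
  -- short, and it gives 1 + `gapOf δ` ≤ 9/4. Lowering δ₀ to δ only relaxes the hypothesis of (i).
  set δ := min δ₀ (2 * Real.pi / 3) with hδ
  have hδ0 : 0 < δ := by positivity
  have hδ1 : δ ≤ 2 * Real.pi / 3 := min_le_right _ _
  obtain ⟨s, hs⟩ := Epi.exists_isSpeed (Epi.gapOf_pos hδ0 hδ1)
    (by unfold Epi.dispConst; positivity : 0 ≤ Epi.dispConst)
  have hs0 := hs.pos
  -- s was chosen from δ alone, so ε is independent of c, and even of n.
  refine ⟨s / 3, by positivity, fun c hc => ?_⟩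
  obtain ⟨C, C', hC, hper, -, hcC⟩ := hc.exists_rep
  obtain ⟨b, A, B, L, hf, hL, hLi⟩ := Epi.exists_fills hC hper hs hδ0 hδ1
  obtain ⟨z1, z2, z3⟩ := Epi.weissV_oneHomExt hC hper hc.1 hcC b
  obtain ⟨u, u1, u2, u3⟩ := hf.exists_competitor hc.1 hper hcC
  -- One competitor serves both parts: W^V(u) ≤ (1 - s/3) W^V(z) + (s/3)(L/2) is monotone in L, and
  -- L is at most π in (i) and at most 2π in (ii).
  refine ⟨⟨z1, z2⟩, fun hpos => ⟨u, u1, u2, ?_⟩, ⟨u, u1, u2, ?_⟩⟩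
  · rw [Epi.arcLength_pos_eq hc.1 hper hcC b] at hpos
    have := hLi (hpos.trans (by linarith [min_le_left δ₀ (2 * Real.pi / 3)]))
    rw [z3]
    nlinarith
  · rw [z3]
    nlinarith
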